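/- **Setting.** Let $T=T_{(\pi,\ell)}:I\to I$ be an interval exchange transformation with irreducible $\pi=(\pi_0,\pi_1)$ on a finite alphabet $\mathcal A$ with $N$ letters, exchanging $I_\alpha=[l_\alpha,r_\alpha)$, $\alpha\in\mathcal A$, and satisfying Keane's condition; $H(\pi)=\Omega_\pi(\mathbb R^{\mathcal A})$, where $\Omega_\pi$ is the translation matrix. Let $\mathcal R$ be Rauzy–Veech induction and $A^{(n)}(T)=A(T)A(\mathcal RT)\cdots A(\mathcal R^{n-1}T)$ the Kontsevich–Zorich cocycle. For an accelerating sequence $0=n_0<n_1<\cdots$ put $T^{(k)}=\mathcal R^{n_k}(T):I^{(k)}\to I^{(k)}$ (exchanging $I^{(k)}_\alpha$), $Q(k,l)=A^{(n_l-n_k)}(T^{(k)})^t$ for $k\le l$, $Q(k)=Q(0,k)$, $Z(k+1)=Q(k,k+1)$, and $Q_\alpha(k,l)=\sum_\beta Q_{\alpha\beta}(k,l)$. Norms on $\mathbb R^{\mathcal A}$ are sup norms and matrices carry operator norms. $S(k,l)\varphi(x)=\sum_{0\le m<Q_\alpha(k,l)}\varphi((T^{(k)})^mx)$ for $x\in I^{(l)}_\alpha$,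 $S(k)=S(0,k)$, and $\mathcal M^{(k)}(f)\in\mathbb R^{\mathcal A}$ is the vector of mean values of $f$ on the $I^{(k)}_\alpha$. $\|\cdot\|_{\sup}$ and $\operatorname{Var}$ are taken over the interiors of the exchanged intervals. Vectors $h\in\mathbb R^{\mathcal A}$ are identified with functions constant on each $I_\alpha$, and $\widetilde h(x)=\int_0^xh$. **Oseledets filtration.** $\lambda_1>\dots>\lambda_g>\lambda_{g+1}=0$ and $\{0\}=E_0\subset E_{-1}\subset\dots\subset E_{-g}\subset E_{g+1}\subset E_g\subset\dots\subset E_1=\mathbb R^{\mathcal A}$ are such that, for the cocycle $Q(n)$ of some accelerating sequence, $\frac1n\log\|Q(n)h\|$ tends to $-\lambda_i$ on $E_{-i}\setminus E_{-i+1}$, to $0$ on $E_{g+1}\setminus E_{-g}$ and to $\lambda_i$ on $E_i\setminus E_{i+1}$, and $\dim E_{-i}-\dim E_{-i+1}=\dim E_i-\dim E_{i+1}=1$ $(1\le i\le g)$. **FFDC.** For $\tau>0$, a *$\tau$-frame* consists of an accelerating sequence $(n_k)$, natural numbers $(r_n)_{n\ge0}$ with $r_0=0$, and a filtration $\{0\}=U_1\subset\dots\subset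 U_{g+1}\subset U_{-g}\subset\dots\subset U_{-1}\subset U_0=\mathbb R^{\mathcal A}$ with $U_{g+1}\subset H(\pi)$ and $E_j\oplus U_j=\mathbb R^{\mathcal A}$ for $-g\le j\le g+1$, such that the following hold for some $C,\kappa\ge1$, $c>0$, where $r(k,l)=\sum_{k\le j<l}r_j$, $E^{(k)}_j=Q(k)E_j$, $U^{(k)}_j=Q(k)U_j$. (i) Rokhlin tower condition: for some $0<\delta<1$ and every $k\ge1$ there is $0<p_k\le\min_\alpha Q_\alpha(0,k)$ such that $T^mI^{(k)}$, $0\le m<p_k$, are disjoint intervals of total measure $\ge\delta|I|$. (ii) $\lim_n r(0,n)/n$ exists and lies in $(1,1+\tau)$. (iii) For $0\le k<l$: $\|Q|_{E^{(k)}_j}(k,l)\|\le Ce^{(\lambda_j+\tau)r(k,l)}$ $(1\le j\le g+1)$; $\|Q|_{E^{(k)}_{-j}}(k,l)\|\le Ce^{(-\lambda_j+\tau)r(k,l)}$ $(1\le j\le g)$; $\|Q|_{U^{(k)}_j}(k,l)^{-1}\|\le Ce^{(-\lambda_{j-1}+\tau)r(k,l)}$ $(2\le j\le g+1)$; $\|Q|_{U^{(k)}_{-j}}(k,l)^{-1}\|\le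 Ce^{(\lambda_{j+1}+\tau)r(k,l)}$ $(0\le j\le g)$. (iv) For $k\ge0$: $\|Z(k+1)\|\le Ce^{\tau k}$; $C^{-1}e^{\lambda_1k}\le\|Q(k)\|\le Ce^{\lambda_1(1+\tau)k}$; $|I^{(k)}|\le\kappa|I^{(k)}_\alpha|$ for all $\alpha$; and $|\sin\angle(E^{(k)}_j,U^{(k)}_j)|\ge c\|Q(k)\|^{-\tau}$ $(-g\le j\le g+1)$. $T$ satisfies the *Full Filtration Diophantine Condition* (FFDC) if a $\tau$-frame exists for every $\tau>0$. **Function spaces.** For $0\le a<1$, $n\ge0$, $C^{n+P_aG}$ is the set of $\varphi$ of class $C^{n+1}$ on $\bigcup_\alpha(l_\alpha,r_\alpha)$ such that $p_a(D^n\varphi)=\sup_{\alpha}\sup_{x\in(l_\alpha,r_\alpha)}|D^{n+1}\varphi(x)|\min\{x-l_\alpha,r_\alpha-x\}^{1+a}<\infty$, the limits $C^+_\alpha=\lim_{x\searrow l_\alpha}D^{n+1}\varphi(x)(x-l_\alpha)^{1+a}$ and $C^-_\alpha=\lim_{x\nearrow r_\alpha}D^{n+1}\varphi(x)(r_\alpha-x)^{1+a}$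 exist, and $C^-_{\pi_0^{-1}(N)}C^-_{\pi_1^{-1}(N)}=0=C^+_{\pi_0^{-1}(1)}C^+_{\pi_1^{-1}(1)}$. Put $\|\varphi\|_{C^{n+P_a}}=\sum_{k=0}^n\|D^k\varphi\|_{L^1(I)}+p_a(D^n\varphi)$. "Linear" on such a set means: compatible with every linear combination that stays in the set. **Operators and series.** Given a frame, with $P_{U^{(k)}_j}$ the projection onto $U^{(k)}_j$ along $E^{(k)}_j$, put $\mathfrak h_i(\varphi)=\lim_kQ(k)^{-1}P_{U^{(k)}_i}\mathcal M^{(k)}S(k)\varphi$ and $\mathfrak h^*_j(\varphi)=\lim_kQ(k)^{-1}P_{U^{(k)}_{-j}}\mathcal M^{(k)}S(k)\varphi$ when these limits exist, and $C_i^{1+P_aG}=\{\varphi\in C^{1+P_aG}:\mathfrak h_i(D\varphi)=0\}$. Let $\langle s\rangle^a=s^a$ if $a>0$ and $1+\log s$ if $a=0$, and $$K_k=\sum_{l\ge k}\|Q|_{U^{(k)}_i}(k,l+1)^{-1}\|\,\|Z(l+1)\|\,\langle\|Q(l)\|\rangle^a\|Q(l+1)\|^\tau,$$ $$C_k=\sum_{0\le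 l<k}\|Q|_{E^{(l+1)}_i}(l+1,k)\|\,\|Z(l+1)\|\,\langle\|Q(l)\|\rangle^a\|Q(l+1)\|^\tau,\qquad s_k=|I^{(k)}|(K_k+C_k),$$ $$V_k=\sum_{l\ge k}\|Q|_{U^{(k)}_{-j}}(k,l+1)^{-1}\|\,\|Q(l+1)\|^\tau\|Z(l+1)\|s_l,\qquad W_k=\sum_{0\le l<k}\|Q|_{E^{(l+1)}_{-j}}(l+1,k)\|\,\|Q(l+1)\|^\tau\|Z(l+1)\|s_l.$$ **Theorem.** Let $T$ satisfy the FFDC, and let $0\le a<1$, $2\le i\le g+1$, $1\le j\le g$ with $a\lambda_1<\lambda_{i-1}$ and $\max\{a\lambda_1,\lambda_i\}<\lambda_1-\lambda_{j+1}$. 1. Let $0<\tau<\frac{\lambda_1-\lambda_{j+1}-\max\{a\lambda_1,\lambda_i\}}{9(1+\lambda_1)}$ and $\tau<\frac{\lambda_{i-1}-\lambda_1a}{3(1+\lambda_1)}$, and fix any $\tau$-frame. Then $\mathfrak h^*_j:C_i^{1+P_aG}\to U_{-j}$ is well defined, linear and bounded (for $\|\cdot\|_{C^{1+P_a}}$);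 the series $K_k$ and $V_k$ converge; and there is $C\ge1$ such that for all $\varphi\in C_i^{1+P_aG}$ with $\mathfrak h^*_j(\varphi)=0$ and all $k\ge0$, $$\operatorname{Var}(S(k)\varphi)\le Cs_k\|D\varphi\|_{C^{0+P_a}},\qquad \|\mathcal M^{(k)}(S(k)\varphi)\|\le C\big((W_k+V_k)\|D\varphi\|_{C^{0+P_a}}+\|Q|_{E_{-j}}(k)\|\,\|\varphi\|_{\sup}\big),$$ where $$s_k=O\big(e^{(\max\{\lambda_i,\lambda_1a\}-\lambda_1+6\tau(1+\lambda_1))r(0,k+1)}\big),\quad V_k=O\big(e^{(\max\{\lambda_i,\lambda_1a\}-\lambda_1+8\tau(1+\lambda_1))r(0,k)}\big),$$ $$W_k=O\big(e^{(\max\{\lambda_i-\lambda_1,\lambda_1a-\lambda_1,-\lambda_j\}+9\tau(1+\lambda_1))r(0,k)}\big).$$ 2. There is $\tau_*>0$ such that for every $0<\tau_0\le\tau_*$ and every $\tau_0$-frame (with filtration $U$ and operators $\mathfrak h_i,\mathfrak h_j^*$) there is a bounded linear operator $\mathfrak h_{-j,i}:C^{1+P_aG}\to U_{-j}$ with the following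 properties. For every $\varphi\in C^{1+P_aG}$, $\mathfrak h_i(D\varphi)\in U_i$ exists and $\mathfrak h_{-j,i}(\varphi)=\mathfrak h^*_j\big(\varphi-\widetilde{\mathfrak h_i(D\varphi)}\big)$. Moreover, for every $\tau>0$, every $\tau_1$ with $0<\tau_1\le\tau_*$ and $9\tau_1(1+\lambda_1)\le\tau$, and every $\tau_1$-frame, there is a constant $C$ such that for every $\varphi\in C^{1+P_aG}$ with $\mathfrak h_{-j,i}(\varphi)=0$ and $\mathfrak h_i(D\varphi)=0$, $$\|S(k)\varphi\|_{\sup}\le C\,e^{(\max\{\lambda_i-\lambda_1,\ \lambda_1a-\lambda_1,\ -\lambda_j\}+\tau)\,r(0,k)}\,\|\varphi\|_{C^{1+P_a}}\qquad\text{for all }k\ge0,$$ where $S(k)$ and $r(0,k)$ are those of the $\tau_1$-frame. -/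

import Mathlib

open Filter Topology MeasureTheory Set

noncomputable section

/-- Combinatorial and length data `(π, λ)` on an alphabet with `d + 1` letters; positions are
numbered `0, …, d`. -/
structure IETData (𝒜 : Type*) (d : ℕ) where
  π₀ : 𝒜 ≃ Fin (d + 1)
  π₁ : 𝒜 ≃ Fin (d + 1)
  len : 𝒜 → ℝ

/-! ### Linear algebra on `ℝ^𝒜` (with the sup norm) -/

/-- Norm of the restriction to `W` of the linear map with matrix `M`. -/
def opNormOn {𝒜 : Type*} [Fintype 𝒜] [DecidableEq 𝒜] (M : Matrix 𝒜 𝒜 ℝ)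
    (W : Submodule ℝ (𝒜 → ℝ)) : ℝ :=
  ‖LinearMap.toContinuousLinearMap ((Matrix.toLin' M).domRestrict W)‖

/-- Norm of the linear map with matrix `M`. -/
def opNorm {𝒜 : Type*} [Fintype 𝒜] [DecidableEq 𝒜] (M : Matrix 𝒜 𝒜 ℝ) : ℝ :=
  ‖LinearMap.toContinuousLinearMap (Matrix.toLin' M)‖

open Classical in
/-- The projection onto `p` along `q` (for complementary subspaces). -/
def projAlong {V : Type*} [AddCommGroup V] [Module ℝ V] (p q : Submodule ℝ V) : V →ₗ[ℝ] V :=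
  if h : IsCompl p q then Submodule.projection p q h else 0

/-- A map defined on a set `V` of functions (not assumed to be a linear subspace) respects all
linear combinations that stay in `V`. -/
def LinearOn {𝒜 : Type*} (V : Set (ℝ → ℝ)) (F : (ℝ → ℝ) → (𝒜 → ℝ)) : Prop :=
  ∀ (s t : ℝ) (φ ψ : ℝ → ℝ), φ ∈ V → ψ ∈ V → s • φ + t • ψ ∈ V →
    F (s • φ + t • ψ) = s • F φ + t • F ψ

namespace IETData

variable {𝒜 : Type*} [Fintype 𝒜] [DecidableEq 𝒜] {d : ℕ}

/-! ### Interval exchange transformations -/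

def left (T : IETData 𝒜 d) (α : 𝒜) : ℝ := ∑ β with T.π₀ β < T.π₀ α, T.len β

def right (T : IETData 𝒜 d) (α : 𝒜) : ℝ := ∑ β with T.π₀ β ≤ T.π₀ α, T.len β

/-- The length `|I|`. -/
def total (T : IETData 𝒜 d) : ℝ := ∑ β, T.len β

/-- The interval `I`. -/
def domain (T : IETData 𝒜 d) : Set ℝ := Ico 0 T.total

/-- The exchanged interval `I_α`. -/
def piece (T : IETData 𝒜 d) (α : 𝒜) : Set ℝ := Ico (T.left α) (T.right α)

/-- The interior of `I_α`. -/
def inner (T : IETData 𝒜 d) (α : 𝒜) : Set ℝ := Ioo (T.left α) (T.right α)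

/-- The translation matrix `Ω_π`. -/
def Omega (T : IETData 𝒜 d) : Matrix 𝒜 𝒜 ℝ := fun α β =>
  if T.π₁ β < T.π₁ α ∧ T.π₀ α < T.π₀ β then 1
  else if T.π₁ α < T.π₁ β ∧ T.π₀ β < T.π₀ α then -1
  else 0

/-- The space `H(π) = Ω_π(ℝ^𝒜)`. -/
def H (T : IETData 𝒜 d) : Submodule ℝ (𝒜 → ℝ) := LinearMap.range (Matrix.toLin' T.Omega)

/-- The interval exchange transformation: `x ↦ x + w_α` on `I_α`, where `w = Ω_π λ`. -/
def toFun (T : IETData 𝒜 d) (x : ℝ) : ℝ :=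
  x + ∑ α, (T.piece α).indicator (fun _ => T.Omega.mulVec T.len α) x

/-- Irreducible permutation pair and positive lengths. -/
structure IsIET (T : IETData 𝒜 d) : Prop where
  pos : ∀ α, 0 < T.len α
  irreducible : ∀ k : ℕ, 1 ≤ k → k < d + 1 →
    {β | (T.π₀ β : ℕ) < k} ≠ {β | (T.π₁ β : ℕ) < k}

def Keane (T : IETData 𝒜 d) : Prop :=
  ∀ (m : ℕ) (α β : 𝒜), 1 ≤ m → T.π₀ β ≠ 0 → T.toFun^[m] (T.left α) ≠ T.left β

/-! ### Rauzy–Veech induction and the accelerated Kontsevich–Zorich cocycle -/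

/-- The last letter of the top row. -/
def topLetter (T : IETData 𝒜 d) : 𝒜 := T.π₀.symm (Fin.last d)

/-- The last letter of the bottom row. -/
def botLetter (T : IETData 𝒜 d) : 𝒜 := T.π₁.symm (Fin.last d)

open Classical in
/-- One step of Rauzy–Veech induction. The loser is moved, in the row where it is last, to the
place directly after the winner; its length is subtracted from the length of the winner. -/
def rauzy (T : IETData 𝒜 d) : IETData 𝒜 d :=
  if T.len T.botLetter < T.len T.topLetter then
    { π₀ := T.π₀
      π₁ := T.π₁.trans (Fin.cycleIcc (T.π₁ T.topLetter + 1) (Fin.last d))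
      len := Function.update T.len T.topLetter (T.len T.topLetter - T.len T.botLetter) }
  else
    { π₀ := T.π₀.trans (Fin.cycleIcc (T.π₀ T.botLetter + 1) (Fin.last d))
      π₁ := T.π₁
      len := Function.update T.len T.botLetter (T.len T.botLetter - T.len T.topLetter) }

open Classical in
/-- The matrix `A(T) = Id + E_{winner, loser}`. -/
def stepMatrix (T : IETData 𝒜 d) : Matrix 𝒜 𝒜 ℕ :=
  if T.len T.botLetter < T.len T.topLetter then
    1 + Matrix.single T.topLetter T.botLetter 1
  else
    1 + Matrix.single T.botLetter T.topLetter 1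

/-- `A^{(n)}(T) = A(T) A(R T) ⋯ A(R^{n-1} T)`. -/
def cocycle (T : IETData 𝒜 d) : ℕ → Matrix 𝒜 𝒜 ℕ
  | 0 => 1
  | n + 1 => T.stepMatrix * cocycle T.rauzy n

/-- An accelerating sequence. -/
def IsAccelerating (n : ℕ → ℕ) : Prop := n 0 = 0 ∧ StrictMono n

/-- `T^{(k)} = R^{n_k}(T)`. -/
def acc (T : IETData 𝒜 d) (n : ℕ → ℕ) (k : ℕ) : IETData 𝒜 d := rauzy^[n k] T

/-- `Q(k,l)`, with its natural number entries (used for `k ≤ l`). -/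
def Qnat (T : IETData 𝒜 d) (n : ℕ → ℕ) (k l : ℕ) : Matrix 𝒜 𝒜 ℕ :=
  ((T.acc n k).cocycle (n l - n k)).transpose

/-- `Q(k,l)` as a real matrix. -/
def Q (T : IETData 𝒜 d) (n : ℕ → ℕ) (k l : ℕ) : Matrix 𝒜 𝒜 ℝ :=
  (T.Qnat n k l).map (Nat.cast : ℕ → ℝ)

/-- `Z(k) = Q(k-1,k)` for `k ≥ 1`. -/
def Z (T : IETData 𝒜 d) (n : ℕ → ℕ) (k : ℕ) : Matrix 𝒜 𝒜 ℝ := T.Q n (k - 1) k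

/-- The return time `Q_α(k,l) = ∑_β Q_{αβ}(k,l)`. -/
def returnTime (T : IETData 𝒜 d) (n : ℕ → ℕ) (k l : ℕ) (α : 𝒜) : ℕ := ∑ β, T.Qnat n k l α β

/-- `W^{(k)} = Q(k) W` for a subspace `W` of `ℝ^𝒜`. -/
def push (T : IETData 𝒜 d) (n : ℕ → ℕ) (k : ℕ) (W : Submodule ℝ (𝒜 → ℝ)) :
    Submodule ℝ (𝒜 → ℝ) := W.map (Matrix.toLin' (T.Q n 0 k))

/-- `‖Q|_{W^{(k)}}(k,l)‖`. -/
def normQ (T : IETData 𝒜 d) (n : ℕ → ℕ) (W : Submodule ℝ (𝒜 → ℝ)) (k l : ℕ) : ℝ :=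
  opNormOn (T.Q n k l) (T.push n k W)

/-- `‖Q|_{W^{(k)}}(k,l)⁻¹‖`: the norm of the inverse of `Q(k,l) : W^{(k)} → W^{(l)}`. -/
def normQInv (T : IETData 𝒜 d) (n : ℕ → ℕ) (W : Submodule ℝ (𝒜 → ℝ)) (k l : ℕ) : ℝ :=
  opNormOn (T.Q n k l)⁻¹ (T.push n l W)

/-- Special Birkhoff sums `S(k,l)φ` over `T^{(k)}`, a function on `I^{(l)}` (extended by zero). -/
def S (T : IETData 𝒜 d) (n : ℕ → ℕ) (k l : ℕ) (φ : ℝ → ℝ) (x : ℝ) : ℝ :=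
  ∑ α, ((T.acc n l).piece α).indicator
    (fun y => ∑ m ∈ Finset.range (T.returnTime n k l α), φ ((T.acc n k).toFun^[m] y)) x

/-- Mean values of `f` on the exchanged intervals of `T`. -/
def mean (T : IETData 𝒜 d) (f : ℝ → ℝ) : 𝒜 → ℝ := fun α =>
  (T.right α - T.left α)⁻¹ * ∫ x in T.piece α, f x

/-- The piecewise constant function with value `h α` on `I_α`. -/
def stepFun (T : IETData 𝒜 d) (h : 𝒜 → ℝ) (x : ℝ) : ℝ :=
  ∑ α, (T.piece α).indicator (fun _ => h α) x

/-- The primitive `x ↦ ∫_0^x h` of the piecewise constant function given by `h`. -/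
def primitive (T : IETData 𝒜 d) (h : 𝒜 → ℝ) (x : ℝ) : ℝ := ∫ y in (0 : ℝ)..x, T.stepFun h y

/-! ### The Full Filtration Diophantine Condition -/

/-- `E` is an Oseledets filtration of `T` with exponents `λ_1 > ⋯ > λ_g > λ_{g+1} = 0`, for the
cocycle accelerated along `m`. -/
structure IsOseledets (T : IETData 𝒜 d) (m : ℕ → ℕ) (g : ℕ) (lam : ℕ → ℝ)
    (E : ℤ → Submodule ℝ (𝒜 → ℝ)) : Prop where
  lam_anti : ∀ i, 1 ≤ i → i ≤ g → lam (i + 1) < lam i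
  lam_zero : lam (g + 1) = 0
  E_zero : E 0 = ⊥
  E_neg_le : ∀ i : ℕ, 1 ≤ i → i ≤ g → E (-(i : ℤ) + 1) ≤ E (-(i : ℤ))
  E_center : E (-(g : ℤ)) ≤ E ((g : ℤ) + 1)
  E_pos_le : ∀ i : ℕ, 1 ≤ i → i ≤ g → E ((i : ℤ) + 1) ≤ E (i : ℤ)
  E_one : E 1 = ⊤
  lim_neg : ∀ i : ℕ, 1 ≤ i → i ≤ g → ∀ h ∈ E (-(i : ℤ)), h ∉ E (-(i : ℤ) + 1) →
    Tendsto (fun n : ℕ => Real.log ‖(T.Q m 0 n).mulVec h‖ / n) atTop (𝓝 (-lam i))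
  lim_center : ∀ h ∈ E ((g : ℤ) + 1), h ∉ E (-(g : ℤ)) →
    Tendsto (fun n : ℕ => Real.log ‖(T.Q m 0 n).mulVec h‖ / n) atTop (𝓝 0)
  lim_pos : ∀ i : ℕ, 1 ≤ i → i ≤ g → ∀ h ∈ E (i : ℤ), h ∉ E ((i : ℤ) + 1) →
    Tendsto (fun n : ℕ => Real.log ‖(T.Q m 0 n).mulVec h‖ / n) atTop (𝓝 (lam i))
  dim_neg : ∀ i : ℕ, 1 ≤ i → i ≤ g →
    Module.finrank ℝ (E (-(i : ℤ))) = Module.finrank ℝ (E (-(i : ℤ) + 1)) + 1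
  dim_pos : ∀ i : ℕ, 1 ≤ i → i ≤ g →
    Module.finrank ℝ (E (i : ℤ)) = Module.finrank ℝ (E ((i : ℤ) + 1)) + 1

/-- `U` is a filtration complementary to `E`. -/
structure IsComplementary (T : IETData 𝒜 d) (g : ℕ) (E U : ℤ → Submodule ℝ (𝒜 → ℝ)) :
    Prop where
  U_one : U 1 = ⊥
  U_pos_le : ∀ i : ℕ, 1 ≤ i → i ≤ g → U (i : ℤ) ≤ U ((i : ℤ) + 1)
  U_center : U ((g : ℤ) + 1) ≤ U (-(g : ℤ))
  U_neg_le : ∀ i : ℕ, 1 ≤ i → i ≤ g → U (-(i : ℤ)) ≤ U (-(i : ℤ) + 1)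
  U_zero : U 0 = ⊤
  U_le_H : U ((g : ℤ) + 1) ≤ T.H
  compl : ∀ j : ℤ, -(g : ℤ) ≤ j → j ≤ (g : ℤ) + 1 → IsCompl (E j) (U j)

/-- Rokhlin Tower Condition for `T` with the acceleration `n`. -/
def RTC (T : IETData 𝒜 d) (n : ℕ → ℕ) : Prop :=
  ∃ δ : ℝ, 0 < δ ∧ δ < 1 ∧ ∀ k : ℕ, 1 ≤ k → ∃ p : ℕ, 0 < p ∧
    (∀ α, p ≤ T.returnTime n 0 k α) ∧
    (∀ i < p, (T.toFun^[i] '' (T.acc n k).domain).OrdConnected) ∧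
    (∀ i < p, ∀ j < p, i ≠ j →
      Disjoint (T.toFun^[i] '' (T.acc n k).domain) (T.toFun^[j] '' (T.acc n k).domain)) ∧
    ENNReal.ofReal (δ * T.total) ≤ volume (⋃ i ∈ Finset.range p, T.toFun^[i] '' (T.acc n k).domain)

/-- The objects whose existence, for each parameter `τ`, is required by the FFDC: an accelerating
sequence `(n_k)`, a sequence `(r_n)` and a filtration `U`. -/
structure Frame (𝒜 : Type*) where
  n : ℕ → ℕ
  r : ℕ → ℕ
  U : ℤ → Submodule ℝ (𝒜 → ℝ)

/-- `r(k,l) = ∑_{k ≤ j < l} r_j`. -/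
def Frame.rsum (D : Frame 𝒜) (k l : ℕ) : ℝ := ∑ j ∈ Finset.Ico k l, (D.r j : ℝ)

/-- `D` fulfils the requirements of the FFDC with parameter `τ`. -/
structure IsFrame (T : IETData 𝒜 d) (g : ℕ) (lam : ℕ → ℝ) (E : ℤ → Submodule ℝ (𝒜 → ℝ))
    (τ : ℝ) (D : Frame 𝒜) : Prop where
  accelerating : IsAccelerating D.n
  r_zero : D.r 0 = 0
  complementary : T.IsComplementary g E D.U
  rtc : T.RTC D.n
  r_lim : ∃ L : ℝ, 1 < L ∧ L < 1 + τ ∧ Tendsto (fun n : ℕ => D.rsum 0 n / n) atTop (𝓝 L)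
  bounds : ∃ C κ c : ℝ, 1 ≤ C ∧ 1 ≤ κ ∧ 0 < c ∧
    (∀ k l : ℕ, k < l → ∀ j : ℕ, 1 ≤ j → j ≤ g + 1 →
      T.normQ D.n (E j) k l ≤ C * Real.exp ((lam j + τ) * D.rsum k l)) ∧
    (∀ k l : ℕ, k < l → ∀ j : ℕ, 1 ≤ j → j ≤ g →
      T.normQ D.n (E (-(j : ℤ))) k l ≤ C * Real.exp ((-lam j + τ) * D.rsum k l)) ∧
    (∀ k l : ℕ, k < l → ∀ j : ℕ, 2 ≤ j → j ≤ g + 1 →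
      T.normQInv D.n (D.U j) k l ≤ C * Real.exp ((-lam (j - 1) + τ) * D.rsum k l)) ∧
    (∀ k l : ℕ, k < l → ∀ j : ℕ, j ≤ g →
      T.normQInv D.n (D.U (-(j : ℤ))) k l ≤ C * Real.exp ((lam (j + 1) + τ) * D.rsum k l)) ∧
    (∀ k : ℕ, opNorm (T.Z D.n (k + 1)) ≤ C * Real.exp (τ * k)) ∧
    (∀ k : ℕ, C⁻¹ * Real.exp (lam 1 * k) ≤ opNorm (T.Q D.n 0 k) ∧
      opNorm (T.Q D.n 0 k) ≤ C * Real.exp (lam 1 * (1 + τ) * k)) ∧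
    (∀ (k : ℕ) (α : 𝒜), (T.acc D.n k).total / (T.acc D.n k).len α ≤ κ) ∧
    (∀ (k : ℕ) (j : ℤ), -(g : ℤ) ≤ j → j ≤ (g : ℤ) + 1 →
      ∀ e ∈ T.push D.n k (E j), ∀ u ∈ T.push D.n k (D.U j), e ≠ 0 → u ≠ 0 →
        c * opNorm (T.Q D.n 0 k) ^ (-τ) ≤
          |Real.sin (InnerProductGeometry.angle (WithLp.toLp 2 e : EuclideanSpace ℝ 𝒜)
            (WithLp.toLp 2 u))|)

/-- The Full Filtration Diophantine Condition for `T`, with Lyapunov exponents `λ_1, …, λ_g`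
and Oseledets filtration `E`. -/
structure FFDC (T : IETData 𝒜 d) (g : ℕ) (lam : ℕ → ℝ) (E : ℤ → Submodule ℝ (𝒜 → ℝ)) :
    Prop where
  isIET : T.IsIET
  keane : T.Keane
  oseledets : ∃ m : ℕ → ℕ, IsAccelerating m ∧ T.IsOseledets m g lam E
  frames : ∀ τ : ℝ, 0 < τ → ∃ D : Frame 𝒜, T.IsFrame g lam E τ D

/-! ### The spaces `C^{n+P_a}` and `C^{n+P_aG}` -/

/-- The values `|ψ'(x)| min(x - l_α, r_α - x)^{1+a}` whose supremum is `p_a(ψ)`. -/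
def paSet (T : IETData 𝒜 d) (a : ℝ) (ψ : ℝ → ℝ) : Set ℝ :=
  {y | ∃ α, ∃ x ∈ T.inner α, y = |deriv ψ x| * min (x - T.left α) (T.right α - x) ^ (1 + a)}

/-- `p_a(ψ)`. -/
def pa (T : IETData 𝒜 d) (a : ℝ) (ψ : ℝ → ℝ) : ℝ := sSup (T.paSet a ψ)

/-- The set `C^{n+P_aG}`: functions of class `C^{n+1}` on the interiors of the `I_α`, with finite
`p_a(D^nφ)`, for which the limits `C^±` at the ends of the `I_α` exist (here `cp`, `cm`, up to
sign) and are of geometric type. Values outside the interiors of the `I_α` play no role. -/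
def CPaG (T : IETData 𝒜 d) (a : ℝ) (n : ℕ) : Set (ℝ → ℝ) :=
  {φ | (∀ α, ContDiffOn ℝ ((n + 1 : ℕ) : WithTop ℕ∞) φ (T.inner α)) ∧
    BddAbove (T.paSet a (iteratedDeriv n φ)) ∧
    ∃ cp cm : 𝒜 → ℝ,
      (∀ α, Tendsto (fun x => iteratedDeriv (n + 1) φ x * (x - T.left α) ^ (1 + a))
        (𝓝[>] T.left α) (𝓝 (cp α))) ∧
      (∀ α, Tendsto (fun x => iteratedDeriv (n + 1) φ x * (T.right α - x) ^ (1 + a))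
        (𝓝[<] T.right α) (𝓝 (cm α))) ∧
      cm (T.π₀.symm (Fin.last d)) * cm (T.π₁.symm (Fin.last d)) = 0 ∧
      cp (T.π₀.symm 0) * cp (T.π₁.symm 0) = 0}

/-- The norm of `C^{n+P_a}`. -/
def normPa (T : IETData 𝒜 d) (a : ℝ) (n : ℕ) (φ : ℝ → ℝ) : ℝ :=
  (∑ k ∈ Finset.range (n + 1), ∫ x in T.domain, |iteratedDeriv k φ x|) +
    T.pa a (iteratedDeriv n φ)

/-- The supremum of `|φ|` over the interiors of the `I_α`. -/
def supNorm (T : IETData 𝒜 d) (φ : ℝ → ℝ) : ℝ := sSup ((fun x => |φ x|) '' ⋃ α, T.inner α)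

/-- The sum of the variations of `φ` on the interiors of the `I_α`. -/
def Var (T : IETData 𝒜 d) (φ : ℝ → ℝ) : ENNReal := ∑ α, eVariationOn φ (T.inner α)

/-! ### Correction operators and the associated series -/

/-- `IsCorrection T E D j φ h`: the sequence
`Q(0,k)⁻¹ ∘ P_{U_j^{(k)}} ∘ M^{(k)} ∘ S(k) (φ)` converges to `h`, where `P_{U_j^{(k)}}` is the
projection along `E_j^{(k)}`. For `j = i ≥ 2` this says `𝔥_i(φ) = h`; for `j = -m ≤ 0` it
says `𝔥*_m(φ) = h`. -/
def IsCorrection (T : IETData 𝒜 d) (E : ℤ → Submodule ℝ (𝒜 → ℝ)) (D : Frame 𝒜) (j : ℤ)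
    (φ : ℝ → ℝ) (h : 𝒜 → ℝ) : Prop :=
  Tendsto (fun k : ℕ => (T.Q D.n 0 k)⁻¹.mulVec
    (projAlong (T.push D.n k (D.U j)) (T.push D.n k (E j))
      ((T.acc D.n k).mean (T.S D.n 0 k φ)))) atTop (𝓝 h)

/-- The set `C_i^{1+P_aG}` of those `φ ∈ C^{1+P_aG}` with `𝔥_i(Dφ) = 0`. -/
def CiPaG (T : IETData 𝒜 d) (E : ℤ → Submodule ℝ (𝒜 → ℝ)) (D : Frame 𝒜) (a : ℝ) (i : ℕ) :
    Set (ℝ → ℝ) :=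
  {φ | φ ∈ T.CPaG a 1 ∧ T.IsCorrection E D i (deriv φ) 0}

/-- `⟨s⟩^a`, which is `s^a` for `a > 0` and `1 + log s` for `a = 0`. -/
def bracket (a s : ℝ) : ℝ := if 0 < a then s ^ a else 1 + Real.log s

/-- The term with index `l ≥ k` of the series `K_k^{a,i,τ}`. -/
def Kterm (T : IETData 𝒜 d) (D : Frame 𝒜) (a : ℝ) (i : ℕ) (τ : ℝ) (k l : ℕ) : ℝ :=
  T.normQInv D.n (D.U i) k (l + 1) * opNorm (T.Z D.n (l + 1)) *
    bracket a (opNorm (T.Q D.n 0 l)) * opNorm (T.Q D.n 0 (l + 1)) ^ τ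

/-- `K_k^{a,i,τ}(T)`. -/
def Kseries (T : IETData 𝒜 d) (D : Frame 𝒜) (a : ℝ) (i : ℕ) (τ : ℝ) (k : ℕ) : ℝ :=
  ∑' m : ℕ, T.Kterm D a i τ k (k + m)

/-- `C_k^{a,i,τ}(T)`. -/
def Cseries (T : IETData 𝒜 d) (E : ℤ → Submodule ℝ (𝒜 → ℝ)) (D : Frame 𝒜) (a : ℝ) (i : ℕ)
    (τ : ℝ) (k : ℕ) : ℝ :=
  ∑ l ∈ Finset.range k, T.normQ D.n (E i) (l + 1) k * opNorm (T.Z D.n (l + 1)) *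
    bracket a (opNorm (T.Q D.n 0 l)) * opNorm (T.Q D.n 0 (l + 1)) ^ τ

/-- `s_k = |I^{(k)}| (K_k^{a,i,τ} + C_k^{a,i,τ})`. -/
def sSeq (T : IETData 𝒜 d) (E : ℤ → Submodule ℝ (𝒜 → ℝ)) (D : Frame 𝒜) (a : ℝ) (i : ℕ)
    (τ : ℝ) (k : ℕ) : ℝ :=
  (T.acc D.n k).total * (T.Kseries D a i τ k + T.Cseries E D a i τ k)

/-- The term with index `l ≥ k` of the series `V_k^{j,τ}(s)`. -/
def Vterm (T : IETData 𝒜 d) (D : Frame 𝒜) (j : ℕ) (τ : ℝ) (s : ℕ → ℝ) (k l : ℕ) : ℝ :=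
  T.normQInv D.n (D.U (-(j : ℤ))) k (l + 1) * opNorm (T.Q D.n 0 (l + 1)) ^ τ *
    opNorm (T.Z D.n (l + 1)) * s l

/-- `V_k^{j,τ}(T, s)`. -/
def Vseries (T : IETData 𝒜 d) (D : Frame 𝒜) (j : ℕ) (τ : ℝ) (s : ℕ → ℝ) (k : ℕ) : ℝ :=
  ∑' m : ℕ, T.Vterm D j τ s k (k + m)

/-- `W_k^{j,τ}(T, s)`. -/
def Wseries (T : IETData 𝒜 d) (E : ℤ → Submodule ℝ (𝒜 → ℝ)) (D : Frame 𝒜) (j : ℕ) (τ : ℝ)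
    (s : ℕ → ℝ) (k : ℕ) : ℝ :=
  ∑ l ∈ Finset.range k, T.normQ D.n (E (-(j : ℤ))) (l + 1) k *
    opNorm (T.Q D.n 0 (l + 1)) ^ τ * opNorm (T.Z D.n (l + 1)) * s l

end IETData

end

set_option linter.unusedSectionVars false

noncomputable section

variable {𝒜 : Type*} [Fintype 𝒜] [DecidableEq 𝒜] {d : ℕ}

/-- Total length of the letters placed before `γ` by the ordering `π`. -/
def posOf (π : 𝒜 ≃ Fin (d + 1)) (len : 𝒜 → ℝ) (γ : 𝒜) : ℝ := ∑ β with π β < π γ, len β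

theorem posOf_add_len (π : 𝒜 ≃ Fin (d + 1)) (len : 𝒜 → ℝ) (γ : 𝒜) :
    posOf π len γ + len γ = ∑ β with π β ≤ π γ, len β := by
  have : (Finset.univ.filter fun β => π β ≤ π γ) =
      insert γ (Finset.univ.filter fun β => π β < π γ) := by
    ext β
    simp only [Finset.mem_filter, Finset.mem_univ, true_and, Finset.mem_insert, le_iff_lt_or_eq,
      EmbeddingLike.apply_eq_iff_eq]
    tauto
  rw [this, Finset.sum_insert (by simp), posOf, add_comm]

theorem posOf_nonneg (π : 𝒜 ≃ Fin (d + 1)) {len : 𝒜 → ℝ} (h : ∀ α, 0 < len α) (γ : 𝒜) :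
    0 ≤ posOf π len γ := Finset.sum_nonneg fun β _ => (h β).le

theorem posOf_add_len_le_posOf (π : 𝒜 ≃ Fin (d + 1)) {len : 𝒜 → ℝ} (h : ∀ α, 0 < len α)
    {β γ : 𝒜} (hlt : π β < π γ) : posOf π len β + len β ≤ posOf π len γ := by
  rw [posOf_add_len]
  refine Finset.sum_le_sum_of_subset_of_nonneg (fun δ hδ => ?_) fun i _ _ => (h i).le
  simp only [Finset.mem_filter, Finset.mem_univ, true_and] at hδ ⊢
  exact hδ.trans_lt hlt

theorem posOf_add_len_le_total (π : 𝒜 ≃ Fin (d + 1)) {len : 𝒜 → ℝ} (h : ∀ α, 0 < len α)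
    (γ : 𝒜) : posOf π len γ + len γ ≤ ∑ β, len β := by
  rw [posOf_add_len]
  exact Finset.sum_le_sum_of_subset_of_nonneg (Finset.filter_subset _ _) fun i _ _ => (h i).le

theorem posOf_last (π : 𝒜 ≃ Fin (d + 1)) (len : 𝒜 → ℝ) {γ : 𝒜} (hγ : π γ = Fin.last d) :
    posOf π len γ = ∑ β, len β - len γ := by
  rw [eq_sub_iff_add_eq, posOf_add_len, Finset.filter_true_of_mem]
  intro β _
  rw [hγ]
  exact Fin.le_last _

theorem posOf_first (π : 𝒜 ≃ Fin (d + 1)) (len : 𝒜 → ℝ) {γ : 𝒜} (hγ : π γ = 0) :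
    posOf π len γ = 0 := by
  rw [posOf, Finset.filter_false_of_mem, Finset.sum_empty]
  intro β _
  rw [hγ]
  exact Fin.not_lt_zero _

theorem eq_of_mem_posOf (π : 𝒜 ≃ Fin (d + 1)) {len : 𝒜 → ℝ} (h : ∀ α, 0 < len α) {β γ : 𝒜}
    {x : ℝ} (h1 : posOf π len β ≤ x) (h2 : x < posOf π len β + len β)
    (h3 : posOf π len γ ≤ x) (h4 : x < posOf π len γ + len γ) : β = γ := by
  rcases lt_trichotomy (π β) (π γ) with hlt | heq | hlt
  · have := posOf_add_len_le_posOf π h hlt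
    linarith
  · exact π.injective heq
  · have := posOf_add_len_le_posOf π h hlt
    linarith

theorem exists_mem_posOf (π : 𝒜 ≃ Fin (d + 1)) (len : 𝒜 → ℝ) {x : ℝ} (h0 : 0 ≤ x)
    (h1 : x < ∑ β, len β) : ∃ γ, posOf π len γ ≤ x ∧ x < posOf π len γ + len γ := by
  classical
  obtain ⟨γ, hγ, hmax⟩ := Finset.exists_max_image
    (Finset.univ.filter fun γ => posOf π len γ ≤ x) π
    ⟨π.symm 0, by simp [posOf_first π len (γ := π.symm 0) (by simp), h0]⟩
  simp only [Finset.mem_filter, Finset.mem_univ, true_and] at hγ hmax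
  refine ⟨γ, hγ, ?_⟩
  by_contra! hle
  by_cases hlast : π γ = Fin.last d
  · rw [posOf_last π len hlast] at hle
    linarith
  · have hlt : π γ < π γ + 1 := Fin.lt_add_one_iff.2 (lt_of_le_of_ne (Fin.le_last _) hlast)
    refine absurd (hmax (π.symm (π γ + 1)) ?_) (by rw [Equiv.apply_symm_apply]; exact not_le.2 hlt)
    refine le_trans (le_of_eq ?_) hle
    rw [posOf_add_len, posOf]
    congr 1
    ext β
    simp only [Finset.mem_filter, Finset.mem_univ, true_and, Equiv.apply_symm_apply]
    rw [Fin.lt_def, Fin.le_def, Fin.val_add_one_of_lt (lt_of_le_of_ne (Fin.le_last _) hlast)]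
    omega

/-- The ordering in which the last letter is moved to the place directly after `w`. -/
def moveLast (π : 𝒜 ≃ Fin (d + 1)) (w : 𝒜) : 𝒜 ≃ Fin (d + 1) :=
  π.trans (Fin.cycleIcc (π w + 1) (Fin.last d))

theorem moveLast_val (π : 𝒜 ≃ Fin (d + 1)) {w l : 𝒜} (hl : π l = Fin.last d) (hwl : w ≠ l)
    (γ : 𝒜) : (moveLast π w γ : ℕ) =
      if γ = l then (π w : ℕ) + 1 else if (π γ : ℕ) ≤ π w then (π γ : ℕ) else π γ + 1 := by
  have hw : π w < Fin.last d :=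
    lt_of_le_of_ne (Fin.le_last _) fun h => hwl (π.injective (h.trans hl.symm))
  have hval : ((π w + 1 : Fin (d + 1)) : ℕ) = π w + 1 := Fin.val_add_one_of_lt hw
  have hle : π w + 1 ≤ Fin.last d := Fin.le_last _
  simp only [moveLast, Equiv.trans_apply]
  split_ifs with h1 h2
  · rw [h1, hl, Fin.cycleIcc_of_last hle, hval]
  · rw [Fin.cycleIcc_of_lt]
    rw [Fin.lt_def, hval]
    omega
  · have hγ : π γ < Fin.last d :=
      lt_of_le_of_ne (Fin.le_last _) fun h => h1 (π.injective (h.trans hl.symm))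
    rw [Fin.cycleIcc_of_ge_of_lt (by rw [Fin.le_def, hval]; omega) hγ, Fin.val_add_one_of_lt hγ]

theorem sum_update_sub (len : 𝒜 → ℝ) {w l : 𝒜} (s : Finset 𝒜) :
    ∑ β ∈ s, Function.update len w (len w - len l) β =
      ∑ β ∈ s, len β - if w ∈ s then len l else 0 := by
  have : ∀ β, Function.update len w (len w - len l) β = len β - if β = w then len l else 0 := by
    intro β
    by_cases h : β = w
    · subst h; simp
    · simp [h]
  simp only [this, Finset.sum_sub_distrib, Finset.sum_ite_eq']

theorem posOf_update_of_last (π : 𝒜 ≃ Fin (d + 1)) (len : 𝒜 → ℝ) {w l : 𝒜}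
    (hw : π w = Fin.last d) (γ : 𝒜) :
    posOf π (Function.update len w (len w - len l)) γ = posOf π len γ := by
  rw [posOf, sum_update_sub, if_neg, sub_zero, posOf]
  simp only [Finset.mem_filter, Finset.mem_univ, true_and, hw, not_lt]
  exact Fin.le_last _

theorem posOf_moveLast (π : 𝒜 ≃ Fin (d + 1)) (len : 𝒜 → ℝ) {w l : 𝒜} (hl : π l = Fin.last d)
    (hwl : w ≠ l) {γ : 𝒜} (hγ : γ ≠ l) :
    posOf (moveLast π w) (Function.update len w (len w - len l)) γ = posOf π len γ := by
  have hlt : ∀ β, β ≠ l → (π β : ℕ) < d := fun β hβ => by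
    have : π β ≠ Fin.last d := fun h => hβ (π.injective (h.trans hl.symm))
    have := lt_of_le_of_ne (Fin.le_last _) this
    simpa [Fin.lt_def] using this
  have hlv : (π l : ℕ) = d := by rw [hl]; rfl
  have h1 : ∀ β, β ≠ l → (moveLast π w β < moveLast π w γ ↔ π β < π γ) := by
    intro β hβ
    rw [Fin.lt_def, Fin.lt_def, moveLast_val π hl hwl, moveLast_val π hl hwl, if_neg hβ, if_neg hγ]
    split_ifs <;> omega
  have h2 : moveLast π w l < moveLast π w γ ↔ π w < π γ := by
    rw [Fin.lt_def, Fin.lt_def, moveLast_val π hl hwl, moveLast_val π hl hwl, if_pos rfl, if_neg hγ]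
    split_ifs <;> omega
  rw [posOf, sum_update_sub]
  simp only [Finset.mem_filter, Finset.mem_univ, true_and, h1 w hwl]
  by_cases hw : π w < π γ
  · have : (Finset.univ.filter fun β => moveLast π w β < moveLast π w γ) =
        insert l (Finset.univ.filter fun β => π β < π γ) := by
      ext β
      simp only [Finset.mem_filter, Finset.mem_univ, true_and, Finset.mem_insert]
      by_cases hβ : β = l
      · subst hβ; simp [h2, hw]
      · simp [hβ, h1 β hβ]
    rw [this, Finset.sum_insert, if_pos hw, posOf, add_sub_cancel_left]
    simp only [Finset.mem_filter, Finset.mem_univ, true_and, hl, not_lt]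
    exact Fin.le_last _
  · have : (Finset.univ.filter fun β => moveLast π w β < moveLast π w γ) =
        Finset.univ.filter fun β => π β < π γ := by
      ext β
      simp only [Finset.mem_filter, Finset.mem_univ, true_and]
      by_cases hβ : β = l
      · subst hβ
        simp only [h2, hw, false_iff, not_lt, hl]
        exact Fin.le_last _
      · exact h1 β hβ
    rw [this, if_neg hw, sub_zero, posOf]

theorem posOf_moveLast_self (π : 𝒜 ≃ Fin (d + 1)) (len : 𝒜 → ℝ) {w l : 𝒜}
    (hl : π l = Fin.last d) (hwl : w ≠ l) :
    posOf (moveLast π w) (Function.update len w (len w - len l)) l =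
      posOf π len w + len w - len l := by
  have : (Finset.univ.filter fun β => moveLast π w β < moveLast π w l) =
      Finset.univ.filter fun β => π β ≤ π w := by
    ext β
    simp only [Finset.mem_filter, Finset.mem_univ, true_and]
    rw [Fin.lt_def, Fin.le_def, moveLast_val π hl hwl, moveLast_val π hl hwl, if_pos rfl]
    have hlv : (π l : ℕ) = d := by rw [hl]; rfl
    have hw : (π w : ℕ) < d := by
      have : π w ≠ Fin.last d := fun h => hwl (π.injective (h.trans hl.symm))
      have := lt_of_le_of_ne (Fin.le_last _) this
      simpa [Fin.lt_def] using this
    by_cases hβ : β = l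
    · subst hβ; simp; omega
    · rw [if_neg hβ]
      split_ifs <;> omega
  rw [posOf, sum_update_sub, this, if_pos (by simp), posOf_add_len]

namespace IETData

theorem left_eq (T : IETData 𝒜 d) (α : 𝒜) : T.left α = posOf T.π₀ T.len α := rfl

theorem right_eq (T : IETData 𝒜 d) (α : 𝒜) : T.right α = T.left α + T.len α :=
  (posOf_add_len _ _ _).symm

theorem Omega_mulVec_len (T : IETData 𝒜 d) (α : 𝒜) :
    T.Omega.mulVec T.len α = posOf T.π₁ T.len α - posOf T.π₀ T.len α := by
  simp only [Matrix.mulVec, dotProduct, posOf, Finset.sum_filter, ← Finset.sum_sub_distrib]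
  refine Finset.sum_congr rfl fun β _ => ?_
  rcases eq_or_ne β α with rfl | hne
  · simp [Omega]
  · have h0 : T.π₀ β ≠ T.π₀ α := fun h => hne (T.π₀.injective h)
    have h1 : T.π₁ β ≠ T.π₁ α := fun h => hne (T.π₁.injective h)
    rcases lt_or_gt_of_ne h0 with h0 | h0 <;> rcases lt_or_gt_of_ne h1 with h1 | h1 <;>
      simp [Omega, h0, h1, h0.not_gt, h1.not_gt]

theorem left_nonneg {T : IETData 𝒜 d} (hpos : ∀ α, 0 < T.len α) (α : 𝒜) :
    0 ≤ T.left α := posOf_nonneg _ hpos _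

theorem left_lt_right {T : IETData 𝒜 d} (hpos : ∀ α, 0 < T.len α) (α : 𝒜) :
    T.left α < T.right α := by
  rw [right_eq]; linarith [hpos α]

theorem right_le_total {T : IETData 𝒜 d} (hpos : ∀ α, 0 < T.len α) (α : 𝒜) :
    T.right α ≤ T.total := by
  rw [right_eq]; exact posOf_add_len_le_total _ hpos _

theorem piece_subset_domain {T : IETData 𝒜 d} (hpos : ∀ α, 0 < T.len α) (α : 𝒜) :
    T.piece α ⊆ T.domain := fun _ hx =>
  ⟨(left_nonneg hpos α).trans hx.1, hx.2.trans_le (right_le_total hpos α)⟩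

theorem eq_of_mem_piece {T : IETData 𝒜 d} (hpos : ∀ α, 0 < T.len α) {α β : 𝒜} {x : ℝ}
    (hα : x ∈ T.piece α) (hβ : x ∈ T.piece β) : α = β :=
  eq_of_mem_posOf T.π₀ hpos hα.1 (by rw [← left_eq, ← right_eq]; exact hα.2) hβ.1
    (by rw [← left_eq, ← right_eq]; exact hβ.2)

theorem exists_mem_piece {T : IETData 𝒜 d} {x : ℝ} (hx : x ∈ T.domain) : ∃ α, x ∈ T.piece α := by
  obtain ⟨γ, h1, h2⟩ := exists_mem_posOf T.π₀ T.len hx.1 hx.2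
  exact ⟨γ, h1, by rw [right_eq]; exact h2⟩

theorem sum_indicator_piece {T : IETData 𝒜 d} (hpos : ∀ α, 0 < T.len α) (F : 𝒜 → ℝ → ℝ)
    {α : 𝒜} {x : ℝ} (hx : x ∈ T.piece α) :
    ∑ β, (T.piece β).indicator (F β) x = F α x := by
  rw [Finset.sum_eq_single α]
  · rw [indicator_of_mem hx]
  · intro β _ hβ
    rw [indicator_of_notMem]
    exact fun h => hβ (eq_of_mem_piece hpos h hx)
  · simp

theorem toFun_eq {T : IETData 𝒜 d} (hpos : ∀ α, 0 < T.len α) {α : 𝒜} {x : ℝ} (hx : x ∈ T.piece α) :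
    T.toFun x = x - T.left α + posOf T.π₁ T.len α := by
  rw [toFun, sum_indicator_piece hpos (fun α _ => T.Omega.mulVec T.len α) hx, Omega_mulVec_len,
    left_eq]
  ring

theorem toFun_mem_posOf {T : IETData 𝒜 d} (hpos : ∀ α, 0 < T.len α) {α : 𝒜} {x : ℝ}
    (hx : x ∈ T.piece α) :
    posOf T.π₁ T.len α ≤ T.toFun x ∧ T.toFun x < posOf T.π₁ T.len α + T.len α := by
  rw [toFun_eq hpos hx]
  have h1 := hx.1
  have h2 := hx.2
  rw [right_eq] at h2
  constructor <;> linarith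

theorem toFun_mem_domain {T : IETData 𝒜 d} (hpos : ∀ α, 0 < T.len α) {x : ℝ}
    (hx : x ∈ T.domain) : T.toFun x ∈ T.domain := by
  obtain ⟨α, hα⟩ := exists_mem_piece hx
  have h := toFun_mem_posOf hpos hα
  exact ⟨(posOf_nonneg _ hpos _).trans h.1, h.2.trans_le (posOf_add_len_le_total _ hpos _)⟩

theorem toFun_injOn {T : IETData 𝒜 d} (hpos : ∀ α, 0 < T.len α) : InjOn T.toFun T.domain := by
  intro x hx y hy hxy
  obtain ⟨α, hα⟩ := exists_mem_piece hx
  obtain ⟨β, hβ⟩ := exists_mem_piece hy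
  have h1 := toFun_mem_posOf hpos hα
  have h2 := toFun_mem_posOf hpos hβ
  rw [← hxy] at h2
  obtain rfl := eq_of_mem_posOf T.π₁ hpos h1.1 h1.2 h2.1 h2.2
  rw [toFun_eq hpos hα, toFun_eq hpos hβ] at hxy
  linarith

theorem left_mem_piece {T : IETData 𝒜 d} (hpos : ∀ α, 0 < T.len α) (α : 𝒜) :
    T.left α ∈ T.piece α := ⟨le_rfl, left_lt_right hpos α⟩

end IETData

theorem setOf_moveLast_lt (π : 𝒜 ≃ Fin (d + 1)) {w l : 𝒜} (hl : π l = Fin.last d) (hwl : w ≠ l)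
    {k : ℕ} (hk : k ≤ π w + 1) : {β | (moveLast π w β : ℕ) < k} = {β | (π β : ℕ) < k} := by
  have hlv : (π l : ℕ) = d := by rw [hl]; rfl
  have hw : (π w : ℕ) < d := by
    have : π w ≠ Fin.last d := fun h => hwl (π.injective (h.trans hl.symm))
    have := lt_of_le_of_ne (Fin.le_last _) this
    simpa [Fin.lt_def] using this
  ext β
  simp only [mem_ofPred_eq]
  rw [moveLast_val π hl hwl]
  by_cases hβ : β = l
  · subst hβ; simp; omega
  · rw [if_neg hβ]
    split_ifs <;> omega

theorem setOf_moveLast_lt_ne (π π' : 𝒜 ≃ Fin (d + 1)) {w l : 𝒜} (hl : π l = Fin.last d)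
    (hwl : w ≠ l) (hw' : π' w = Fin.last d) {k : ℕ} (hk : k < d + 1)
    (h : {β | (π' β : ℕ) < k} ≠ {β | (π β : ℕ) < k}) :
    {β | (π' β : ℕ) < k} ≠ {β | (moveLast π w β : ℕ) < k} := by
  by_cases hkw : k ≤ π w + 1
  · rwa [setOf_moveLast_lt π hl hwl hkw]
  · intro heq
    have h1 : w ∈ {β | (moveLast π w β : ℕ) < k} := by
      rw [mem_ofPred_eq, moveLast_val π hl hwl, if_neg hwl, if_pos le_rfl]
      omega
    rw [← heq, mem_ofPred_eq, hw', Fin.val_last] at h1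
    omega

namespace IETData

/-- `T'` arises from `T` by one step of Rauzy-Veech induction with winner `w` and loser `l`;
the points of the new interval of the loser visit first the interval of `u`, then that of `v`. -/
structure RauzyStep (T T' : IETData 𝒜 d) (w l u v : 𝒜) : Prop where
  ne : w ≠ l
  uv : (u = l ∧ v = w) ∨ (u = w ∧ v = l)
  len_lt : T.len l < T.len w
  len_eq : T'.len = Function.update T.len w (T.len w - T.len l)
  piece_subset : ∀ γ, γ ≠ l → T'.piece γ ⊆ T.piece γ
  toFun_eq : ∀ γ, γ ≠ l → ∀ x ∈ T'.piece γ, T'.toFun x = T.toFun x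
  first : ∀ x ∈ T'.piece l, x ∈ T.piece u
  second : ∀ x ∈ T'.piece l, T.toFun x ∈ T.piece v
  toFun_loser : ∀ x ∈ T'.piece l, T'.toFun x = T.toFun (T.toFun x)
  notMem : ∀ x ∈ T'.piece l, T.toFun x ∉ T'.domain
  left_eq : ∀ γ, γ ≠ l → T'.left γ = T.left γ
  left_loser : T'.left l = T.left l ∨ T.toFun (T'.left l) = T.left l
  first_letter : ∀ γ, T'.π₀ γ = 0 ↔ T.π₀ γ = 0

theorem update_len_pos {len : 𝒜 → ℝ} (hpos : ∀ α, 0 < len α) {w l : 𝒜} (h : len l < len w)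
    (γ : 𝒜) : 0 < Function.update len w (len w - len l) γ := by
  by_cases hγ : γ = w
  · subst hγ; simpa using h
  · simpa [hγ] using hpos γ

theorem rauzyStep_top {T : IETData 𝒜 d} (hpos : ∀ α, 0 < T.len α) {w l : 𝒜}
    (hw : T.π₀ w = Fin.last d) (hl : T.π₁ l = Fin.last d) (hwl : w ≠ l)
    (hlt : T.len l < T.len w) :
    T.RauzyStep ⟨T.π₀, moveLast T.π₁ w, Function.update T.len w (T.len w - T.len l)⟩ w l l w := by
  set T' : IETData 𝒜 d :=
    ⟨T.π₀, moveLast T.π₁ w, Function.update T.len w (T.len w - T.len l)⟩ with hT'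
  have hpos' : ∀ α, 0 < T'.len α := update_len_pos hpos hlt
  have hleft : ∀ γ, T'.left γ = T.left γ := posOf_update_of_last T.π₀ T.len hw
  have hlen : ∀ γ, γ ≠ w → T'.len γ = T.len γ := fun γ hγ => by simp [hT', hγ]
  have hlenw : T'.len w = T.len w - T.len l := by simp [hT']
  have hbot : ∀ γ, γ ≠ l → posOf T'.π₁ T'.len γ = posOf T.π₁ T.len γ := fun γ hγ =>
    posOf_moveLast T.π₁ T.len hl hwl hγ
  have hbotl : posOf T'.π₁ T'.len l = posOf T.π₁ T.len w + T.len w - T.len l :=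
    posOf_moveLast_self T.π₁ T.len hl hwl
  have htot : T'.total = T.total - T.len l := by
    simp only [total, hT']
    rw [sum_update_sub, if_pos (Finset.mem_univ w)]
  have hsub : ∀ γ, T'.piece γ ⊆ T.piece γ := by
    intro γ
    refine Ico_subset_Ico (hleft γ).ge ?_
    rw [right_eq, right_eq, hleft]
    by_cases hγ : γ = w
    · subst hγ; rw [hlenw]; linarith [hpos l]
    · rw [hlen γ hγ]
  have hTx : ∀ x ∈ T'.piece l, T.toFun x = x - T.left l + (T.total - T.len l) := by
    intro x hx
    rw [IETData.toFun_eq hpos (hsub l hx), posOf_last T.π₁ T.len hl, total]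
  have hlw : T.left w = T.total - T.len w := posOf_last T.π₀ T.len hw
  have hx2 : ∀ x ∈ T'.piece l, T.toFun x ∈ T.piece w := by
    intro x hx
    have h1 := (hsub l hx).1
    have h2 := (hsub l hx).2
    rw [right_eq] at h2
    rw [hTx x hx]
    refine ⟨?_, ?_⟩
    · rw [hlw]; linarith
    · rw [right_eq, hlw]; linarith
  refine ⟨hwl, Or.inl ⟨rfl, rfl⟩, hlt, rfl, fun γ _ => hsub γ, ?_, fun x hx => hsub l hx, hx2, ?_,
    ?_, fun γ _ => hleft γ, Or.inl (hleft l), fun _ => Iff.rfl⟩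
  · intro γ hγ x hx
    rw [IETData.toFun_eq hpos' hx, IETData.toFun_eq hpos (hsub γ hx), hleft, hbot γ hγ]
  · intro x hx
    rw [IETData.toFun_eq hpos' hx, IETData.toFun_eq hpos (hx2 x hx), hleft, hbotl, hTx x hx, hlw]
    ring
  · intro x hx h
    have h1 := (hsub l hx).1
    have h2 := h.2
    rw [hTx x hx, htot] at h2
    linarith

theorem rauzyStep_bot {T : IETData 𝒜 d} (hpos : ∀ α, 0 < T.len α) {w l : 𝒜}
    (hw : T.π₁ w = Fin.last d) (hl : T.π₀ l = Fin.last d) (hwl : w ≠ l)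
    (hlt : T.len l < T.len w) :
    T.RauzyStep ⟨moveLast T.π₀ w, T.π₁, Function.update T.len w (T.len w - T.len l)⟩ w l w l := by
  set T' : IETData 𝒜 d :=
    ⟨moveLast T.π₀ w, T.π₁, Function.update T.len w (T.len w - T.len l)⟩ with hT'
  have hpos' : ∀ α, 0 < T'.len α := update_len_pos hpos hlt
  have hbot : ∀ γ, posOf T'.π₁ T'.len γ = posOf T.π₁ T.len γ :=
    posOf_update_of_last T.π₁ T.len hw
  have hlen : ∀ γ, γ ≠ w → T'.len γ = T.len γ := fun γ hγ => by simp [hT', hγ]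
  have hlenw : T'.len w = T.len w - T.len l := by simp [hT']
  have hleft : ∀ γ, γ ≠ l → T'.left γ = T.left γ := fun γ hγ =>
    posOf_moveLast T.π₀ T.len hl hwl hγ
  have hleftl : T'.left l = T.left w + T.len w - T.len l :=
    posOf_moveLast_self T.π₀ T.len hl hwl
  have htot : T'.total = T.total - T.len l := by
    simp only [total, hT']
    rw [sum_update_sub, if_pos (Finset.mem_univ w)]
  have hsub : ∀ γ, γ ≠ l → T'.piece γ ⊆ T.piece γ := by
    intro γ hγl
    refine Ico_subset_Ico (hleft γ hγl).ge ?_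
    rw [right_eq, right_eq, hleft γ hγl]
    by_cases hγ : γ = w
    · subst hγ; rw [hlenw]; linarith [hpos l]
    · rw [hlen γ hγ]
  have hx1 : ∀ x ∈ T'.piece l, x ∈ T.piece w := by
    intro x hx
    have h1 := hx.1
    have h2 := hx.2
    rw [right_eq, hleftl, hlen l hwl.symm] at h2
    rw [hleftl] at h1
    refine ⟨by linarith, by rw [right_eq]; linarith⟩
  have hlw : T.left l = T.total - T.len l := posOf_last T.π₀ T.len hl
  have hTx : ∀ x ∈ T'.piece l, T.toFun x = x - T.left w + (T.total - T.len w) := by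
    intro x hx
    rw [IETData.toFun_eq hpos (hx1 x hx), posOf_last T.π₁ T.len hw, total]
  have hx2 : ∀ x ∈ T'.piece l, T.toFun x ∈ T.piece l := by
    intro x hx
    have h1 := hx.1
    have h2 := hx.2
    rw [right_eq, hleftl, hlen l hwl.symm] at h2
    rw [hleftl] at h1
    rw [hTx x hx]
    refine ⟨?_, ?_⟩
    · rw [hlw]; linarith
    · rw [right_eq, hlw]; linarith
  refine ⟨hwl, Or.inr ⟨rfl, rfl⟩, hlt, rfl, hsub, ?_, hx1, hx2, ?_, ?_, hleft, Or.inr ?_, ?_⟩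
  · intro γ hγ x hx
    rw [IETData.toFun_eq hpos' hx, IETData.toFun_eq hpos (hsub γ hγ hx), hleft γ hγ, hbot γ]
  · intro x hx
    rw [IETData.toFun_eq hpos' hx, IETData.toFun_eq hpos (hx2 x hx), hleftl, hbot, hTx x hx, hlw]
    ring
  · intro x hx h
    have h1 := hx.1
    have h2 := h.2
    rw [hTx x hx, htot] at h2
    rw [hleftl] at h1
    linarith
  · rw [hTx _ (left_mem_piece hpos' l), hleftl, hlw]
    ring
  · intro γ
    rw [Fin.ext_iff, Fin.ext_iff]
    have h0 : ((0 : Fin (d + 1)) : ℕ) = 0 := rfl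
    simp only [hT', h0]
    rw [moveLast_val T.π₀ hl hwl]
    have hlv : (T.π₀ l : ℕ) = d := by rw [hl]; rfl
    have hwv : (T.π₀ w : ℕ) < d := by
      have : T.π₀ w ≠ Fin.last d := fun h => hwl (T.π₀.injective (h.trans hl.symm))
      have := lt_of_le_of_ne (Fin.le_last _) this
      simpa [Fin.lt_def] using this
    by_cases hγ : γ = l
    · subst hγ
      rw [if_pos rfl, hlv]
      exact iff_of_false (Nat.succ_ne_zero _) (by omega)
    · rw [if_neg hγ]
      split_ifs <;> simp <;> omega

theorem iterate_mem_domain {T : IETData 𝒜 d} (hpos : ∀ α, 0 < T.len α) {x : ℝ}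
    (hx : x ∈ T.domain) (m : ℕ) : T.toFun^[m] x ∈ T.domain := by
  induction m with
  | zero => exact hx
  | succ m ih =>
    rw [Function.iterate_succ_apply']
    exact toFun_mem_domain hpos ih

theorem RauzyStep.len_pos {T T' : IETData 𝒜 d} {w l u v : 𝒜} (h : T.RauzyStep T' w l u v)
    (hpos : ∀ α, 0 < T.len α) (γ : 𝒜) : 0 < T'.len γ := by
  rw [h.len_eq]
  exact update_len_pos hpos h.len_lt γ

/-- On each exchanged interval of the induced map, the induced map is the first or second iterate
of the original one. -/
theorem RauzyStep.exists_iterate {T T' : IETData 𝒜 d} {w l u v : 𝒜} (h : T.RauzyStep T' w l u v)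
    {γ : 𝒜} {x : ℝ} (hx : x ∈ T'.piece γ) :
    T'.toFun x = T.toFun^[if γ = l then 2 else 1] x := by
  split_ifs with hγ
  · subst hγ
    exact h.toFun_loser x hx
  · exact h.toFun_eq γ hγ x hx

theorem RauzyStep.exists_iterate' {T T' : IETData 𝒜 d} {w l u v : 𝒜}
    (h : T.RauzyStep T' w l u v) (hpos : ∀ α, 0 < T.len α) {γ : 𝒜} {x : ℝ}
    (hx : x ∈ T'.piece γ) (m : ℕ) (hm : 1 ≤ m) :
    ∃ M : ℕ, (if γ = l then 2 else 1) ≤ M ∧ T'.toFun^[m] x = T.toFun^[M] x := by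
  have hpos' := h.len_pos hpos
  induction m, hm using Nat.le_induction with
  | base => exact ⟨_, le_rfl, h.exists_iterate hx⟩
  | succ m hm ih =>
    obtain ⟨M, hM, hMx⟩ := ih
    have hdom : T'.toFun^[m] x ∈ T'.domain :=
      iterate_mem_domain hpos' (piece_subset_domain hpos' γ hx) m
    obtain ⟨δ, hδ⟩ := exists_mem_piece hdom
    refine ⟨(if δ = l then 2 else 1) + M, hM.trans (Nat.le_add_left _ _), ?_⟩
    rw [Function.iterate_succ_apply', h.exists_iterate hδ, hMx, ← Function.iterate_add_apply]

theorem RauzyStep.keane {T T' : IETData 𝒜 d} {w l u v : 𝒜} (h : T.RauzyStep T' w l u v)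
    (hpos : ∀ α, 0 < T.len α) (hK : T.Keane) : T'.Keane := by
  intro m α β hm hβ heq
  rw [Ne, h.first_letter] at hβ
  obtain ⟨M, hM, hMx⟩ := h.exists_iterate' hpos (left_mem_piece (h.len_pos hpos) α) m hm
  rw [hMx] at heq
  have key : ∀ γ, ∃ e : ℕ, e ≤ (if γ = l then 1 else 0) ∧ T.toFun^[e] (T'.left γ) = T.left γ := by
    intro γ
    by_cases hγ : γ = l
    · subst hγ
      rcases h.left_loser with h' | h'
      · exact ⟨0, Nat.zero_le _, h'⟩
      · exact ⟨1, by simp, h'⟩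
    · exact ⟨0, Nat.zero_le _, h.left_eq γ hγ⟩
  obtain ⟨e, he, hex⟩ := key α
  obtain ⟨e', -, hex'⟩ := key β
  have hle : e + 1 ≤ e' + M := by
    split_ifs at he hM <;> omega
  refine hK (e' + M - e) α β (by omega) hβ ?_
  rw [← hex, ← Function.iterate_add_apply, Nat.sub_add_cancel (by omega),
    Function.iterate_add_apply, heq, hex']

/-- Interval exchange transformations with at least two intervals to which Rauzy-Veech induction
can be applied indefinitely. -/
structure Regular (T : IETData 𝒜 d) : Prop where
  isIET : T.IsIET
  keane : T.Keane
  pos_card : 0 < d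

theorem Regular.exists_rauzyStep {T : IETData 𝒜 d} (hT : T.Regular) :
    T.rauzy.Regular ∧ ∃ w l u v, T.RauzyStep T.rauzy w l u v ∧
      T.stepMatrix = 1 + Matrix.single w l 1 := by
  obtain ⟨⟨hpos, hirr⟩, hK, hd⟩ := hT
  have htop : T.π₀ T.topLetter = Fin.last d := by simp [topLetter]
  have hbot : T.π₁ T.botLetter = Fin.last d := by simp [botLetter]
  have hne : T.topLetter ≠ T.botLetter := by
    intro h
    refine hirr d hd (Nat.lt_succ_self d) ?_
    have h0 : ∀ π : 𝒜 ≃ Fin (d + 1), π T.topLetter = Fin.last d →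
        {β | (π β : ℕ) < d} = {T.topLetter}ᶜ := by
      intro π hπ
      ext β
      rw [mem_ofPred_eq, mem_compl_iff, mem_singleton_iff, ← π.injective.eq_iff, hπ]
      have : π β < Fin.last d ↔ π β ≠ Fin.last d := Fin.lt_last_iff_ne_last
      rw [Ne, Fin.lt_def, Fin.val_last] at this
      exact this
    rw [h0 _ htop, h0 _ (h ▸ hbot)]
  have hlen : T.len T.topLetter ≠ T.len T.botLetter := by
    intro h
    refine hK 1 T.botLetter T.topLetter le_rfl ?_ ?_
    · rw [htop]
      exact fun h => hd.ne' (by simpa using congrArg Fin.val h)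
    · rw [Function.iterate_one, toFun_eq hpos (left_mem_piece hpos _), posOf_last _ _ hbot,
        left_eq T T.topLetter, posOf_last _ _ htop, h]
      ring
  by_cases hlt : T.len T.botLetter < T.len T.topLetter
  · have hstep := rauzyStep_top hpos htop hbot hne hlt
    have hr : T.rauzy = ⟨T.π₀, moveLast T.π₁ T.topLetter,
        Function.update T.len T.topLetter (T.len T.topLetter - T.len T.botLetter)⟩ := by
      rw [rauzy, if_pos hlt]; rfl
    rw [← hr] at hstep
    refine ⟨⟨⟨hstep.len_pos hpos, ?_⟩, hstep.keane hpos hK, hd⟩, _, _, _, _, hstep, ?_⟩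
    · intro k hk1 hk
      rw [hr]
      exact setOf_moveLast_lt_ne _ _ hbot hne htop hk (hirr k hk1 hk)
    · rw [stepMatrix, if_pos hlt]
  · have hlt' : T.len T.topLetter < T.len T.botLetter := lt_of_le_of_ne (not_lt.1 hlt) hlen
    have hstep := rauzyStep_bot hpos hbot htop hne.symm hlt'
    have hr : T.rauzy = ⟨moveLast T.π₀ T.botLetter, T.π₁,
        Function.update T.len T.botLetter (T.len T.botLetter - T.len T.topLetter)⟩ := by
      rw [rauzy, if_neg hlt]; rfl
    rw [← hr] at hstep
    refine ⟨⟨⟨hstep.len_pos hpos, ?_⟩, hstep.keane hpos hK, hd⟩, _, _, _, _, hstep, ?_⟩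
    · intro k hk1 hk
      rw [hr]
      exact (setOf_moveLast_lt_ne _ _ htop hne.symm hbot hk (hirr k hk1 hk).symm).symm
    · rw [stepMatrix, if_neg hlt]

theorem Regular.iterate {T : IETData 𝒜 d} (hT : T.Regular) (N : ℕ) : (rauzy^[N] T).Regular := by
  induction N with
  | zero => exact hT
  | succ N ih =>
    rw [Function.iterate_succ_apply']
    exact ih.exists_rauzyStep.1

theorem Regular.len_pos {T : IETData 𝒜 d} (hT : T.Regular) : ∀ α, 0 < T.len α := hT.isIET.pos

/-- `T'` is the map induced by `T` on a subinterval; the matrix `B` counts how often the points of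
an interval exchanged by `T'` visit the intervals exchanged by `T` before they return. -/
structure Tower (T T' : IETData 𝒜 d) (B : Matrix 𝒜 𝒜 ℕ) : Prop where
  pos : ∀ α, 0 < T.len α
  pos' : ∀ α, 0 < T'.len α
  translate : ∀ α, ∀ m < ∑ β, B α β, ∃ β c, ∀ x ∈ T'.piece α,
    T.toFun^[m] x = x + c ∧ T.toFun^[m] x ∈ T.piece β
  iterate_eq : ∀ α, ∀ x ∈ T'.piece α, T.toFun^[∑ β, B α β] x = T'.toFun x
  notMem : ∀ α, ∀ x ∈ T'.piece α, ∀ m, 0 < m → m < ∑ β, B α β → T.toFun^[m] x ∉ T'.domain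
  count : ∀ α, ∀ x ∈ T'.piece α, ∀ h : 𝒜 → ℝ,
    ∑ m ∈ Finset.range (∑ β, B α β), T.stepFun h (T.toFun^[m] x) = ∑ β, B α β * h β
  total_le : T'.total ≤ T.total
  len_eq : ∀ β, T.len β = ∑ α, B α β * T'.len α

theorem stepFun_apply {T : IETData 𝒜 d} (hpos : ∀ α, 0 < T.len α) (h : 𝒜 → ℝ) {α : 𝒜} {x : ℝ}
    (hx : x ∈ T.piece α) : T.stepFun h x = h α :=
  sum_indicator_piece hpos (fun α _ => h α) hx

theorem tower_refl {T : IETData 𝒜 d} (hpos : ∀ α, 0 < T.len α) : Tower T T 1 := by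
  have h1 : ∀ α : 𝒜, ∑ β, (1 : Matrix 𝒜 𝒜 ℕ) α β = 1 := fun α => by
    simp [Matrix.one_apply]
  refine ⟨hpos, hpos, ?_, ?_, ?_, ?_, le_rfl, ?_⟩
  · intro α m hm
    rw [h1, Nat.lt_one_iff] at hm
    subst hm
    exact ⟨α, 0, fun x hx => ⟨by simp, hx⟩⟩
  · intro α x _
    rw [h1, Function.iterate_one]
  · intro α x _ m h0 hm
    rw [h1] at hm
    omega
  · intro α x hx h
    rw [h1, Finset.sum_range_one, Function.iterate_zero, id_eq, stepFun_apply hpos h hx]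
    simp [Matrix.one_apply]
  · intro β
    simp [Matrix.one_apply]

theorem step_mul_apply (B : Matrix 𝒜 𝒜 ℕ) (w l α β : 𝒜) :
    ((1 + Matrix.single w l 1 : Matrix 𝒜 𝒜 ℕ).transpose * B) α β =
      B α β + if α = l then B w β else 0 := by
  rw [Matrix.transpose_add, Matrix.transpose_one, Matrix.transpose_single, add_mul, one_mul,
    Matrix.add_apply]
  split_ifs with h
  · subst h
    simp
  · rw [Matrix.single_mul_apply_of_ne _ _ _ _ _ h]

theorem Tower.step {T T' T'' : IETData 𝒜 d} {B : Matrix 𝒜 𝒜 ℕ} (hB : Tower T T' B)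
    {w l u v : 𝒜} (h : T'.RauzyStep T'' w l u v) :
    Tower T T'' ((1 + Matrix.single w l 1 : Matrix 𝒜 𝒜 ℕ).transpose * B) := by
  set B' := (1 + Matrix.single w l 1 : Matrix 𝒜 𝒜 ℕ).transpose * B with hB'
  have hne : ∀ α β, α ≠ l → B' α β = B α β := fun α β hα => by
    rw [hB', step_mul_apply, if_neg hα, add_zero]
  have huv : ∀ β, B' l β = B u β + B v β := fun β => by
    rw [hB', step_mul_apply, if_pos rfl]
    rcases h.uv with ⟨rfl, rfl⟩ | ⟨rfl, rfl⟩
    · rfl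
    · rw [add_comm]
  have hq : ∀ α, α ≠ l → ∑ β, B' α β = ∑ β, B α β := fun α hα =>
    Finset.sum_congr rfl fun β _ => hne α β hα
  have hql : ∑ β, B' l β = ∑ β, B v β + ∑ β, B u β := by
    simp only [huv, Finset.sum_add_distrib, add_comm]
  have hpos'' := h.len_pos hB.pos'
  have htot : T''.total ≤ T'.total := by
    simp only [total, h.len_eq]
    rw [sum_update_sub, if_pos (Finset.mem_univ w)]
    linarith [hB.pos' l]
  have hdom : T''.domain ⊆ T'.domain := Ico_subset_Ico le_rfl htot
  have hsplit : ∀ x ∈ T''.piece l, ∀ m, T.toFun^[m + ∑ β, B u β] x = T.toFun^[m] (T'.toFun x) := by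
    intro x hx m
    rw [Function.iterate_add_apply, hB.iterate_eq u x (h.first x hx)]
  refine ⟨hB.pos, hpos'', ?_, ?_, ?_, ?_, htot.trans hB.total_le, ?_⟩
  · intro α m hm
    by_cases hα : α = l
    · subst hα
      rw [hql] at hm
      by_cases hmu : m < ∑ β, B u β
      · obtain ⟨β, c, hc⟩ := hB.translate u m hmu
        exact ⟨β, c, fun x hx => hc x (h.first x hx)⟩
      · obtain ⟨k, rfl⟩ := Nat.exists_eq_add_of_le' (not_lt.1 hmu)
        obtain ⟨β, c, hc⟩ := hB.translate v k (by omega)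
        refine ⟨β, posOf T'.π₁ T'.len u - T'.left u + c, fun x hx => ?_⟩
        have := hc _ (h.second x hx)
        rw [hsplit x hx, this.1, toFun_eq hB.pos' (h.first x hx)]
        refine ⟨by ring, ?_⟩
        rw [← toFun_eq hB.pos' (h.first x hx), ← this.1]
        exact this.2
    · rw [hq α hα] at hm
      obtain ⟨β, c, hc⟩ := hB.translate α m hm
      exact ⟨β, c, fun x hx => hc x (h.piece_subset α hα hx)⟩
  · intro α x hx
    by_cases hα : α = l
    · subst hα
      rw [hql, hsplit x hx, hB.iterate_eq v _ (h.second x hx), h.toFun_loser x hx]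
    · rw [hq α hα, hB.iterate_eq α x (h.piece_subset α hα hx), h.toFun_eq α hα x hx]
  · intro α x hx m h0 hm
    by_cases hα : α = l
    · subst hα
      rw [hql] at hm
      by_cases hmu : m < ∑ β, B u β
      · exact fun hmem => hB.notMem u x (h.first x hx) m h0 hmu (hdom hmem)
      · obtain ⟨k, rfl⟩ := Nat.exists_eq_add_of_le' (not_lt.1 hmu)
        rw [hsplit x hx]
        rcases Nat.eq_zero_or_pos k with rfl | hk
        · exact h.notMem x hx
        · exact fun hmem => hB.notMem v _ (h.second x hx) k hk (by omega) (hdom hmem)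
    · rw [hq α hα] at hm
      exact fun hmem => hB.notMem α x (h.piece_subset α hα hx) m h0 hm (hdom hmem)
  · intro α x hx f
    by_cases hα : α = l
    · subst hα
      rw [hql, add_comm, Finset.sum_range_add, hB.count u x (h.first x hx) f]
      have : ∀ m, T.toFun^[∑ β, B u β + m] x = T.toFun^[m] (T'.toFun x) := fun m => by
        rw [add_comm, hsplit x hx]
      simp only [this]
      rw [hB.count v _ (h.second x hx) f, ← Finset.sum_add_distrib]
      refine Finset.sum_congr rfl fun β _ => ?_
      rw [huv]
      push_cast
      ring
    · rw [hq α hα, hB.count α x (h.piece_subset α hα hx) f]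
      exact Finset.sum_congr rfl fun β _ => by rw [hne α β hα]
  · intro β
    rw [hB.len_eq β]
    have hl : ∀ α, T'.len α = T''.len α + if α = w then T''.len l else 0 := by
      intro α
      rw [h.len_eq, Function.update_of_ne h.ne.symm]
      by_cases hα : α = w
      · subst hα; simp
      · simp [hα]
    have hb : ∀ α, (B' α β : ℝ) = B α β + if α = l then (B w β : ℝ) else 0 := by
      intro α
      rw [hB', step_mul_apply]
      split_ifs <;> simp
    simp only [hb, add_mul, ite_mul, zero_mul, Finset.sum_add_distrib, Finset.sum_ite_eq',
      Finset.mem_univ, if_true]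
    simp only [hl, mul_add, mul_ite, mul_zero, Finset.sum_add_distrib, Finset.sum_ite_eq',
      Finset.mem_univ, if_true]

theorem cocycle_succ' (T : IETData 𝒜 d) (N : ℕ) :
    T.cocycle (N + 1) = T.cocycle N * (rauzy^[N] T).stepMatrix := by
  induction N generalizing T with
  | zero => simp [cocycle]
  | succ N ih =>
    rw [cocycle, ih, ← mul_assoc, Function.iterate_succ_apply]
    rfl

theorem cocycle_add (T : IETData 𝒜 d) (M N : ℕ) :
    T.cocycle (M + N) = T.cocycle M * (rauzy^[M] T).cocycle N := by
  induction N with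
  | zero => simp [cocycle]
  | succ N ih =>
    rw [← add_assoc, cocycle_succ', ih, cocycle_succ', mul_assoc, ← Function.iterate_add_apply,
      add_comm M N]

theorem Regular.tower {T : IETData 𝒜 d} (hT : T.Regular) (N : ℕ) :
    Tower T (rauzy^[N] T) (T.cocycle N).transpose := by
  induction N with
  | zero =>
    rw [cocycle, Matrix.transpose_one]
    exact tower_refl hT.len_pos
  | succ N ih =>
    obtain ⟨-, w, l, u, v, hstep, hmat⟩ := (hT.iterate N).exists_rauzyStep
    rw [Function.iterate_succ_apply', cocycle_succ', hmat, Matrix.transpose_mul]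
    exact ih.step hstep

namespace Tower

variable {T T' T'' : IETData 𝒜 d} {B B' : Matrix 𝒜 𝒜 ℕ}

theorem domain_subset (h : Tower T T' B) : T'.domain ⊆ T.domain :=
  Ico_subset_Ico le_rfl h.total_le

theorem eq_of_iterate_eq (h : Tower T T' B) {α α' : 𝒜} {m m' : ℕ} {x x' : ℝ}
    (hx : x ∈ T'.piece α) (hx' : x' ∈ T'.piece α') (hm : m < ∑ β, B α β)
    (hm' : m' < ∑ β, B α' β) (heq : T.toFun^[m] x = T.toFun^[m'] x') : α = α' ∧ m = m' := by
  wlog hle : m ≤ m' generalizing α α' m m' x x'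
  · exact (this hx' hx hm' hm heq.symm (le_of_not_ge hle)).imp Eq.symm Eq.symm
  have hinj : ∀ n : ℕ, ∀ y ∈ T.domain, ∀ z ∈ T.domain, T.toFun^[n] y = T.toFun^[n] z → y = z := by
    intro n
    induction n with
    | zero => exact fun y _ z _ h => h
    | succ n ih =>
      intro y hy z hz hyz
      rw [Function.iterate_succ_apply, Function.iterate_succ_apply] at hyz
      exact toFun_injOn h.pos hy hz
        (ih _ (toFun_mem_domain h.pos hy) _ (toFun_mem_domain h.pos hz) hyz)
  obtain ⟨k, rfl⟩ := Nat.exists_eq_add_of_le hle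
  have hd : ∀ {α x}, x ∈ T'.piece α → x ∈ T.domain := fun hx =>
    h.domain_subset (piece_subset_domain h.pos' _ hx)
  rw [Function.iterate_add_apply] at heq
  have hxe := hinj m _ (hd hx) _ (iterate_mem_domain h.pos (hd hx') k) heq
  rcases Nat.eq_zero_or_pos k with rfl | hk
  · refine ⟨eq_of_mem_piece h.pos' hx ?_, rfl⟩
    rw [hxe]
    exact hx'
  · refine absurd (piece_subset_domain h.pos' α hx) ?_
    rw [hxe]
    exact h.notMem α' x' hx' k hk (by omega)

/-- The floor of height `m` of the tower over the interval with letter `α`. -/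
def floor (T T' : IETData 𝒜 d) (α : 𝒜) (m : ℕ) : Set ℝ :=
  Ico (T.toFun^[m] (T'.left α)) (T.toFun^[m] (T'.left α) + T'.len α)

theorem iterate_eq_add (h : Tower T T' B) {α : 𝒜} {m : ℕ} (hm : m < ∑ β, B α β) {x : ℝ}
    (hx : x ∈ T'.piece α) : T.toFun^[m] x = x + (T.toFun^[m] (T'.left α) - T'.left α) := by
  obtain ⟨β, c, hc⟩ := h.translate α m hm
  rw [(hc x hx).1, (hc _ (left_mem_piece h.pos' α)).1]
  ring

theorem exists_iterate_of_mem_floor (h : Tower T T' B) {α : 𝒜} {m : ℕ} (hm : m < ∑ β, B α β)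
    {y : ℝ} (hy : y ∈ floor T T' α m) : ∃ x ∈ T'.piece α, T.toFun^[m] x = y := by
  have hx : y - (T.toFun^[m] (T'.left α) - T'.left α) ∈ T'.piece α := by
    refine ⟨by linarith [hy.1], ?_⟩
    rw [right_eq]
    linarith [hy.2]
  exact ⟨_, hx, by rw [h.iterate_eq_add hm hx]; ring⟩

theorem exists_floor_subset (h : Tower T T' B) {α : 𝒜} {m : ℕ} (hm : m < ∑ β, B α β) :
    ∃ β, floor T T' α m ⊆ T.piece β := by
  obtain ⟨β, c, hc⟩ := h.translate α m hm
  refine ⟨β, fun y hy => ?_⟩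
  obtain ⟨x, hx, rfl⟩ := h.exists_iterate_of_mem_floor hm hy
  exact (hc x hx).2

theorem floor_subset_domain (h : Tower T T' B) {α : 𝒜} {m : ℕ} (hm : m < ∑ β, B α β) :
    floor T T' α m ⊆ T.domain := by
  obtain ⟨β, hβ⟩ := h.exists_floor_subset hm
  exact hβ.trans (piece_subset_domain h.pos β)

/-- The floors of all towers, as an index set. -/
def floors (B : Matrix 𝒜 𝒜 ℕ) : Finset (Σ _ : 𝒜, ℕ) :=
  Finset.univ.sigma fun α => Finset.range (∑ β, B α β)

theorem pairwiseDisjoint_floor (h : Tower T T' B) :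
    (floors B : Set (Σ _ : 𝒜, ℕ)).PairwiseDisjoint fun p => floor T T' p.1 p.2 := by
  rintro ⟨α, m⟩ hp ⟨α', m'⟩ hp' hne
  simp only [floors, Finset.coe_sigma, Finset.coe_univ, Finset.coe_range, mem_sigma_iff, mem_univ,
    true_and, mem_Iio] at hp hp'
  refine disjoint_left.2 fun y hy hy' => hne ?_
  obtain ⟨x, hx, rfl⟩ := h.exists_iterate_of_mem_floor hp hy
  obtain ⟨x', hx', heq⟩ := h.exists_iterate_of_mem_floor hp' hy'
  obtain ⟨rfl, rfl⟩ := h.eq_of_iterate_eq hx hx' hp hp' heq.symm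
  rfl

theorem sum_integral_floor_le (h : Tower T T' B) {g : ℝ → ℝ} (hg : IntegrableOn g T.domain)
    (h0 : ∀ x ∈ T.domain, 0 ≤ g x) :
    ∑ α, ∑ m ∈ Finset.range (∑ β, B α β), ∫ x in floor T T' α m, g x ≤ ∫ x in T.domain, g x := by
  have hmem : ∀ p ∈ floors B, p.2 < ∑ β, B p.1 β := fun p hp => by
    simpa [floors] using hp
  rw [Finset.sum_sigma' Finset.univ (fun α => Finset.range (∑ β, B α β))
    (fun α m => ∫ x in floor T T' α m, g x)]
  change ∑ p ∈ floors B, ∫ x in floor T T' p.1 p.2, g x ≤ _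
  rw [← integral_biUnion_finset (s := fun p : Σ _ : 𝒜, ℕ => floor T T' p.1 p.2) _
    (fun p _ => measurableSet_Ico) h.pairwiseDisjoint_floor
    (fun p hp => hg.mono_set (h.floor_subset_domain (hmem p hp)))]
  refine setIntegral_mono_set hg ?_ (LE.le.eventuallyLE ?_)
  · exact (ae_restrict_iff' measurableSet_Ico).2 (ae_of_all _ h0)
  · exact iUnion₂_subset fun p hp => h.floor_subset_domain (hmem p hp)

theorem integral_iterate (h : Tower T T' B) {α : 𝒜} {m : ℕ} (hm : m < ∑ β, B α β) (g : ℝ → ℝ) :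
    ∫ x in T'.piece α, g (T.toFun^[m] x) = ∫ x in floor T T' α m, g x := by
  have hcongr : ∫ x in T'.piece α, g (T.toFun^[m] x) =
      ∫ x in T'.piece α, g (x + (T.toFun^[m] (T'.left α) - T'.left α)) :=
    setIntegral_congr_fun measurableSet_Ico fun x hx => by simp only [h.iterate_eq_add hm hx]
  have hle : T'.left α ≤ T'.right α := (left_lt_right h.pos' α).le
  have hle' : T.toFun^[m] (T'.left α) ≤ T.toFun^[m] (T'.left α) + T'.len α := by
    linarith [h.pos' α]
  rw [hcongr, piece, floor, integral_Ico_eq_integral_Ioc, integral_Ico_eq_integral_Ioc,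
    ← intervalIntegral.integral_of_le hle, ← intervalIntegral.integral_of_le hle',
    intervalIntegral.integral_comp_add_right]
  congr 1
  · ring
  · rw [right_eq]; ring

theorem integrableOn_iterate (h : Tower T T' B) {α : 𝒜} {m : ℕ} (hm : m < ∑ β, B α β)
    {g : ℝ → ℝ} (hg : IntegrableOn g T.domain) :
    IntegrableOn (fun x => g (T.toFun^[m] x)) (T'.piece α) := by
  have h1 : IntegrableOn g (floor T T' α m) := hg.mono_set (h.floor_subset_domain hm)
  set c := T.toFun^[m] (T'.left α) - T'.left α with hc
  have h2 : IntegrableOn (fun x => g (x + c)) (T'.piece α) := by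
    have hmp : MeasurePreserving (fun x : ℝ => x + c) volume volume :=
      measurePreserving_add_right volume c
    have hpre : (fun x : ℝ => x + c) ⁻¹' floor T T' α m = T'.piece α := by
      rw [floor, preimage_add_const_Ico, piece, right_eq, hc]
      congr 1 <;> ring
    rw [← hpre]
    exact (hmp.integrableOn_comp_preimage (measurableEmbedding_addRight c)).2 h1
  refine h2.congr_fun (fun x hx => ?_) measurableSet_Ico
  simp only [h.iterate_eq_add hm hx, hc]

end Tower

theorem biUnion_piece {T : IETData 𝒜 d} (hpos : ∀ α, 0 < T.len α) :
    ⋃ α ∈ (Finset.univ : Finset 𝒜), T.piece α = T.domain := by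
  ext x
  simp only [Finset.mem_univ, iUnion_true, mem_iUnion]
  exact ⟨fun ⟨α, hα⟩ => piece_subset_domain hpos α hα, exists_mem_piece⟩

theorem pairwiseDisjoint_piece {T : IETData 𝒜 d} (hpos : ∀ α, 0 < T.len α) (s : Set 𝒜) :
    s.PairwiseDisjoint T.piece := fun _ _ _ _ hne =>
  disjoint_left.2 fun _ hα hβ => hne (eq_of_mem_piece hpos hα hβ)

theorem measurableSet_piece (T : IETData 𝒜 d) (α : 𝒜) : MeasurableSet (T.piece α) :=
  measurableSet_Ico

theorem measurableSet_inner (T : IETData 𝒜 d) (α : 𝒜) : MeasurableSet (T.inner α) :=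
  measurableSet_Ioo

theorem integrableOn_domain_iff {T : IETData 𝒜 d} (hpos : ∀ α, 0 < T.len α) {f : ℝ → ℝ} :
    IntegrableOn f T.domain ↔ ∀ α, IntegrableOn f (T.piece α) := by
  rw [← biUnion_piece hpos, integrableOn_finset_iUnion]
  simp

theorem integral_domain_eq_sum {T : IETData 𝒜 d} (hpos : ∀ α, 0 < T.len α) {f : ℝ → ℝ}
    (hf : IntegrableOn f T.domain) : ∫ x in T.domain, f x = ∑ α, ∫ x in T.piece α, f x := by
  rw [← biUnion_piece hpos, integral_biUnion_finset _ (fun α _ => T.measurableSet_piece α)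
    (pairwiseDisjoint_piece hpos _) fun α _ => (integrableOn_domain_iff hpos).1 hf α]

theorem total_pos {T : IETData 𝒜 d} (hpos : ∀ α, 0 < T.len α) : 0 < T.total :=
  Finset.sum_pos (fun α _ => hpos α) ⟨T.π₀.symm 0, Finset.mem_univ _⟩

theorem inner_subset_piece (T : IETData 𝒜 d) (α : 𝒜) : T.inner α ⊆ T.piece α := Ioo_subset_Ico_self

theorem integral_piece_eq_inner (T : IETData 𝒜 d) (α : 𝒜) (f : ℝ → ℝ) :
    ∫ x in T.piece α, f x = ∫ x in T.inner α, f x :=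
  setIntegral_congr_set Ioo_ae_eq_Ico.symm

theorem integrableOn_piece_iff_inner (T : IETData 𝒜 d) (α : 𝒜) {f : ℝ → ℝ} :
    IntegrableOn f (T.piece α) ↔ IntegrableOn f (T.inner α) :=
  integrableOn_congr_set_ae Ioo_ae_eq_Ico.symm

theorem integrableOn_domain_congr {T : IETData 𝒜 d} (hpos : ∀ α, 0 < T.len α) {f g : ℝ → ℝ}
    (h : ∀ α, EqOn f g (T.inner α)) (hf : IntegrableOn f T.domain) : IntegrableOn g T.domain := by
  rw [integrableOn_domain_iff hpos] at hf ⊢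
  intro α
  rw [integrableOn_piece_iff_inner] at *
  exact ((T.integrableOn_piece_iff_inner α).1 (hf α)).congr_fun (h α) measurableSet_Ioo

theorem integral_domain_congr {T : IETData 𝒜 d} (hpos : ∀ α, 0 < T.len α) {f g : ℝ → ℝ}
    (h : ∀ α, EqOn f g (T.inner α)) (hf : IntegrableOn f T.domain) :
    ∫ x in T.domain, f x = ∫ x in T.domain, g x := by
  rw [integral_domain_eq_sum hpos hf,
    integral_domain_eq_sum hpos (integrableOn_domain_congr hpos h hf)]
  refine Finset.sum_congr rfl fun α _ => ?_
  rw [integral_piece_eq_inner, integral_piece_eq_inner]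
  exact setIntegral_congr_fun measurableSet_Ioo (h α)

/-! ### Mean values -/

theorem mean_apply (T : IETData 𝒜 d) (f : ℝ → ℝ) (α : 𝒜) :
    T.mean f α = (T.len α)⁻¹ * ∫ x in T.piece α, f x := by
  rw [mean, right_eq, add_sub_cancel_left]

theorem mean_congr (T : IETData 𝒜 d) {f g : ℝ → ℝ} (h : ∀ α, EqOn f g (T.inner α)) :
    T.mean f = T.mean g := by
  ext α
  rw [mean_apply, mean_apply, integral_piece_eq_inner, integral_piece_eq_inner,
    setIntegral_congr_fun (T.measurableSet_inner α) (h α)]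

theorem integral_piece_const {T : IETData 𝒜 d} (hpos : ∀ α, 0 < T.len α) (α : 𝒜) (c : ℝ) :
    ∫ _ in T.piece α, c = T.len α * c := by
  rw [setIntegral_const, piece, measureReal_def, Real.volume_Ico, right_eq, add_sub_cancel_left,
    ENNReal.toReal_ofReal (hpos α).le, smul_eq_mul]

theorem integrableOn_stepFun {T : IETData 𝒜 d} (hpos : ∀ α, 0 < T.len α) (h : 𝒜 → ℝ) :
    IntegrableOn (T.stepFun h) T.domain := by
  rw [integrableOn_domain_iff hpos]
  intro α
  refine IntegrableOn.congr_fun (f := fun _ => h α) ?_ (fun x hx => (stepFun_apply hpos h hx).symm)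
    measurableSet_Ico
  exact integrableOn_const (by simp [piece])

theorem mean_stepFun {T : IETData 𝒜 d} (hpos : ∀ α, 0 < T.len α) (h : 𝒜 → ℝ) :
    T.mean (T.stepFun h) = h := by
  ext α
  rw [mean_apply, setIntegral_congr_fun (T.measurableSet_piece α) fun x hx =>
      stepFun_apply hpos h hx,
    integral_piece_const hpos, inv_mul_cancel_left₀ (hpos α).ne']

theorem mean_linear {T : IETData 𝒜 d} (hpos : ∀ α, 0 < T.len α) {f g : ℝ → ℝ}
    (hf : IntegrableOn f T.domain) (hg : IntegrableOn g T.domain) (s t : ℝ) :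
    T.mean (fun x => s * f x + t * g x) = s • T.mean f + t • T.mean g := by
  ext α
  have hf' := (integrableOn_domain_iff hpos).1 hf α
  have hg' := (integrableOn_domain_iff hpos).1 hg α
  simp only [mean_apply, Pi.add_apply, Pi.smul_apply, smul_eq_mul]
  rw [integral_add (hf'.const_mul s) (hg'.const_mul t), integral_const_mul, integral_const_mul]
  ring

theorem mean_sub {T : IETData 𝒜 d} (hpos : ∀ α, 0 < T.len α) {f g : ℝ → ℝ}
    (hf : IntegrableOn f T.domain) (hg : IntegrableOn g T.domain) :
    T.mean (fun x => f x - g x) = T.mean f - T.mean g := by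
  have := mean_linear hpos hf hg 1 (-1)
  simpa [← sub_eq_add_neg] using this

theorem abs_mean_le {T : IETData 𝒜 d} (hpos : ∀ α, 0 < T.len α) {f : ℝ → ℝ}
    (hf : IntegrableOn f T.domain) (α : 𝒜) :
    |T.mean f α| ≤ (T.len α)⁻¹ * ∫ x in T.domain, |f x| := by
  rw [mean_apply, abs_mul, abs_of_pos (inv_pos.2 (hpos α))]
  refine mul_le_mul_of_nonneg_left ((abs_integral_le_integral_abs).trans ?_) (inv_pos.2 (hpos α)).le
  exact setIntegral_mono_set hf.abs (ae_of_all _ fun x => abs_nonneg _)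
    (LE.le.eventuallyLE (piece_subset_domain hpos α))

theorem norm_mean_le {T : IETData 𝒜 d} (hpos : ∀ α, 0 < T.len α) {κ : ℝ}
    (hκ : ∀ α, T.total / T.len α ≤ κ) {f : ℝ → ℝ} (hf : IntegrableOn f T.domain) :
    ‖T.mean f‖ ≤ κ / T.total * ∫ x in T.domain, |f x| := by
  have h0 : 0 ≤ ∫ x in T.domain, |f x| := integral_nonneg fun _ => abs_nonneg _
  have ht := total_pos hpos
  have hinv : ∀ α, (T.len α)⁻¹ ≤ κ / T.total := fun α => by
    rw [le_div_iff₀ ht, inv_mul_eq_div]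
    exact hκ α
  have hκ0 : 0 ≤ κ / T.total := (inv_pos.2 (hpos (T.π₀.symm 0))).le.trans (hinv _)
  refine (pi_norm_le_iff_of_nonneg (mul_nonneg hκ0 h0)).2 fun α => ?_
  exact (abs_mean_le hpos hf α).trans (mul_le_mul_of_nonneg_right (hinv α) h0)

/-! ### Special Birkhoff sums -/

/-- Special Birkhoff sums over a tower. -/
def bsum (T T' : IETData 𝒜 d) (B : Matrix 𝒜 𝒜 ℕ) (φ : ℝ → ℝ) (x : ℝ) : ℝ :=
  ∑ α, (T'.piece α).indicator (fun y => ∑ m ∈ Finset.range (∑ β, B α β), φ (T.toFun^[m] y)) x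

theorem bsum_linear (T T' : IETData 𝒜 d) (B : Matrix 𝒜 𝒜 ℕ) (s t : ℝ) (f g : ℝ → ℝ) (x : ℝ) :
    bsum T T' B (fun x => s * f x + t * g x) x = s * bsum T T' B f x + t * bsum T T' B g x := by
  simp only [bsum, Finset.mul_sum, ← Finset.sum_add_distrib]
  refine Finset.sum_congr rfl fun α _ => ?_
  by_cases hx : x ∈ T'.piece α
  · simp [hx, Finset.sum_add_distrib, Finset.mul_sum]
  · simp [hx]

theorem bsum_sub (T T' : IETData 𝒜 d) (B : Matrix 𝒜 𝒜 ℕ) (f g : ℝ → ℝ) (x : ℝ) :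
    bsum T T' B (fun x => f x - g x) x = bsum T T' B f x - bsum T T' B g x := by
  have := bsum_linear T T' B 1 (-1) f g x
  simpa [← sub_eq_add_neg] using this

namespace Tower

variable {T T' T'' : IETData 𝒜 d} {B B' : Matrix 𝒜 𝒜 ℕ}

theorem bsum_apply (h : Tower T T' B) (φ : ℝ → ℝ) {α : 𝒜} {x : ℝ} (hx : x ∈ T'.piece α) :
    bsum T T' B φ x = ∑ m ∈ Finset.range (∑ β, B α β), φ (T.toFun^[m] x) :=
  sum_indicator_piece h.pos' (fun α y => ∑ m ∈ Finset.range (∑ β, B α β), φ (T.toFun^[m] y)) hx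

theorem bsum_stepFun (h : Tower T T' B) (f : 𝒜 → ℝ) {x : ℝ} (hx : x ∈ T'.domain) :
    bsum T T' B (T.stepFun f) x = T'.stepFun ((B.map (Nat.cast : ℕ → ℝ)).mulVec f) x := by
  obtain ⟨α, hα⟩ := exists_mem_piece hx
  rw [h.bsum_apply _ hα, h.count α x hα, stepFun_apply h.pos' _ hα]
  rfl

theorem iterate_mem_inner (h : Tower T T' B) {α : 𝒜} {m : ℕ} (hm : m < ∑ β, B α β) :
    ∃ β, ∀ x ∈ T'.inner α, T.toFun^[m] x ∈ T.inner β := by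
  obtain ⟨β, c, hc⟩ := h.translate α m hm
  refine ⟨β, fun x hx => ?_⟩
  have h1 := hc x (T'.inner_subset_piece α hx)
  have h2 := hc _ (left_mem_piece h.pos' α)
  refine ⟨?_, h1.2.2⟩
  have := h2.2.1
  rw [h2.1] at this
  rw [h1.1]
  linarith [hx.1]

theorem bsum_congr (h : Tower T T' B) {f g : ℝ → ℝ} (hfg : ∀ α, EqOn f g (T.inner α)) (α : 𝒜) :
    EqOn (bsum T T' B f) (bsum T T' B g) (T'.inner α) := by
  intro x hx
  rw [h.bsum_apply _ (T'.inner_subset_piece α hx), h.bsum_apply _ (T'.inner_subset_piece α hx)]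
  refine Finset.sum_congr rfl fun m hm => ?_
  obtain ⟨β, hβ⟩ := h.iterate_mem_inner (Finset.mem_range.1 hm)
  exact hfg β (hβ x hx)

theorem integrableOn_bsum (h : Tower T T' B) {f : ℝ → ℝ} (hf : IntegrableOn f T.domain) :
    IntegrableOn (bsum T T' B f) T'.domain := by
  rw [integrableOn_domain_iff h.pos']
  intro α
  refine IntegrableOn.congr_fun ?_ (fun x hx => (h.bsum_apply f hx).symm) measurableSet_Ico
  exact integrable_finsetSum _ fun m hm => h.integrableOn_iterate (Finset.mem_range.1 hm) hf

theorem integral_abs_bsum_le (h : Tower T T' B) {f : ℝ → ℝ} (hf : IntegrableOn f T.domain) :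
    ∫ x in T'.domain, |bsum T T' B f x| ≤ ∫ x in T.domain, |f x| := by
  rw [integral_domain_eq_sum h.pos' (h.integrableOn_bsum hf).abs]
  refine le_trans (Finset.sum_le_sum fun α _ => ?_)
    (h.sum_integral_floor_le hf.abs fun _ _ => abs_nonneg _)
  have hi : ∀ m ∈ Finset.range (∑ β, B α β),
      IntegrableOn (fun x => |f (T.toFun^[m] x)|) (T'.piece α) := fun m hm =>
    (h.integrableOn_iterate (Finset.mem_range.1 hm) hf).abs
  rw [setIntegral_congr_fun (g := fun x => |∑ m ∈ Finset.range (∑ β, B α β), f (T.toFun^[m] x)|)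
    (T'.measurableSet_piece α) fun x hx => by simp only [h.bsum_apply f hx]]
  calc ∫ x in T'.piece α, |∑ m ∈ Finset.range (∑ β, B α β), f (T.toFun^[m] x)|
      ≤ ∫ x in T'.piece α, ∑ m ∈ Finset.range (∑ β, B α β), |f (T.toFun^[m] x)| := by
        refine integral_mono ?_ (integrable_finsetSum _ hi) fun x => Finset.abs_sum_le_sum_abs _ _
        exact (integrable_finsetSum _ fun m hm =>
          h.integrableOn_iterate (Finset.mem_range.1 hm) hf).abs
    _ = ∑ m ∈ Finset.range (∑ β, B α β), ∫ x in T'.piece α, |f (T.toFun^[m] x)| :=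
        integral_finsetSum _ hi
    _ = _ := Finset.sum_congr rfl fun m hm =>
        h.integral_iterate (Finset.mem_range.1 hm) fun x => |f x|

theorem bsum_comp (h : Tower T T' B) (h' : Tower T' T'' B') (h'' : Tower T T'' (B' * B))
    (φ : ℝ → ℝ) {x : ℝ} (hx : x ∈ T''.domain) :
    bsum T T'' (B' * B) φ x = bsum T' T'' B' (bsum T T' B φ) x := by
  obtain ⟨α, hα⟩ := exists_mem_piece hx
  set q : 𝒜 → ℕ := fun α => ∑ β, B α β with hq
  have key : ∀ M : ℕ, ∃ t : ℕ,
      (t : ℝ) = ∑ m ∈ Finset.range M, T'.stepFun (fun β => q β) (T'.toFun^[m] x) ∧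
      T'.toFun^[M] x = T.toFun^[t] x ∧
      ∑ m ∈ Finset.range M, bsum T T' B φ (T'.toFun^[m] x) =
        ∑ m ∈ Finset.range t, φ (T.toFun^[m] x) := by
    intro M
    induction M with
    | zero => exact ⟨0, by simp⟩
    | succ M ih =>
      obtain ⟨t, h1, h2, h3⟩ := ih
      obtain ⟨β, hβ⟩ := exists_mem_piece (iterate_mem_domain h.pos' (h'.domain_subset hx) M)
      refine ⟨t + q β, ?_, ?_, ?_⟩
      · rw [Finset.sum_range_succ, ← h1, stepFun_apply h.pos' _ hβ]
        push_cast
        rfl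
      · rw [Function.iterate_succ_apply', ← h.iterate_eq β _ hβ, h2, ← Function.iterate_add_apply,
          add_comm]
      · rw [Finset.sum_range_succ, h3, Finset.sum_range_add, h.bsum_apply φ hβ, h2]
        congr 1
        refine Finset.sum_congr rfl fun m _ => ?_
        rw [← Function.iterate_add_apply, add_comm]
  obtain ⟨t, h1, -, h3⟩ := key (∑ β, B' α β)
  rw [h''.bsum_apply φ hα, h'.bsum_apply _ hα, h3]
  congr 2
  rw [h'.count α x hα] at h1
  have : (t : ℝ) = ((∑ β, (B' * B) α β : ℕ) : ℝ) := by
    rw [h1]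
    simp only [hq, Matrix.mul_apply]
    push_cast
    rw [Finset.sum_comm]
    exact Finset.sum_congr rfl fun β _ => Finset.mul_sum _ _ _
  exact_mod_cast this.symm

theorem total_eq (h : Tower T T' B) : T.total = ∑ α, ((∑ β, B α β : ℕ) : ℝ) * T'.len α := by
  simp only [total, h.len_eq]
  rw [Finset.sum_comm]
  refine Finset.sum_congr rfl fun α _ => ?_
  push_cast
  rw [Finset.sum_mul]

end Tower

end IETData

/-! ### Functions with integrable derivative -/

theorem abs_sub_le_integral_abs_deriv {f f' : ℝ → ℝ} {p q : ℝ}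
    (hf : ∀ x ∈ Ioo p q, HasDerivAt f (f' x) x) (hf' : IntegrableOn f' (Ioo p q)) {x y : ℝ}
    (hx : x ∈ Ioo p q) (hy : y ∈ Ioo p q) (hxy : x ≤ y) :
    |f y - f x| ≤ ∫ t in x..y, |f' t| := by
  have hsub : Icc x y ⊆ Ioo p q := fun t ht => ⟨hx.1.trans_le ht.1, ht.2.trans_lt hy.2⟩
  have hint : IntervalIntegrable f' volume x y := by
    rw [intervalIntegrable_iff_integrableOn_Icc_of_le hxy]
    exact hf'.mono_set hsub
  rw [← intervalIntegral.integral_eq_sub_of_hasDerivAt (fun t ht => hf t ?_) hint]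
  · exact intervalIntegral.abs_integral_le_integral_abs hxy
  · rw [uIcc_of_le hxy] at ht
    exact hsub ht

theorem eVariationOn_le_integral_abs_deriv {f f' : ℝ → ℝ} {p q : ℝ}
    (hf : ∀ x ∈ Ioo p q, HasDerivAt f (f' x) x) (hf' : IntegrableOn f' (Ioo p q)) :
    eVariationOn f (Ioo p q) ≤ ENNReal.ofReal (∫ t in Ioo p q, |f' t|) := by
  have hint : ∀ {x y}, p ≤ x → x ≤ y → y ≤ q → IntervalIntegrable (fun t => |f' t|) volume x y := by
    intro x y hpx hxy hyq
    rw [intervalIntegrable_iff_integrableOn_Ioo_of_le hxy]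
    exact IntegrableOn.mono_set (Integrable.abs hf') (Ioo_subset_Ioo hpx hyq)
  set F : ℝ → ℝ := fun x => ∫ t in p..x, |f' t| with hF
  have hsub : ∀ {x y}, p ≤ x → x ≤ y → y ≤ q → F y - F x = ∫ t in x..y, |f' t| := by
    intro x y hpx hxy hyq
    exact intervalIntegral.integral_interval_sub_left (hint le_rfl (hpx.trans hxy) hyq)
      (hint le_rfl hpx (hxy.trans hyq))
  have hmono : MonotoneOn F (Icc p q) := by
    intro x hx y hy hxy
    rw [← sub_nonneg, hsub hx.1 hxy hy.2]
    exact intervalIntegral.integral_nonneg hxy fun _ _ => abs_nonneg _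
  rcases le_or_gt q p with hqp | hpq
  · rw [Ioo_eq_empty (not_lt.2 hqp), eVariationOn.subsingleton f subsingleton_empty]
    exact zero_le
  have h1 : eVariationOn f (Ioo p q) ≤ eVariationOn F (Icc p q) := by
    refine iSup_le fun ⟨n, u, hu, hus⟩ => ?_
    refine le_trans (Finset.sum_le_sum fun i _ => ?_)
      (eVariationOn.sum_le (f := F) hu fun i => Ioo_subset_Icc_self (hus i))
    rw [edist_dist, edist_dist]
    refine ENNReal.ofReal_le_ofReal ?_
    rw [Real.dist_eq, Real.dist_eq]
    refine le_trans (abs_sub_le_integral_abs_deriv hf hf' (hus i) (hus (i + 1))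
      (hu (Nat.le_succ i))) (le_trans (le_of_eq ?_) (le_abs_self _))
    exact (hsub (hus i).1.le (hu (Nat.le_succ i)) (hus (i + 1)).2.le).symm
  refine h1.trans ?_
  have := hmono.eVariationOn_eq (left_mem_Icc.2 hpq.le) (right_mem_Icc.2 hpq.le)
  rw [inter_self] at this
  refine this.le.trans (ENNReal.ofReal_le_ofReal (le_of_eq ?_))
  rw [hsub le_rfl hpq.le le_rfl, intervalIntegral.integral_of_le hpq.le,
    integral_Ioc_eq_integral_Ioo]

theorem abs_sub_le_setIntegral_abs_deriv {f f' : ℝ → ℝ} {p q : ℝ}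
    (hf : ∀ x ∈ Ioo p q, HasDerivAt f (f' x) x) (hf' : IntegrableOn f' (Ioo p q)) {x y : ℝ}
    (hx : x ∈ Ioo p q) (hy : y ∈ Ioo p q) :
    |f x - f y| ≤ ∫ t in Ioo p q, |f' t| := by
  wlog hxy : y ≤ x generalizing x y
  · rw [abs_sub_comm]
    exact this hy hx (le_of_not_ge hxy)
  refine (abs_sub_le_integral_abs_deriv hf hf' hy hx hxy).trans ?_
  rw [intervalIntegral.integral_of_le hxy]
  refine setIntegral_mono_set hf'.abs (ae_of_all _ fun _ => abs_nonneg _) (LE.le.eventuallyLE ?_)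
  exact fun t ht => ⟨hy.1.trans ht.1, ht.2.trans_lt hx.2⟩

/-! ### Oscillation in `L¹` of functions with singularities at the ends of an interval -/

theorem lintegral_sub_midpoint_le {ψ : ℝ → ℝ} {p q : ℝ} (hpq : p < q)
    (hψ : ContDiffOn ℝ 1 ψ (Ioo p q)) :
    ∫⁻ x in Ioo p q, ‖ψ x - ψ ((p + q) / 2)‖ₑ ≤
      ∫⁻ t in Ioo p q, ‖deriv ψ t‖ₑ * ENNReal.ofReal (min (t - p) (q - t)) := by
  set c := (p + q) / 2 with hc
  have hcmem : c ∈ Ioo p q := ⟨by rw [hc]; linarith, by rw [hc]; linarith⟩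
  have hderiv : ∀ x ∈ Ioo p q, HasDerivAt ψ (deriv ψ x) x := fun x hx =>
    ((hψ.differentiableOn one_ne_zero x hx).differentiableAt
      (Ioo_mem_nhds hx.1 hx.2)).hasDerivAt
  have hcont : ContinuousOn (deriv ψ) (Ioo p q) := hψ.continuousOn_deriv_of_isOpen isOpen_Ioo le_rfl
  have huIcc : ∀ x ∈ Ioo p q, uIcc c x ⊆ Ioo p q := fun x hx =>
    (ordConnected_Ioo).uIcc_subset hcmem hx
  set K : ℝ → ℝ → ENNReal := fun x t => (uIoc c x).indicator (fun t => ‖deriv ψ t‖ₑ) t with hK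
  have hKm : Measurable (Function.uncurry K) := by
    have hs : MeasurableSet {z : ℝ × ℝ | z.2 ∈ uIoc c z.1} := by
      have : {z : ℝ × ℝ | z.2 ∈ uIoc c z.1} =
          {z : ℝ × ℝ | min c z.1 < z.2} ∩ {z : ℝ × ℝ | z.2 ≤ max c z.1} := by
        ext z; rfl
      rw [this]
      exact (measurableSet_lt (by fun_prop) (by fun_prop)).inter
        (measurableSet_le (by fun_prop) (by fun_prop))
    have : Function.uncurry K =
        {z : ℝ × ℝ | z.2 ∈ uIoc c z.1}.indicator fun z => ‖deriv ψ z.2‖ₑ := by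
      ext z
      simp only [Function.uncurry, hK, indicator]
      rfl
    rw [this]
    exact Measurable.indicator (((measurable_deriv ψ).comp measurable_snd).enorm) hs
  have h1 : ∀ x ∈ Ioo p q, ‖ψ x - ψ c‖ₑ ≤ ∫⁻ t, K x t := by
    intro x hx
    have hint : IntervalIntegrable (deriv ψ) volume c x :=
      (hcont.mono (huIcc x hx)).intervalIntegrable
    rw [← intervalIntegral.integral_eq_sub_of_hasDerivAt
      (fun t ht => hderiv t (huIcc x hx ht)) hint, hK, lintegral_indicator measurableSet_uIoc]
    have := intervalIntegral.norm_intervalIntegral_eq (deriv ψ) c x volume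
    rw [← ofReal_norm, this, ofReal_norm]
    exact enorm_integral_le_lintegral_enorm _
  have hswap : ∫⁻ x in Ioo p q, ∫⁻ t, K x t = ∫⁻ t, ∫⁻ x in Ioo p q, K x t :=
    lintegral_lintegral_swap hKm.aemeasurable
  refine (setLIntegral_mono' measurableSet_Ioo h1).trans ?_
  rw [hswap, ← lintegral_indicator measurableSet_Ioo]
  refine lintegral_mono fun t => ?_
  have hKt : ∀ x, K x t = {x | t ∈ uIoc c x}.indicator (fun _ => ‖deriv ψ t‖ₑ) x := by
    intro x
    simp only [hK, indicator]
    rfl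
  have hle : ∀ s : Set ℝ, (∀ x ∈ Ioo p q, t ∈ uIoc c x → x ∈ s) →
      ∫⁻ x in Ioo p q, K x t ≤ ‖deriv ψ t‖ₑ * volume s := by
    intro s hs
    rw [← setLIntegral_const]
    simp only [hKt]
    have hms : MeasurableSet {x | t ∈ uIoc c x} := by
      have : {x | t ∈ uIoc c x} = {x : ℝ | min c x < t} ∩ {x : ℝ | t ≤ max c x} := by
        ext z; rfl
      rw [this]
      exact (measurableSet_lt (by fun_prop) (by fun_prop)).inter
        (measurableSet_le (by fun_prop) (by fun_prop))
    rw [setLIntegral_indicator hms]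
    exact lintegral_mono_set fun x hx => hs x hx.2 hx.1
  by_cases ht : t ∈ Ioo p q
  · rw [indicator_of_mem ht]
    rcases le_or_gt t c with htc | htc
    · have hmin : min (t - p) (q - t) = t - p := min_eq_left (by rw [hc] at htc; linarith)
      rw [hmin, ← Real.volume_Ioo]
      refine hle _ fun x hx htx => ⟨hx.1, ?_⟩
      rcases mem_uIoc.1 htx with h | h
      · exact absurd h.1 (not_lt.2 htc)
      · exact h.1
    · have hmin : min (t - p) (q - t) = q - t := min_eq_right (by rw [hc] at htc; linarith)
      rw [hmin, ← Real.volume_Ico]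
      refine hle _ fun x hx htx => ⟨?_, hx.2⟩
      rcases mem_uIoc.1 htx with h | h
      · exact h.2
      · exact absurd h.2 (not_le.2 htc)
  · rw [indicator_of_notMem ht]
    refine (hle ∅ fun x hx htx => ht (huIcc x hx (uIoc_subset_uIcc htx))).trans ?_
    simp

theorem integral_sub_midpoint_le {ψ G : ℝ → ℝ} {p q : ℝ} (hpq : p < q)
    (hψ : ContDiffOn ℝ 1 ψ (Ioo p q)) (hG : IntegrableOn G (Ioo p q))
    (hle : ∀ t ∈ Ioo p q, |deriv ψ t| * min (t - p) (q - t) ≤ G t) :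
    IntegrableOn ψ (Ioo p q) ∧
      ∫ x in Ioo p q, |ψ x - ψ ((p + q) / 2)| ≤ ∫ x in Ioo p q, G x := by
  have hG0 : ∀ t ∈ Ioo p q, 0 ≤ G t := fun t ht =>
    (mul_nonneg (abs_nonneg _) (le_min (sub_nonneg.2 ht.1.le) (sub_nonneg.2 ht.2.le))).trans
      (hle t ht)
  have h1 : ∫⁻ x in Ioo p q, ‖ψ x - ψ ((p + q) / 2)‖ₑ ≤
      ENNReal.ofReal (∫ x in Ioo p q, G x) := by
    rw [ofReal_integral_eq_lintegral_ofReal hG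
      ((ae_restrict_iff' measurableSet_Ioo).2 (ae_of_all _ hG0))]
    refine (lintegral_sub_midpoint_le hpq hψ).trans (setLIntegral_mono' measurableSet_Ioo ?_)
    intro t ht
    rw [← ofReal_norm, ← ENNReal.ofReal_mul (norm_nonneg _)]
    exact ENNReal.ofReal_le_ofReal (hle t ht)
  have hmeas : AEStronglyMeasurable (fun x => ψ x - ψ ((p + q) / 2))
      (volume.restrict (Ioo p q)) :=
    (hψ.continuousOn.sub continuousOn_const).aestronglyMeasurable measurableSet_Ioo
  have hint : IntegrableOn (fun x => ψ x - ψ ((p + q) / 2)) (Ioo p q) :=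
    ⟨hmeas, h1.trans_lt ENNReal.ofReal_lt_top⟩
  refine ⟨?_, ?_⟩
  · have := hint.add (integrableOn_const (C := ψ ((p + q) / 2)) (s := Ioo p q) (μ := volume)
      (by simp))
    simpa [IntegrableOn, Pi.add_def] using this
  · have h2 := integral_norm_eq_lintegral_enorm hmeas
    simp only [Real.norm_eq_abs] at h2
    rw [h2]
    exact ENNReal.toReal_le_of_le_ofReal (setIntegral_nonneg measurableSet_Ioo hG0) h1

theorem integral_sub_average_le {ψ G : ℝ → ℝ} {p q : ℝ} (hpq : p < q)
    (hψ : ContDiffOn ℝ 1 ψ (Ioo p q)) (hG : IntegrableOn G (Ioo p q))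
    (hle : ∀ t ∈ Ioo p q, |deriv ψ t| * min (t - p) (q - t) ≤ G t) :
    ∫ x in Ioo p q, |ψ x - (q - p)⁻¹ * ∫ y in Ioo p q, ψ y| ≤ 2 * ∫ x in Ioo p q, G x := by
  obtain ⟨hi, hle⟩ := integral_sub_midpoint_le hpq hψ hG hle
  set c := ψ ((p + q) / 2)
  have hconst : ∀ b : ℝ, IntegrableOn (fun _ => b) (Ioo p q) := fun b =>
    integrableOn_const (by simp)
  have hvol : ∀ b : ℝ, ∫ _ in Ioo p q, b = (q - p) * b := fun b => by
    rw [setIntegral_const, measureReal_def, Real.volume_Ioo,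
      ENNReal.toReal_ofReal (sub_nonneg.2 hpq.le), smul_eq_mul]
  have hqp : 0 < q - p := sub_pos.2 hpq
  have hcav : (q - p) * |c - (q - p)⁻¹ * ∫ y in Ioo p q, ψ y| ≤ ∫ x in Ioo p q, |ψ x - c| := by
    calc (q - p) * |c - (q - p)⁻¹ * ∫ y in Ioo p q, ψ y|
        = |(q - p) * (c - (q - p)⁻¹ * ∫ y in Ioo p q, ψ y)| := by
          rw [abs_mul, abs_of_pos hqp]
      _ = |∫ y in Ioo p q, (ψ y - c)| := by
          rw [integral_sub hi (hconst c), hvol, mul_sub, mul_inv_cancel_left₀ hqp.ne', abs_sub_comm]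
      _ ≤ _ := abs_integral_le_integral_abs
  calc ∫ x in Ioo p q, |ψ x - (q - p)⁻¹ * ∫ y in Ioo p q, ψ y|
      ≤ ∫ x in Ioo p q, (|ψ x - c| + |c - (q - p)⁻¹ * ∫ y in Ioo p q, ψ y|) := by
        refine integral_mono (hi.sub (hconst _)).abs ((hi.sub (hconst _)).abs.add (hconst _)) ?_
        intro x
        exact abs_sub_le _ _ _
    _ = (∫ x in Ioo p q, |ψ x - c|) + (q - p) * |c - (q - p)⁻¹ * ∫ y in Ioo p q, ψ y| := by
        have := integral_add (hi.sub (hconst c)).abs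
          (hconst |c - (q - p)⁻¹ * ∫ y in Ioo p q, ψ y|)
        rw [hvol] at this
        exact this
    _ ≤ 2 * ∫ x in Ioo p q, G x := by linarith

/-! ### The profile of a power singularity -/

namespace IETData

/-- Weight of a singularity of order `1 + a` at distance `s`, truncated at length `L`. -/
def profile (a L s : ℝ) : ℝ := s ^ (-(1 + a)) * min s L

theorem profile_nonneg {a L s : ℝ} (hL : 0 ≤ L) (hs : 0 ≤ s) : 0 ≤ profile a L s :=
  mul_nonneg (Real.rpow_nonneg hs _) (le_min hs hL)

theorem profile_le_left {a L s : ℝ} (hs : 0 < s) : profile a L s ≤ s ^ (-a) := by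
  have : s ^ (-a) = s ^ (-(1 + a)) * s := by
    rw [← Real.rpow_add_one hs.ne']
    ring_nf
  rw [profile, this]
  exact mul_le_mul_of_nonneg_left (min_le_left _ _) (Real.rpow_nonneg hs.le _)

theorem profile_le_right {a L s : ℝ} (hs : 0 < s) : profile a L s ≤ s ^ (-(1 + a)) * L :=
  mul_le_mul_of_nonneg_left (min_le_right _ _) (Real.rpow_nonneg hs.le _)

theorem intervalIntegrable_profile {a L x y : ℝ} (ha1 : a < 1) (hL : 0 ≤ L) (hx : 0 ≤ x)
    (hxy : x ≤ y) : IntervalIntegrable (profile a L) volume x y := by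
  have h1 : IntervalIntegrable (fun s : ℝ => s ^ (-a)) volume x y :=
    intervalIntegral.intervalIntegrable_rpow' (by linarith)
  rw [intervalIntegrable_iff_integrableOn_Ioc_of_le hxy] at *
  refine Integrable.mono' h1 ?_ ?_
  · refine Measurable.aestronglyMeasurable ?_
    unfold profile
    fun_prop
  · refine (ae_restrict_iff' measurableSet_Ioc).2 (ae_of_all _ fun s hs => ?_)
    rw [Real.norm_eq_abs, abs_of_nonneg (profile_nonneg hL (hx.trans hs.1.le))]
    exact profile_le_left (hx.trans_lt hs.1)

theorem integral_profile_le {a : ℝ} (ha0 : 0 ≤ a) (ha1 : a < 1) {A : ℝ} (hA : 0 < A) :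
    ∃ C : ℝ, 0 ≤ C ∧ ∀ L, 0 < L → L ≤ A →
      ∫ s in (0 : ℝ)..A, profile a L s ≤ C * (L * bracket a (A / L)) := by
  have key : ∀ L, 0 < L → L ≤ A → ∫ s in (0 : ℝ)..A, profile a L s ≤
      L ^ (1 - a) / (1 - a) + L * ∫ s in L..A, s ^ (-(1 + a)) := by
    intro L hL hLA
    rw [← intervalIntegral.integral_add_adjacent_intervals
      (intervalIntegrable_profile ha1 hL.le le_rfl hL.le)
      (intervalIntegrable_profile ha1 hL.le hL.le hLA)]
    refine add_le_add ?_ ?_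
    · have h1 : IntervalIntegrable (fun s : ℝ => s ^ (-a)) volume 0 L :=
        intervalIntegral.intervalIntegrable_rpow' (by linarith)
      have h2 : ∫ s in (0 : ℝ)..L, s ^ (-a) = L ^ (1 - a) / (1 - a) := by
        rw [integral_rpow (Or.inl (by linarith)), Real.zero_rpow (by linarith), sub_zero]
        ring_nf
      rw [← h2]
      refine intervalIntegral.integral_mono_on_of_le_Ioo hL.le
        (intervalIntegrable_profile ha1 hL.le le_rfl hL.le) h1 fun s hs => profile_le_left hs.1
    · rw [mul_comm, ← intervalIntegral.integral_mul_const]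
      refine intervalIntegral.integral_mono_on_of_le_Ioo hLA
        (intervalIntegrable_profile ha1 hL.le hL.le hLA) ?_
        fun s hs => profile_le_right (hL.trans hs.1)
      refine ContinuousOn.intervalIntegrable ?_
      rw [uIcc_of_le hLA]
      exact ((continuousOn_id.rpow_const fun s hs => Or.inl (hL.trans_le hs.1).ne')).mul
        continuousOn_const
  rcases ha0.eq_or_lt with rfl | ha
  · refine ⟨1, zero_le_one, fun L hL hLA => (key L hL hLA).trans (le_of_eq ?_)⟩
    have : ∫ s in L..A, s ^ (-(1 + 0) : ℝ) = Real.log (A / L) := by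
      rw [← integral_inv_of_pos hL hA]
      refine intervalIntegral.integral_congr fun s hs => ?_
      simp only [add_zero, Real.rpow_neg_one]
    rw [this, bracket, if_neg (lt_irrefl _)]
    simp
    ring
  · refine ⟨A ^ (-a) * (1 / (1 - a) + 1 / a), ?_, fun L hL hLA => (key L hL hLA).trans ?_⟩
    · have : 0 < 1 - a := by linarith
      positivity
    · have h0 : (0 : ℝ) ∉ uIcc L A := by
        rw [uIcc_of_le hLA]
        exact fun h => absurd h.1 (not_le.2 hL)
      rw [integral_rpow (Or.inr ⟨by linarith, h0⟩), bracket, if_pos ha]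
      have hA' : A ^ (-a) * (L * (A / L) ^ a) = L ^ (1 - a) := by
        rw [Real.div_rpow hA.le hL.le, Real.rpow_neg hA.le, Real.rpow_sub hL, Real.rpow_one]
        have : A ^ a ≠ 0 := (Real.rpow_pos_of_pos hA _).ne'
        field_simp
      have hL' : L * L ^ (-a) = L ^ (1 - a) := by
        rw [sub_eq_add_neg, Real.rpow_add hL, Real.rpow_one]
      have e1 : -(1 + a) + 1 = -a := by ring
      rw [e1]
      have hAn : 0 ≤ L * A ^ (-a) / a := by positivity
      calc L ^ (1 - a) / (1 - a) + L * ((A ^ (-a) - L ^ (-a)) / -a)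
          = L ^ (1 - a) / (1 - a) + L * L ^ (-a) / a - L * A ^ (-a) / a := by
            field_simp
            ring
        _ ≤ L ^ (1 - a) / (1 - a) + L * L ^ (-a) / a := by linarith
        _ = (A ^ (-a) * (L * (A / L) ^ a)) * (1 / (1 - a) + 1 / a) := by
            rw [hL', hA']; ring
        _ = _ := by ring

/-- `ψ` is `C¹` on the interiors of the exchanged intervals, and its derivative has singularities
of order at most `1 + a` with constant `P` at their ends. -/
def SingBound (T : IETData 𝒜 d) (a P : ℝ) (ψ : ℝ → ℝ) : Prop :=
  (∀ α, ContDiffOn ℝ 1 ψ (T.inner α)) ∧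
    ∀ α, ∀ x ∈ T.inner α, |deriv ψ x| * min (x - T.left α) (T.right α - x) ^ (1 + a) ≤ P

/-- A majorant for `|ψ'|` multiplied with the truncated distance to the singularities. -/
def majorant (T : IETData 𝒜 d) (a P L t : ℝ) : ℝ :=
  P * ∑ β, (T.inner β).indicator
    (fun t => profile a L (t - T.left β) + profile a L (T.right β - t)) t

theorem majorant_apply {T : IETData 𝒜 d} (hpos : ∀ α, 0 < T.len α) (a P L : ℝ) {β : 𝒜} {t : ℝ}
    (ht : t ∈ T.inner β) : T.majorant a P L t =
      P * (profile a L (t - T.left β) + profile a L (T.right β - t)) := by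
  rw [majorant, Finset.sum_eq_single β]
  · rw [indicator_of_mem ht]
  · intro γ _ hγ
    rw [indicator_of_notMem]
    exact fun h => hγ (eq_of_mem_piece hpos (T.inner_subset_piece γ h) (T.inner_subset_piece β ht))
  · simp

theorem majorant_nonneg (T : IETData 𝒜 d) {a P L : ℝ} (hP : 0 ≤ P) (hL : 0 ≤ L) (t : ℝ) :
    0 ≤ T.majorant a P L t := by
  refine mul_nonneg hP (Finset.sum_nonneg fun β _ => indicator_nonneg (fun x hx => ?_) _)
  exact add_nonneg (profile_nonneg hL (sub_nonneg.2 hx.1.le))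
    (profile_nonneg hL (sub_nonneg.2 hx.2.le))

theorem integral_majorant {T : IETData 𝒜 d} (hpos : ∀ α, 0 < T.len α) {a P L : ℝ} (ha1 : a < 1)
    (hP : 0 ≤ P) (hL : 0 ≤ L) :
    IntegrableOn (T.majorant a P L) T.domain ∧ ∫ t in T.domain, T.majorant a P L t ≤
      P * (Fintype.card 𝒜 * (2 * ∫ s in (0 : ℝ)..T.total, profile a L s)) := by
  have hii : ∀ β, IntervalIntegrable (fun t => profile a L (t - T.left β)) volume
        (T.left β) (T.right β) ∧
      IntervalIntegrable (fun t => profile a L (T.right β - t)) volume (T.left β) (T.right β) := by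
    intro β
    have h0 := intervalIntegrable_profile ha1 hL le_rfl
      (sub_nonneg.2 (left_lt_right hpos β).le)
    have h1 := h0.comp_sub_right (T.left β)
    have h2 := (h0.comp_sub_left (T.right β)).symm
    simp only [zero_add, sub_add_cancel, sub_zero, sub_sub_cancel] at h1 h2
    exact ⟨h1, h2⟩
  have hio : ∀ β, IntegrableOn (fun t => P * (profile a L (t - T.left β) +
      profile a L (T.right β - t))) (T.inner β) := by
    intro β
    have := ((hii β).1.add (hii β).2).const_mul P
    rw [intervalIntegrable_iff_integrableOn_Ioo_of_le (left_lt_right hpos β).le] at this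
    exact this
  have hint : IntegrableOn (T.majorant a P L) T.domain := by
    rw [integrableOn_domain_iff hpos]
    intro β
    rw [integrableOn_piece_iff_inner]
    exact (hio β).congr_fun (fun t ht => (majorant_apply hpos a P L ht).symm)
      (T.measurableSet_inner β)
  refine ⟨hint, ?_⟩
  rw [integral_domain_eq_sum hpos hint]
  have hterm : ∀ β, ∫ t in T.piece β, T.majorant a P L t ≤
      P * (2 * ∫ s in (0 : ℝ)..T.total, profile a L s) := by
    intro β
    have hlr := (left_lt_right hpos β).le
    rw [integral_piece_eq_inner, setIntegral_congr_fun (T.measurableSet_inner β)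
      (fun t ht => majorant_apply hpos a P L ht), inner, ← integral_Ioc_eq_integral_Ioo,
      ← intervalIntegral.integral_of_le hlr, intervalIntegral.integral_const_mul,
      intervalIntegral.integral_add (hii β).1 (hii β).2,
      intervalIntegral.integral_comp_sub_right (fun s => profile a L s),
      intervalIntegral.integral_comp_sub_left (fun s => profile a L s), sub_self, sub_self,
      ← two_mul]
    refine mul_le_mul_of_nonneg_left (mul_le_mul_of_nonneg_left ?_ zero_le_two) hP
    have hle : T.right β - T.left β ≤ T.total := by
      linarith [right_le_total hpos β, left_nonneg hpos β]
    refine intervalIntegral.integral_mono_interval le_rfl (sub_nonneg.2 hlr) hle ?_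
      (intervalIntegrable_profile ha1 hL le_rfl (total_pos hpos).le)
    exact (ae_restrict_iff' measurableSet_Ioc).2
      (ae_of_all _ fun s hs => profile_nonneg hL hs.1.le)
  refine (Finset.sum_le_sum fun β _ => hterm β).trans (le_of_eq ?_)
  rw [Finset.sum_const, Finset.card_univ, nsmul_eq_mul]
  ring

theorem SingBound.nonneg {T : IETData 𝒜 d} (hpos : ∀ α, 0 < T.len α) {a P : ℝ} {ψ : ℝ → ℝ}
    (h : T.SingBound a P ψ) : 0 ≤ P := by
  set α := T.π₀.symm 0
  have hx : (T.left α + T.right α) / 2 ∈ T.inner α := by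
    have := left_lt_right hpos α
    constructor <;> linarith
  refine le_trans (mul_nonneg (abs_nonneg _) (Real.rpow_nonneg (le_min ?_ ?_) _)) (h.2 α _ hx)
  · exact sub_nonneg.2 hx.1.le
  · exact sub_nonneg.2 hx.2.le

theorem SingBound.le_majorant {T : IETData 𝒜 d} (hpos : ∀ α, 0 < T.len α) {a P : ℝ}
    {ψ : ℝ → ℝ} (h : T.SingBound a P ψ) {L p q : ℝ} {β : 𝒜} (hl : T.left β ≤ p)
    (hr : q ≤ T.right β) (hL : q - p ≤ L) {t : ℝ} (ht : t ∈ Ioo p q) :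
    |deriv ψ t| * min (t - p) (q - t) ≤ T.majorant a P L t := by
  have ht' : t ∈ T.inner β := ⟨hl.trans_lt ht.1, ht.2.trans_le hr⟩
  have hP := h.nonneg hpos
  have hL0 : 0 ≤ L := by linarith [ht.1, ht.2]
  rw [majorant_apply hpos a P L ht']
  set e := min (t - T.left β) (T.right β - t) with he
  have he0 : 0 < e := lt_min (sub_pos.2 ht'.1) (sub_pos.2 ht'.2)
  have h1 : |deriv ψ t| ≤ P * e ^ (-(1 + a)) := by
    rw [Real.rpow_neg he0.le, ← div_eq_mul_inv, le_div_iff₀ (Real.rpow_pos_of_pos he0 _)]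
    exact h.2 β t ht'
  have h2 : min (t - p) (q - t) ≤ min e L := by
    refine le_min (min_le_min (by linarith) (by linarith)) ((min_le_left _ _).trans ?_)
    linarith [ht.2]
  have h3 : 0 ≤ min (t - p) (q - t) := le_min (sub_nonneg.2 ht.1.le) (sub_nonneg.2 ht.2.le)
  calc |deriv ψ t| * min (t - p) (q - t) ≤ P * e ^ (-(1 + a)) * min e L :=
        mul_le_mul h1 h2 h3 (mul_nonneg hP (Real.rpow_nonneg he0.le _))
    _ = P * profile a L e := by rw [profile, mul_assoc]
    _ ≤ _ := by
        refine mul_le_mul_of_nonneg_left ?_ hP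
        have hn1 := profile_nonneg (a := a) hL0 (sub_nonneg.2 ht'.1.le)
        have hn2 := profile_nonneg (a := a) hL0 (sub_nonneg.2 ht'.2.le)
        rcases min_choice (t - T.left β) (T.right β - t) with hm | hm <;> rw [he, hm] <;> linarith

theorem SingBound.integrableOn {T : IETData 𝒜 d} (hpos : ∀ α, 0 < T.len α) {a P : ℝ}
    (ha1 : a < 1) {ψ : ℝ → ℝ} (h : T.SingBound a P ψ) : IntegrableOn ψ T.domain := by
  have ht := total_pos hpos
  rw [integrableOn_domain_iff hpos]
  intro α
  rw [integrableOn_piece_iff_inner]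
  refine (integral_sub_midpoint_le (G := T.majorant a P T.total) (left_lt_right hpos α) (h.1 α) ?_
    fun t ht => h.le_majorant hpos le_rfl le_rfl ?_ ht).1
  · exact (integral_majorant hpos ha1 (h.nonneg hpos) ht.le).1.mono_set
      ((T.inner_subset_piece α).trans (piece_subset_domain hpos α))
  · linarith [right_le_total hpos α, left_nonneg hpos α]

namespace Tower

variable {T T' : IETData 𝒜 d} {B : Matrix 𝒜 𝒜 ℕ}

theorem mean_bsum (h : Tower T T' B) {f : ℝ → ℝ} (hf : IntegrableOn f T.domain) (α : 𝒜) :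
    T'.mean (bsum T T' B f) α = ∑ m ∈ Finset.range (∑ β, B α β),
      (T'.len α)⁻¹ * ∫ y in floor T T' α m, f y := by
  rw [mean_apply, ← Finset.mul_sum, setIntegral_congr_fun (T'.measurableSet_piece α)
    (fun x hx => h.bsum_apply f hx), integral_finsetSum _
    fun m hm => h.integrableOn_iterate (Finset.mem_range.1 hm) hf]
  congr 1
  exact Finset.sum_congr rfl fun m hm => h.integral_iterate (Finset.mem_range.1 hm) f

theorem floor_endpoints (h : Tower T T' B) {α : 𝒜} {m : ℕ} (hm : m < ∑ β, B α β) :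
    ∃ β, T.left β ≤ T.toFun^[m] (T'.left α) ∧
      T.toFun^[m] (T'.left α) + T'.len α ≤ T.right β := by
  obtain ⟨β, hβ⟩ := h.exists_floor_subset hm
  exact ⟨β, (Ico_subset_Ico_iff (by linarith [h.pos' α])).1 hβ⟩

theorem len_le_total (h : Tower T T' B) (α : 𝒜) : T'.len α ≤ T'.total :=
  Finset.single_le_sum (f := T'.len) (fun β _ => (h.pos' β).le) (Finset.mem_univ α)

/-- The `L¹` distance of a special Birkhoff sum to its mean values. -/
theorem integral_bsum_sub_mean_le (h : Tower T T' B) {a P : ℝ} (ha1 : a < 1) {ψ : ℝ → ℝ}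
    (hψ : T.SingBound a P ψ) :
    ∫ x in T'.domain, |bsum T T' B ψ x - T'.stepFun (T'.mean (bsum T T' B ψ)) x| ≤
      2 * ∫ t in T.domain, T.majorant a P T'.total t := by
  have hL := (total_pos h.pos').le
  have hi := hψ.integrableOn h.pos ha1
  have hP := hψ.nonneg h.pos
  have hG := (integral_majorant h.pos ha1 hP hL).1
  have habs : IntegrableOn (fun x => |bsum T T' B ψ x -
      T'.stepFun (T'.mean (bsum T T' B ψ)) x|) T'.domain :=
    ((h.integrableOn_bsum hi).sub (integrableOn_stepFun h.pos' _)).abs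
  rw [integral_domain_eq_sum h.pos' habs]
  have hfl := h.sum_integral_floor_le hG fun x _ => T.majorant_nonneg hP hL x
  refine le_trans ?_ (mul_le_mul_of_nonneg_left hfl zero_le_two)
  rw [Finset.mul_sum]
  refine Finset.sum_le_sum fun α _ => ?_
  set f : ℕ → ℝ → ℝ := fun m y => ψ y - (T'.len α)⁻¹ * ∫ y in floor T T' α m, ψ y with hf
  have hfi : ∀ m ∈ Finset.range (∑ β, B α β),
      IntegrableOn (fun x => f m (T.toFun^[m] x)) (T'.piece α) := fun m hm =>
    (h.integrableOn_iterate (Finset.mem_range.1 hm) hi).sub (integrableOn_const (by simp [piece]))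
  have heq : EqOn (fun x => |bsum T T' B ψ x - T'.stepFun (T'.mean (bsum T T' B ψ)) x|)
      (fun x => |∑ m ∈ Finset.range (∑ β, B α β), f m (T.toFun^[m] x)|) (T'.piece α) := by
    intro x hx
    simp only [hf]
    rw [h.bsum_apply ψ hx, stepFun_apply h.pos' _ hx, h.mean_bsum hi, Finset.sum_sub_distrib]
  rw [setIntegral_congr_fun (T'.measurableSet_piece α) heq, Finset.mul_sum]
  calc ∫ x in T'.piece α, |∑ m ∈ Finset.range (∑ β, B α β), f m (T.toFun^[m] x)|
      ≤ ∫ x in T'.piece α, ∑ m ∈ Finset.range (∑ β, B α β), |f m (T.toFun^[m] x)| :=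
        integral_mono (integrable_finsetSum _ hfi).abs
          (integrable_finsetSum _ fun m hm => (hfi m hm).abs)
          fun x => Finset.abs_sum_le_sum_abs _ _
    _ = ∑ m ∈ Finset.range (∑ β, B α β), ∫ x in T'.piece α, |f m (T.toFun^[m] x)| :=
        integral_finsetSum _ fun m hm => (hfi m hm).abs
    _ ≤ _ := Finset.sum_le_sum fun m hm => ?_
  have hm' := Finset.mem_range.1 hm
  obtain ⟨β, hβl, hβr⟩ := h.floor_endpoints hm'
  rw [h.integral_iterate hm' fun y => |f m y|]
  set p := T.toFun^[m] (T'.left α) with hp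
  have hpq : p < p + T'.len α := by linarith [h.pos' α]
  have hfloor : ∀ F : ℝ → ℝ, ∫ y in floor T T' α m, F y = ∫ y in Ioo p (p + T'.len α), F y :=
    fun F => setIntegral_congr_set Ioo_ae_eq_Ico.symm
  have := integral_sub_average_le hpq
    ((hψ.1 β).mono (Ioo_subset_Ioo hβl hβr)) (G := T.majorant a P T'.total)
    (hG.mono_set (Ioo_subset_Ico_self.trans (h.floor_subset_domain hm')))
    fun t ht => hψ.le_majorant h.pos hβl hβr (by linarith [h.len_le_total α]) ht
  rw [add_sub_cancel_left] at this
  simp only [hf, hfloor]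
  exact this

end Tower

/-- The `L¹` oscillation of special Birkhoff sums of functions with power singularities. -/
theorem exists_integral_bsum_sub_mean_le {T : IETData 𝒜 d} (hpos : ∀ α, 0 < T.len α) {a : ℝ}
    (ha0 : 0 ≤ a) (ha1 : a < 1) :
    ∃ C : ℝ, 0 ≤ C ∧ ∀ (T' : IETData 𝒜 d) (B : Matrix 𝒜 𝒜 ℕ), Tower T T' B → ∀ (P : ℝ)
      (ψ : ℝ → ℝ), T.SingBound a P ψ →
      ∫ x in T'.domain, |bsum T T' B ψ x - T'.stepFun (T'.mean (bsum T T' B ψ)) x| ≤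
        C * P * (T'.total * bracket a (T.total / T'.total)) := by
  obtain ⟨C, hC, hle⟩ := integral_profile_le ha0 ha1 (total_pos hpos)
  refine ⟨4 * Fintype.card 𝒜 * C, by positivity, fun T' B h P ψ hψ => ?_⟩
  have hP := hψ.nonneg hpos
  have ht' := total_pos h.pos'
  refine (h.integral_bsum_sub_mean_le ha1 hψ).trans ?_
  calc 2 * ∫ t in T.domain, T.majorant a P T'.total t
      ≤ 2 * (P * (Fintype.card 𝒜 * (2 * ∫ s in (0 : ℝ)..T.total, profile a T'.total s))) :=
        mul_le_mul_of_nonneg_left (integral_majorant hpos ha1 hP ht'.le).2 zero_le_two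
    _ ≤ 2 * (P * (Fintype.card 𝒜 * (2 * (C * (T'.total * bracket a (T.total / T'.total)))))) := by
        have := hle T'.total ht' h.total_le
        gcongr
    _ = _ := by ring

/-! ### Special Birkhoff sums of functions with integrable derivative -/

/-- `φ` is differentiable on the interiors of the exchanged intervals with derivative `ψ`, which
is continuous there. -/
def PieceDeriv (T : IETData 𝒜 d) (φ ψ : ℝ → ℝ) : Prop :=
  ∀ α, ContinuousOn ψ (T.inner α) ∧ ∀ x ∈ T.inner α, HasDerivAt φ (ψ x) x

theorem Tower.pieceDeriv {T T' : IETData 𝒜 d} {B : Matrix 𝒜 𝒜 ℕ} (h : Tower T T' B)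
    {φ ψ : ℝ → ℝ} (hφ : T.PieceDeriv φ ψ) : T'.PieceDeriv (bsum T T' B φ) (bsum T T' B ψ) := by
  intro α
  set c : ℕ → ℝ := fun m => T.toFun^[m] (T'.left α) - T'.left α with hc
  have hmem : ∀ m ∈ Finset.range (∑ β, B α β), ∃ β, MapsTo (fun x => x + c m) (T'.inner α)
      (T.inner β) := by
    intro m hm
    obtain ⟨β, hβ⟩ := h.iterate_mem_inner (Finset.mem_range.1 hm)
    refine ⟨β, fun x hx => ?_⟩
    have := hβ x hx
    rwa [h.iterate_eq_add (Finset.mem_range.1 hm) (T'.inner_subset_piece α hx)] at this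
  have heq : ∀ f : ℝ → ℝ, EqOn (bsum T T' B f)
      (fun x => ∑ m ∈ Finset.range (∑ β, B α β), f (x + c m)) (T'.inner α) := by
    intro f x hx
    rw [h.bsum_apply f (T'.inner_subset_piece α hx)]
    refine Finset.sum_congr rfl fun m hm => ?_
    rw [h.iterate_eq_add (Finset.mem_range.1 hm) (T'.inner_subset_piece α hx)]
  refine ⟨ContinuousOn.congr ?_ (heq ψ), fun x hx => ?_⟩
  · refine continuousOn_finsetSum _ fun m hm => ?_
    obtain ⟨β, hβ⟩ := hmem m hm
    exact (hφ β).1.comp (by fun_prop) hβ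
  · rw [heq ψ hx]
    have : HasDerivAt (fun x => ∑ m ∈ Finset.range (∑ β, B α β), φ (x + c m))
        (∑ m ∈ Finset.range (∑ β, B α β), ψ (x + c m)) x := by
      refine HasDerivAt.fun_sum fun m hm => ?_
      obtain ⟨β, hβ⟩ := hmem m hm
      exact HasDerivAt.comp_add_const x (c m) ((hφ β).2 _ (hβ hx))
    exact this.congr_of_eventuallyEq
      (Filter.eventuallyEq_of_mem (Ioo_mem_nhds hx.1 hx.2) (heq φ))

section PieceDeriv

variable {T : IETData 𝒜 d} {φ ψ : ℝ → ℝ}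

theorem PieceDeriv.abs_sub_le (hφ : T.PieceDeriv φ ψ) (hpos : ∀ α, 0 < T.len α)
    (hψ : IntegrableOn ψ T.domain) {α : 𝒜} {x y : ℝ} (hx : x ∈ T.inner α) (hy : y ∈ T.inner α) :
    |φ x - φ y| ≤ ∫ t in T.piece α, |ψ t| := by
  rw [integral_piece_eq_inner]
  exact abs_sub_le_setIntegral_abs_deriv (fun x hx => (hφ α).2 x hx)
    ((T.integrableOn_piece_iff_inner α).1 ((integrableOn_domain_iff hpos).1 hψ α)) hx hy

theorem integral_piece_le_domain (hpos : ∀ α, 0 < T.len α)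
    (hψ : IntegrableOn ψ T.domain) (α : 𝒜) : ∫ t in T.piece α, |ψ t| ≤ ∫ t in T.domain, |ψ t| :=
  setIntegral_mono_set hψ.abs (ae_of_all _ fun _ => abs_nonneg _)
    (LE.le.eventuallyLE (piece_subset_domain hpos α))

theorem PieceDeriv.var_le (hφ : T.PieceDeriv φ ψ) (hpos : ∀ α, 0 < T.len α)
    (hψ : IntegrableOn ψ T.domain) : T.Var φ ≤ ENNReal.ofReal (∫ t in T.domain, |ψ t|) := by
  rw [integral_domain_eq_sum hpos hψ.abs, ENNReal.ofReal_sum_of_nonneg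
    fun α _ => integral_nonneg fun _ => abs_nonneg _]
  refine Finset.sum_le_sum fun α _ => ?_
  rw [integral_piece_eq_inner]
  exact eVariationOn_le_integral_abs_deriv (fun x hx => (hφ α).2 x hx)
    ((T.integrableOn_piece_iff_inner α).1 ((integrableOn_domain_iff hpos).1 hψ α))

theorem PieceDeriv.integrableOn (hφ : T.PieceDeriv φ ψ) (hpos : ∀ α, 0 < T.len α)
    (hψ : IntegrableOn ψ T.domain) : IntegrableOn φ T.domain := by
  rw [integrableOn_domain_iff hpos]
  intro α
  rw [integrableOn_piece_iff_inner]
  have hmid : (T.left α + T.right α) / 2 ∈ T.inner α := by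
    have := left_lt_right hpos α
    constructor <;> linarith
  refine IntegrableOn.of_bound (by simp [inner]) ?_ (|φ ((T.left α + T.right α) / 2)| +
    ∫ t in T.piece α, |ψ t|) ?_
  · have hc : ContinuousOn φ (T.inner α) := fun x hx =>
      ((hφ α).2 x hx).continuousAt.continuousWithinAt
    exact hc.aestronglyMeasurable (T.measurableSet_inner α)
  · refine (ae_restrict_iff' (T.measurableSet_inner α)).2 (ae_of_all _ fun x hx => ?_)
    have := hφ.abs_sub_le hpos hψ hx hmid
    rw [Real.norm_eq_abs]
    linarith [abs_sub_abs_le_abs_sub (φ x) (φ ((T.left α + T.right α) / 2))]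

theorem PieceDeriv.abs_sub_mean_le (hφ : T.PieceDeriv φ ψ) (hpos : ∀ α, 0 < T.len α)
    (hψ : IntegrableOn ψ T.domain) {α : 𝒜} {x : ℝ} (hx : x ∈ T.inner α) :
    |φ x - T.mean φ α| ≤ ∫ t in T.piece α, |ψ t| := by
  have hi := (integrableOn_domain_iff hpos).1 (hφ.integrableOn hpos hψ) α
  have hc : IntegrableOn (fun _ => φ x) (T.piece α) := integrableOn_const (by simp [piece])
  have hl := hpos α
  have h1 : φ x - T.mean φ α = (T.len α)⁻¹ * ∫ y in T.piece α, (φ x - φ y) := by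
    rw [integral_sub hc hi, integral_piece_const hpos, mean_apply, mul_sub,
      inv_mul_cancel_left₀ hl.ne']
  rw [h1, abs_mul, abs_of_pos (inv_pos.2 hl), inv_mul_le_iff₀ hl,
    ← integral_piece_const hpos, integral_piece_eq_inner, integral_piece_eq_inner T α
      (fun _ => ∫ t in T.piece α, |ψ t|)]
  refine abs_integral_le_integral_abs.trans (setIntegral_mono_on ?_ ?_ (T.measurableSet_inner α) ?_)
  · exact ((T.integrableOn_piece_iff_inner α).1 (hc.sub hi)).abs
  · exact integrableOn_const (by simp [inner])
  · exact fun y hy => hφ.abs_sub_le hpos hψ hx hy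

theorem PieceDeriv.integral_sub_mean_le (hφ : T.PieceDeriv φ ψ) (hpos : ∀ α, 0 < T.len α)
    (hψ : IntegrableOn ψ T.domain) :
    ∫ x in T.domain, |φ x - T.stepFun (T.mean φ) x| ≤ T.total * ∫ t in T.domain, |ψ t| := by
  have hi : IntegrableOn (fun x => |φ x - T.stepFun (T.mean φ) x|) T.domain :=
    ((hφ.integrableOn hpos hψ).sub (integrableOn_stepFun hpos (T.mean φ))).abs
  rw [integral_domain_eq_sum hpos hi, total, Finset.sum_mul]
  refine Finset.sum_le_sum fun α _ => ?_
  rw [← integral_piece_const hpos, integral_piece_eq_inner, integral_piece_eq_inner T α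
    (fun _ => ∫ t in T.domain, |ψ t|)]
  refine setIntegral_mono_on ?_ ?_ (T.measurableSet_inner α) ?_
  · exact (T.integrableOn_piece_iff_inner α).1 ((integrableOn_domain_iff hpos).1 hi α)
  · exact integrableOn_const (by simp [inner])
  · intro x hx
    rw [stepFun_apply hpos _ (T.inner_subset_piece α hx)]
    exact (hφ.abs_sub_mean_le hpos hψ hx).trans (integral_piece_le_domain hpos hψ α)

end PieceDeriv

end IETData

/-! ### Operator norms -/

theorem opNormOn_nonneg (M : Matrix 𝒜 𝒜 ℝ) (W : Submodule ℝ (𝒜 → ℝ)) : 0 ≤ opNormOn M W :=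
  norm_nonneg (LinearMap.toContinuousLinearMap ((Matrix.toLin' M).domRestrict W))

theorem opNorm_nonneg (M : Matrix 𝒜 𝒜 ℝ) : 0 ≤ opNorm M := norm_nonneg _

theorem norm_mulVec_le_opNormOn (M : Matrix 𝒜 𝒜 ℝ) {W : Submodule ℝ (𝒜 → ℝ)} {v : 𝒜 → ℝ}
    (hv : v ∈ W) : ‖M.mulVec v‖ ≤ opNormOn M W * ‖v‖ :=
  (LinearMap.toContinuousLinearMap ((Matrix.toLin' M).domRestrict W)).le_opNorm ⟨v, hv⟩

theorem norm_mulVec_le_opNorm (M : Matrix 𝒜 𝒜 ℝ) (v : 𝒜 → ℝ) : ‖M.mulVec v‖ ≤ opNorm M * ‖v‖ :=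
  (LinearMap.toContinuousLinearMap (Matrix.toLin' M)).le_opNorm v

theorem opNormOn_le (M : Matrix 𝒜 𝒜 ℝ) {W : Submodule ℝ (𝒜 → ℝ)} {c : ℝ} (hc : 0 ≤ c)
    (h : ∀ v ∈ W, ‖M.mulVec v‖ ≤ c * ‖v‖) : opNormOn M W ≤ c :=
  ContinuousLinearMap.opNorm_le_bound _ hc fun v => h v v.2

theorem opNorm_le (M : Matrix 𝒜 𝒜 ℝ) {c : ℝ} (hc : 0 ≤ c)
    (h : ∀ v, ‖M.mulVec v‖ ≤ c * ‖v‖) : opNorm M ≤ c :=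
  ContinuousLinearMap.opNorm_le_bound _ hc h

theorem opNormOn_one_le (W : Submodule ℝ (𝒜 → ℝ)) : opNormOn (1 : Matrix 𝒜 𝒜 ℝ) W ≤ 1 :=
  opNormOn_le _ zero_le_one fun v _ => by rw [Matrix.one_mulVec, one_mul]

theorem opNorm_one_le : opNorm (1 : Matrix 𝒜 𝒜 ℝ) ≤ 1 :=
  opNorm_le _ zero_le_one fun v => by rw [Matrix.one_mulVec, one_mul]

theorem rowSum_le_opNorm (B : Matrix 𝒜 𝒜 ℕ) (α : 𝒜) :
    ((∑ β, B α β : ℕ) : ℝ) ≤ opNorm (B.map (Nat.cast : ℕ → ℝ)) := by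
  have h1 := norm_mulVec_le_opNorm (B.map (Nat.cast : ℕ → ℝ)) 1
  have h2 := norm_le_pi_norm ((B.map (Nat.cast : ℕ → ℝ)).mulVec 1) α
  have h3 : ‖(1 : 𝒜 → ℝ)‖ ≤ 1 := (pi_norm_le_iff_of_nonneg zero_le_one).2 fun _ => by simp
  have h4 : ((∑ β, B α β : ℕ) : ℝ) = (B.map (Nat.cast : ℕ → ℝ)).mulVec 1 α := by
    simp [Matrix.mulVec, dotProduct]
  calc ((∑ β, B α β : ℕ) : ℝ) ≤ ‖(B.map (Nat.cast : ℕ → ℝ)).mulVec 1 α‖ := by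
        rw [h4]; exact le_abs_self _
    _ ≤ opNorm (B.map (Nat.cast : ℕ → ℝ)) * ‖(1 : 𝒜 → ℝ)‖ := h2.trans h1
    _ ≤ _ := mul_le_of_le_one_right (opNorm_nonneg _) h3

theorem opNorm_le_sum_rowSum (B : Matrix 𝒜 𝒜 ℕ) :
    opNorm (B.map (Nat.cast : ℕ → ℝ)) ≤ ∑ α, ((∑ β, B α β : ℕ) : ℝ) := by
  refine opNorm_le _ (Finset.sum_nonneg fun α _ => Nat.cast_nonneg _) fun v => ?_
  refine (pi_norm_le_iff_of_nonneg (mul_nonneg (Finset.sum_nonneg fun α _ => Nat.cast_nonneg _)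
    (norm_nonneg _))).2 fun α => ?_
  calc ‖(B.map (Nat.cast : ℕ → ℝ)).mulVec v α‖ ≤ ∑ β, (B α β : ℝ) * ‖v‖ := by
        refine (norm_sum_le _ _).trans (Finset.sum_le_sum fun β _ => ?_)
        rw [norm_mul]
        simp only [Matrix.map_apply, RCLike.norm_natCast]
        exact mul_le_mul_of_nonneg_left (norm_le_pi_norm v β) (Nat.cast_nonneg _)
    _ = ((∑ β, B α β : ℕ) : ℝ) * ‖v‖ := by push_cast; rw [Finset.sum_mul]
    _ ≤ _ := mul_le_mul_of_nonneg_right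
        (Finset.single_le_sum (f := fun α => ((∑ β, B α β : ℕ) : ℝ))
          (fun α _ => Nat.cast_nonneg _) (Finset.mem_univ α)) (norm_nonneg _)

/-! ### Projections and angles -/

theorem projAlong_mem {V : Type*} [AddCommGroup V] [Module ℝ V] {p q : Submodule ℝ V}
    (h : IsCompl p q) (v : V) : projAlong p q v ∈ p := by
  rw [projAlong, dif_pos h]
  exact Submodule.projection_apply_mem h v

theorem projAlong_eq {V : Type*} [AddCommGroup V] [Module ℝ V] {p q : Submodule ℝ V}
    (h : IsCompl p q) {u e : V} (hu : u ∈ p) (he : e ∈ q) : projAlong p q (u + e) = u := by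
  rw [projAlong, dif_pos h, map_add, Submodule.projection_apply_of_mem_left h hu,
    Submodule.projection_apply, (Submodule.projectionOnto_apply_eq_zero_iff h).2 he]
  simp

theorem sub_projAlong_mem {V : Type*} [AddCommGroup V] [Module ℝ V] {p q : Submodule ℝ V}
    (h : IsCompl p q) (v : V) : v - projAlong p q v ∈ q := by
  obtain ⟨u, hu, e, he, rfl⟩ := Submodule.mem_sup.1
    (show v ∈ p ⊔ q by rw [h.sup_eq_top]; exact Submodule.mem_top)
  rw [projAlong_eq h hu he, add_sub_cancel_left]
  exact he

theorem norm_mul_abs_sin_angle_le {F : Type*} [NormedAddCommGroup F] [InnerProductSpace ℝ F]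
    (e u : F) : ‖u‖ * |Real.sin (InnerProductGeometry.angle e u)| ≤ ‖u + e‖ := by
  refine abs_le_of_sq_le_sq' ?_ (norm_nonneg _) |>.2
  have h1 := InnerProductGeometry.cos_angle_mul_norm_mul_norm e u
  have h2 := Real.sin_sq_add_cos_sq (InnerProductGeometry.angle e u)
  have h3 := norm_add_sq_real u e
  rw [real_inner_comm] at h3
  set t := Real.cos (InnerProductGeometry.angle e u)
  rw [mul_pow, sq_abs, h3, ← h1]
  nlinarith [sq_nonneg (‖e‖ + t * ‖u‖)]

theorem norm_toLp_le (v : 𝒜 → ℝ) :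
    ‖(WithLp.toLp 2 v : EuclideanSpace ℝ 𝒜)‖ ≤ (Fintype.card 𝒜 + 1) * ‖v‖ := by
  have h0 : (0 : ℝ) ≤ (Fintype.card 𝒜 + 1) * ‖v‖ := by positivity
  rw [EuclideanSpace.norm_eq, Real.sqrt_le_left h0]
  calc ∑ i, ‖v i‖ ^ 2 ≤ ∑ _i : 𝒜, ‖v‖ ^ 2 := Finset.sum_le_sum fun i _ =>
        pow_le_pow_left₀ (norm_nonneg _) (norm_le_pi_norm v i) 2
    _ = Fintype.card 𝒜 * ‖v‖ ^ 2 := by simp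
    _ ≤ ((Fintype.card 𝒜 + 1) * ‖v‖) ^ 2 := by
        rw [mul_pow]
        refine mul_le_mul_of_nonneg_right ?_ (sq_nonneg _)
        nlinarith [(Nat.cast_nonneg (Fintype.card 𝒜) : (0 : ℝ) ≤ _)]

theorem norm_le_norm_toLp (v : 𝒜 → ℝ) : ‖v‖ ≤ ‖(WithLp.toLp 2 v : EuclideanSpace ℝ 𝒜)‖ :=
  (pi_norm_le_iff_of_nonneg (norm_nonneg _)).2 fun i =>
    PiLp.norm_apply_le (WithLp.toLp 2 v : EuclideanSpace ℝ 𝒜) i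

/-- A lower bound for the angle between complementary subspaces bounds the projections. -/
theorem norm_le_of_angle {s : ℝ} (hs : 0 < s) {e u : 𝒜 → ℝ}
    (h : e ≠ 0 → u ≠ 0 → s ≤ |Real.sin (InnerProductGeometry.angle
      (WithLp.toLp 2 e : EuclideanSpace ℝ 𝒜) (WithLp.toLp 2 u))|) :
    ‖u‖ ≤ (1 + s⁻¹) * (Fintype.card 𝒜 + 1) * ‖u + e‖ := by
  by_cases hu : u = 0
  · subst hu
    rw [norm_zero]
    positivity
  by_cases he : e = 0
  · subst he
    rw [add_zero]
    refine le_mul_of_one_le_left (norm_nonneg _) ?_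
    have : (0 : ℝ) < s⁻¹ := inv_pos.2 hs
    nlinarith [(Nat.cast_nonneg (Fintype.card 𝒜) : (0 : ℝ) ≤ _)]
  have h1 := norm_mul_abs_sin_angle_le (WithLp.toLp 2 e : EuclideanSpace ℝ 𝒜) (WithLp.toLp 2 u)
  have h2 : ‖(WithLp.toLp 2 u : EuclideanSpace ℝ 𝒜)‖ * s ≤ (Fintype.card 𝒜 + 1) * ‖u + e‖ := by
    refine (mul_le_mul_of_nonneg_left (h he hu) (norm_nonneg _)).trans (h1.trans ?_)
    exact norm_toLp_le (u + e)
  have h3 : ‖u‖ ≤ s⁻¹ * ((Fintype.card 𝒜 + 1) * ‖u + e‖) := by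
    rw [← div_eq_inv_mul, le_div_iff₀ hs]
    exact (mul_le_mul_of_nonneg_right (norm_le_norm_toLp u) hs.le).trans h2
  refine h3.trans ?_
  have h4 : 0 ≤ (Fintype.card 𝒜 + 1) * ‖u + e‖ := by positivity
  linarith

namespace IETData

/-! ### The cocycle as real matrices -/

theorem Tower.total_le_opNorm_mul {T T' : IETData 𝒜 d} {B : Matrix 𝒜 𝒜 ℕ} (h : Tower T T' B) :
    T.total ≤ opNorm (B.map (Nat.cast : ℕ → ℝ)) * T'.total := by
  rw [h.total_eq, total, Finset.mul_sum]
  exact Finset.sum_le_sum fun α _ =>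
    mul_le_mul_of_nonneg_right (rowSum_le_opNorm B α) (h.pos' α).le

theorem Tower.one_le_opNorm {T T' : IETData 𝒜 d} {B : Matrix 𝒜 𝒜 ℕ} (h : Tower T T' B) :
    1 ≤ opNorm (B.map (Nat.cast : ℕ → ℝ)) := by
  have h1 := h.total_le_opNorm_mul
  have h2 := total_pos h.pos'
  have h3 := h.total_le
  by_contra! hlt
  nlinarith

theorem Tower.opNorm_mul_total_le {T T' : IETData 𝒜 d} {B : Matrix 𝒜 𝒜 ℕ} (h : Tower T T' B)
    {κ : ℝ} (hκ : ∀ α, T'.total / T'.len α ≤ κ) :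
    opNorm (B.map (Nat.cast : ℕ → ℝ)) * T'.total ≤ κ * T.total := by
  refine (mul_le_mul_of_nonneg_right (opNorm_le_sum_rowSum B) (total_pos h.pos').le).trans ?_
  rw [h.total_eq, Finset.sum_mul, Finset.mul_sum]
  refine Finset.sum_le_sum fun α _ => ?_
  have := (div_le_iff₀ (h.pos' α)).1 (hκ α)
  calc ((∑ β, B α β : ℕ) : ℝ) * T'.total ≤ ((∑ β, B α β : ℕ) : ℝ) * (κ * T'.len α) :=
        mul_le_mul_of_nonneg_left this (Nat.cast_nonneg _)
    _ = _ := by ring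

theorem Regular.det_cocycle {T : IETData 𝒜 d} (hT : T.Regular) (N : ℕ) :
    ((T.cocycle N).map (Nat.cast : ℕ → ℝ)).det = 1 := by
  induction N with
  | zero => simp [cocycle]
  | succ N ih =>
    obtain ⟨-, w, l, u, v, hstep, hmat⟩ := (hT.iterate N).exists_rauzyStep
    have h1 : ((1 + Matrix.single w l 1 : Matrix 𝒜 𝒜 ℕ).map (Nat.cast : ℕ → ℝ)) =
        Matrix.transvection w l (1 : ℝ) := by
      ext i j
      simp only [Matrix.transvection, Matrix.map_apply, Matrix.add_apply, Matrix.one_apply,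
        Matrix.single_apply]
      split_ifs <;> norm_num
    have h2 := Matrix.map_mul (L := T.cocycle N) (M := (rauzy^[N] T).stepMatrix)
      (f := Nat.castRingHom ℝ)
    simp only [Nat.coe_castRingHom] at h2
    rw [cocycle_succ', h2, Matrix.det_mul, ih, hmat, h1, Matrix.det_transvection_of_ne _ _ hstep.ne,
      one_mul]

section Acceleration

variable {T : IETData 𝒜 d} {n : ℕ → ℕ}

theorem acc_eq (hn : Monotone n) {k l : ℕ} (hkl : k ≤ l) :
    T.acc n l = rauzy^[n l - n k] (T.acc n k) := by
  rw [acc, acc, ← Function.iterate_add_apply, Nat.sub_add_cancel (hn hkl)]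

theorem Regular.acc (hT : T.Regular) (n : ℕ → ℕ) (k : ℕ) : (T.acc n k).Regular := hT.iterate _

theorem Regular.tower_acc (hT : T.Regular) (hn : Monotone n) {k l : ℕ} (hkl : k ≤ l) :
    Tower (T.acc n k) (T.acc n l) (T.Qnat n k l) := by
  rw [acc_eq hn hkl]
  exact (hT.acc n k).tower _

theorem Qnat_mul (T : IETData 𝒜 d) (hn : Monotone n) {k l m : ℕ} (hkl : k ≤ l) (hlm : l ≤ m) :
    T.Qnat n l m * T.Qnat n k l = T.Qnat n k m := by
  have h : n m - n k = (n l - n k) + (n m - n l) := by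
    have := hn hkl
    have := hn hlm
    omega
  rw [Qnat, Qnat, Qnat, ← Matrix.transpose_mul, h, cocycle_add, acc_eq hn hkl]

theorem Q_mul (T : IETData 𝒜 d) (hn : Monotone n) {k l m : ℕ} (hkl : k ≤ l) (hlm : l ≤ m) :
    T.Q n l m * T.Q n k l = T.Q n k m := by
  have := Matrix.map_mul (L := T.Qnat n l m) (M := T.Qnat n k l) (f := Nat.castRingHom ℝ)
  simp only [Nat.coe_castRingHom] at this
  rw [Q, Q, Q, ← Qnat_mul T hn hkl hlm, this]

theorem Q_self (T : IETData 𝒜 d) (n : ℕ → ℕ) (k : ℕ) : T.Q n k k = 1 := by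
  simp [Q, Qnat, cocycle]

theorem Regular.isUnit_det_Q (hT : T.Regular) (n : ℕ → ℕ) (k l : ℕ) : IsUnit (T.Q n k l).det := by
  rw [Q, Qnat, Matrix.transpose_map, Matrix.det_transpose, (hT.acc n k).det_cocycle]
  exact isUnit_one

theorem Regular.Q_inv_mulVec (hT : T.Regular) (n : ℕ → ℕ) (k l : ℕ) (v : 𝒜 → ℝ) :
    (T.Q n k l)⁻¹.mulVec ((T.Q n k l).mulVec v) = v := by
  rw [Matrix.mulVec_mulVec, Matrix.nonsing_inv_mul _ (hT.isUnit_det_Q n k l), Matrix.one_mulVec]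

theorem Regular.Q_mulVec_inv (hT : T.Regular) (n : ℕ → ℕ) (k l : ℕ) (v : 𝒜 → ℝ) :
    (T.Q n k l).mulVec ((T.Q n k l)⁻¹.mulVec v) = v := by
  rw [Matrix.mulVec_mulVec, Matrix.mul_nonsing_inv _ (hT.isUnit_det_Q n k l), Matrix.one_mulVec]

theorem Q_mulVec_mulVec (T : IETData 𝒜 d) (hn : Monotone n) {k l m : ℕ} (hkl : k ≤ l)
    (hlm : l ≤ m) (v : 𝒜 → ℝ) :
    (T.Q n l m).mulVec ((T.Q n k l).mulVec v) = (T.Q n k m).mulVec v := by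
  rw [Matrix.mulVec_mulVec, Q_mul T hn hkl hlm]

theorem mem_push {W : Submodule ℝ (𝒜 → ℝ)} {k : ℕ} {v : 𝒜 → ℝ} :
    v ∈ T.push n k W ↔ ∃ w ∈ W, (T.Q n 0 k).mulVec w = v := Iff.rfl

theorem mulVec_mem_push (hn : Monotone n) {W : Submodule ℝ (𝒜 → ℝ)} {k l : ℕ} (hkl : k ≤ l)
    {v : 𝒜 → ℝ} (hv : v ∈ T.push n k W) : (T.Q n k l).mulVec v ∈ T.push n l W := by
  obtain ⟨w, hw, rfl⟩ := hv
  exact ⟨w, hw, (Q_mulVec_mulVec T hn (Nat.zero_le k) hkl w).symm⟩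

theorem Regular.inv_mulVec_mem (hT : T.Regular) {W : Submodule ℝ (𝒜 → ℝ)} {k : ℕ} {v : 𝒜 → ℝ}
    (hv : v ∈ T.push n k W) : (T.Q n 0 k)⁻¹.mulVec v ∈ W := by
  obtain ⟨w, hw, rfl⟩ := hv
  rw [Matrix.toLin'_apply, hT.Q_inv_mulVec]
  exact hw

theorem Regular.isCompl_push (hT : T.Regular) (n : ℕ → ℕ) (k : ℕ)
    {E U : Submodule ℝ (𝒜 → ℝ)} (h : IsCompl E U) : IsCompl (T.push n k U) (T.push n k E) := by
  have hbij : Function.Bijective (Matrix.toLin' (T.Q n 0 k)) :=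
    Function.bijective_iff_has_inverse.2 ⟨(T.Q n 0 k)⁻¹.mulVec,
      fun v => hT.Q_inv_mulVec n 0 k v, fun v => hT.Q_mulVec_inv n 0 k v⟩
  have := h.symm.map (Submodule.orderIsoMapComap (LinearEquiv.ofBijective _ hbij))
  exact this

/-- The projection onto `U^{(k)}` along `E^{(k)}`. -/
def pushProj (T : IETData 𝒜 d) (n : ℕ → ℕ) (E U : Submodule ℝ (𝒜 → ℝ)) (k : ℕ) :
    (𝒜 → ℝ) →ₗ[ℝ] (𝒜 → ℝ) := projAlong (T.push n k U) (T.push n k E)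

theorem Regular.mulVec_pushProj (hT : T.Regular) (hn : Monotone n) {E U : Submodule ℝ (𝒜 → ℝ)}
    (h : IsCompl E U) {k l : ℕ} (hkl : k ≤ l) (v : 𝒜 → ℝ) :
    (T.Q n k l).mulVec (T.pushProj n E U k v) = T.pushProj n E U l ((T.Q n k l).mulVec v) := by
  have hk := hT.isCompl_push n k h
  have hl := hT.isCompl_push n l h
  have h1 := mulVec_mem_push hn hkl (projAlong_mem hk v)
  have h2 := mulVec_mem_push hn hkl (sub_projAlong_mem hk v)
  rw [pushProj, pushProj, ← projAlong_eq hl h1 h2, ← Matrix.mulVec_add, add_sub_cancel]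

/-- Quasi-orbits of the cocycle: existence of the limit of the corrections, and the bounds which
follow when this limit vanishes. -/
theorem Regular.quasiOrbit (hT : T.Regular) (hn : Monotone n) {E U : Submodule ℝ (𝒜 → ℝ)}
    (h : IsCompl E U) {m : ℕ → 𝒜 → ℝ} {b q : ℕ → ℝ}
    (hPU : ∀ k v, ‖T.pushProj n E U k v‖ ≤ q k * ‖v‖)
    (hPE : ∀ k v, ‖v - T.pushProj n E U k v‖ ≤ q k * ‖v‖) (hq : ∀ k, 0 ≤ q k)
    (hb : ∀ k, ‖m (k + 1) - (T.Z n (k + 1)).mulVec (m k)‖ ≤ b k)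
    (hsum : ∀ k, Summable fun l => T.normQInv n U k (k + l + 1) * (q (k + l + 1) * b (k + l))) :
    (∃ x ∈ U, Tendsto (fun k => (T.Q n 0 k)⁻¹.mulVec (T.pushProj n E U k (m k))) atTop (𝓝 x) ∧
      ‖x‖ ≤ q 0 * ‖m 0‖ + ∑' l, T.normQInv n U 0 (0 + l + 1) * (q (0 + l + 1) * b (0 + l))) ∧
    (Tendsto (fun k => (T.Q n 0 k)⁻¹.mulVec (T.pushProj n E U k (m k))) atTop (𝓝 0) → ∀ k,
      ‖m k‖ ≤ ∑' l, T.normQInv n U k (k + l + 1) * (q (k + l + 1) * b (k + l)) +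
        (∑ l ∈ Finset.range k, T.normQ n E (l + 1) k * (q (l + 1) * b l) +
          T.normQ n E 0 k * (q 0 * ‖m 0‖))) := by
  set P := T.pushProj n E U with hP
  set δ : ℕ → 𝒜 → ℝ := fun k => m (k + 1) - (T.Z n (k + 1)).mulVec (m k) with hδ
  have hm : ∀ k, m (k + 1) = (T.Z n (k + 1)).mulVec (m k) + δ k := fun k => by simp [hδ]
  have hZ : ∀ k, T.Z n (k + 1) = T.Q n k (k + 1) := fun k => rfl
  set x : ℕ → 𝒜 → ℝ := fun k => (T.Q n 0 k)⁻¹.mulVec (P k (m k)) with hx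
  have hPm : ∀ k, P (k + 1) (m (k + 1)) =
      (T.Q n k (k + 1)).mulVec (P k (m k)) + P (k + 1) (δ k) := fun k => by
    rw [hT.mulVec_pushProj hn h (Nat.le_succ k), hm k, map_add, hZ]
  have hQx : ∀ k, (T.Q n 0 k).mulVec (x k) = P k (m k) := fun k => hT.Q_mulVec_inv n 0 k _
  have hxs : ∀ k, x (k + 1) = x k + (T.Q n 0 (k + 1))⁻¹.mulVec (P (k + 1) (δ k)) := by
    intro k
    have : x (k + 1) = (T.Q n 0 (k + 1))⁻¹.mulVec (P (k + 1) (m (k + 1))) := rfl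
    rw [this, hPm, Matrix.mulVec_add, ← hQx k,
      Q_mulVec_mulVec T hn (Nat.zero_le k) (Nat.le_succ k), hT.Q_inv_mulVec]
  have hPmem : ∀ k v, P k v ∈ T.push n k U := fun k v => projAlong_mem (hT.isCompl_push n k h) v
  have hstep : ∀ k l, dist ((T.Q n 0 k).mulVec (x (k + l))) ((T.Q n 0 k).mulVec (x (k + l + 1))) ≤
      T.normQInv n U k (k + l + 1) * (q (k + l + 1) * b (k + l)) := by
    intro k l
    have e1 : (T.Q n 0 k).mulVec ((T.Q n 0 (k + l + 1))⁻¹.mulVec (P (k + l + 1) (δ (k + l)))) =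
        (T.Q n k (k + l + 1))⁻¹.mulVec (P (k + l + 1) (δ (k + l))) := by
      have hle : k ≤ k + l + 1 := by omega
      conv_rhs => rw [← hT.Q_mulVec_inv n 0 (k + l + 1) (P (k + l + 1) (δ (k + l))),
        ← Q_mulVec_mulVec T hn (Nat.zero_le k) hle, hT.Q_inv_mulVec]
    rw [dist_comm, dist_eq_norm, hxs, Matrix.mulVec_add, add_sub_cancel_left, e1]
    refine (norm_mulVec_le_opNormOn _ (hPmem _ _)).trans ?_
    refine mul_le_mul_of_nonneg_left ((hPU _ _).trans ?_) (opNormOn_nonneg _ _)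
    exact mul_le_mul_of_nonneg_left (hb _) (hq _)
  have hx0 : ∀ k, (T.Q n 0 0).mulVec (x k) = x k := fun k => by rw [Q_self, Matrix.one_mulVec]
  constructor
  · have hd : ∀ l, dist (x l) (x (l + 1)) ≤
        T.normQInv n U 0 (0 + l + 1) * (q (0 + l + 1) * b (0 + l)) := fun l => by
      simpa only [hx0, zero_add] using hstep 0 l
    have hc := cauchySeq_of_dist_le_of_summable _ hd (hsum 0)
    obtain ⟨y, hy⟩ := cauchySeq_tendsto_of_complete hc
    refine ⟨y, ?_, hy, ?_⟩
    · exact (Submodule.closed_of_finiteDimensional U).mem_of_tendsto hy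
        (Eventually.of_forall fun k => hT.inv_mulVec_mem (hPmem k _))
    · have h1 := dist_le_tsum_of_dist_le_of_tendsto₀ _ hd (hsum 0) hy
      have h2 : ‖x 0‖ ≤ q 0 * ‖m 0‖ := by
        rw [← hx0, hQx]
        exact hPU 0 _
      rw [dist_comm, dist_eq_norm] at h1
      have h3 := norm_sub_norm_le y (x 0)
      linarith
  · intro hlim k
    have hU : ‖P k (m k)‖ ≤ ∑' l, T.normQInv n U k (k + l + 1) * (q (k + l + 1) * b (k + l)) := by
      have ht : Tendsto (fun l => (T.Q n 0 k).mulVec (x (k + l))) atTop (𝓝 0) := by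
        have h1 : Tendsto (fun l => x (k + l)) atTop (𝓝 0) := by
          simpa only [add_comm k] using (tendsto_add_atTop_iff_nat k).2 hlim
        have h2 : Continuous fun v : 𝒜 → ℝ => (T.Q n 0 k).mulVec v := by fun_prop
        have h3 := (h2.tendsto 0).comp h1
        rw [Matrix.mulVec_zero] at h3
        exact h3
      have := dist_le_tsum_of_dist_le_of_tendsto₀ _ (hstep k) (hsum k) ht
      rwa [dist_zero_right, add_zero, hQx] at this
    set e : ℕ → 𝒜 → ℝ := fun k => m k - P k (m k) with he
    set η : ℕ → 𝒜 → ℝ := fun k => δ k - P (k + 1) (δ k) with hη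
    have hes : ∀ k, e (k + 1) = (T.Q n k (k + 1)).mulVec (e k) + η k := by
      intro k
      simp only [he, hη]
      rw [hPm, Matrix.mulVec_sub, hm k, hZ]
      abel
    have hsumE : ∀ k, e k = (T.Q n 0 k).mulVec (e 0) +
        ∑ l ∈ Finset.range k, (T.Q n (l + 1) k).mulVec (η l) := by
      intro k
      induction k with
      | zero => rw [Q_self, Matrix.one_mulVec, Finset.sum_range_zero, add_zero]
      | succ k ih =>
        rw [hes, ih, Matrix.mulVec_add, Q_mulVec_mulVec T hn (Nat.zero_le k) (Nat.le_succ k),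
          Finset.sum_range_succ, Q_self, Matrix.one_mulVec, add_assoc, Matrix.mulVec_sum]
        congr 2
        refine Finset.sum_congr rfl fun l hl => ?_
        rw [Q_mulVec_mulVec T hn (Finset.mem_range.1 hl) (Nat.le_succ k)]
    have hEmem : ∀ k v, v - P k v ∈ T.push n k E := fun k v =>
      sub_projAlong_mem (hT.isCompl_push n k h) v
    have hE : ‖e k‖ ≤ ∑ l ∈ Finset.range k, T.normQ n E (l + 1) k * (q (l + 1) * b l) +
          T.normQ n E 0 k * (q 0 * ‖m 0‖) := by
      rw [hsumE, add_comm]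
      refine (norm_add_le _ _).trans (add_le_add ((norm_sum_le _ _).trans
        (Finset.sum_le_sum fun l _ => ?_)) ?_)
      · refine (norm_mulVec_le_opNormOn _ (hEmem _ _)).trans
          (mul_le_mul_of_nonneg_left ((hPE _ _).trans ?_) (opNormOn_nonneg _ _))
        exact mul_le_mul_of_nonneg_left (hb _) (hq _)
      · exact (norm_mulVec_le_opNormOn _ (hEmem _ _)).trans
          (mul_le_mul_of_nonneg_left (hPE _ _) (opNormOn_nonneg _ _))
    calc ‖m k‖ = ‖P k (m k) + e k‖ := by simp [he]
      _ ≤ ‖P k (m k)‖ + ‖e k‖ := norm_add_le _ _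
      _ ≤ _ := add_le_add hU hE

end Acceleration

end IETData

/-! ### Exponential sums along a sequence of almost linear growth -/

theorem exp_neg_mul_le {R : ℕ → ℝ} {τ c η : ℝ} (hτ : 0 < τ) (hc : 0 ≤ c) (hη : 0 ≤ η)
    (hR0 : ∀ k, 0 ≤ R k) (hle : ∀ k : ℕ, R k ≤ (1 + τ) * k + c) (k : ℕ) :
    Real.exp (-η * k) ≤ Real.exp (η * c) * Real.exp ((-η + τ * η) * R k) := by
  rw [← Real.exp_add, Real.exp_le_exp]
  have h1 : (1 - τ) * R k ≤ k + c := by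
    rcases le_or_gt τ 1 with h | h
    · calc (1 - τ) * R k ≤ (1 - τ) * ((1 + τ) * k + c) :=
            mul_le_mul_of_nonneg_left (hle k) (sub_nonneg.2 h)
        _ = k + c - τ * (τ * k + c) := by ring
        _ ≤ k + c := by
            have : 0 ≤ τ * (τ * k + c) := by positivity
            linarith
    · have : (1 - τ) * R k ≤ 0 := mul_nonpos_of_nonpos_of_nonneg (by linarith) (hR0 k)
      have : (0 : ℝ) ≤ k := Nat.cast_nonneg k
      linarith
  have := mul_le_mul_of_nonneg_left h1 hη
  linarith

/-- Tails of exponentially decreasing series. -/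
theorem exists_tail_bound {R : ℕ → ℝ} {τ c x y : ℝ} (hτ : 0 < τ) (hc : 0 ≤ c)
    (hR0 : ∀ k, 0 ≤ R k) (hge : ∀ k : ℕ, (k : ℝ) ≤ R k + c)
    (hle : ∀ k : ℕ, R k ≤ (1 + τ) * k + c) (hxy : x + y < 0) :
    ∃ G : ℝ, 0 ≤ G ∧ ∀ (A : ℝ) (u : ℕ → ℕ → ℝ), 0 ≤ A → (∀ k m, 0 ≤ u k m) →
      (∀ k m, u k m ≤ A * (Real.exp (x * (R (k + m + 1) - R k)) * Real.exp (y * R (k + m + 1)))) →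
      ∀ k, Summable (u k) ∧ ∑' m, u k m ≤ A * G * Real.exp ((y + τ * -(x + y)) * R k) := by
  set η := -(x + y) with hη
  have hη0 : 0 < η := by linarith
  set ρ := Real.exp (-η) with hρ
  have hρ0 : 0 ≤ ρ := (Real.exp_pos _).le
  have hρ1 : ρ < 1 := Real.exp_lt_one_iff.2 (by linarith)
  have hgeo := summable_geometric_of_lt_one hρ0 hρ1
  refine ⟨Real.exp (η * c) * Real.exp (η * c) * ∑' m : ℕ, ρ ^ m, ?_, ?_⟩
  · exact mul_nonneg (by positivity) (tsum_nonneg fun m => pow_nonneg hρ0 m)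
  intro A u hA hu0 hu k
  set b := A * (Real.exp (-x * R k) * Real.exp (η * c) * Real.exp (-η * k)) with hb
  have hb0 : 0 ≤ b := by positivity
  have hub : ∀ m, u k m ≤ b * ρ ^ m := by
    intro m
    refine (hu k m).trans ?_
    rw [hb, mul_assoc]
    refine mul_le_mul_of_nonneg_left ?_ hA
    rw [hρ, ← Real.exp_nat_mul, ← Real.exp_add, ← Real.exp_add, ← Real.exp_add, ← Real.exp_add,
      Real.exp_le_exp]
    have h1 := mul_le_mul_of_nonneg_left (hge (k + m + 1)) hη0.le
    push_cast at h1
    have h2 : x * (R (k + m + 1) - R k) + y * R (k + m + 1) = -x * R k - η * R (k + m + 1) := by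
      rw [hη]; ring
    rw [h2]
    linarith
  have hs : Summable (u k) := Summable.of_nonneg_of_le (hu0 k) hub (hgeo.mul_left b)
  refine ⟨hs, ?_⟩
  refine (hs.tsum_le_tsum hub (hgeo.mul_left b)).trans ?_
  rw [tsum_mul_left]
  have h3 := exp_neg_mul_le hτ hc hη0.le hR0 hle k
  have hg0 : 0 ≤ ∑' m : ℕ, ρ ^ m := tsum_nonneg fun m => pow_nonneg hρ0 m
  calc b * ∑' m : ℕ, ρ ^ m
      ≤ A * (Real.exp (-x * R k) * Real.exp (η * c) *
          (Real.exp (η * c) * Real.exp ((-η + τ * η) * R k))) * ∑' m : ℕ, ρ ^ m := by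
        rw [hb]
        gcongr
    _ = A * (Real.exp (η * c) * Real.exp (η * c) * ∑' m : ℕ, ρ ^ m) *
          (Real.exp (-x * R k) * Real.exp ((-η + τ * η) * R k)) := by ring
    _ = _ := by
        rw [← Real.exp_add (-x * R k)]
        congr 2
        rw [hη]; ring

theorem natCast_le_exp {τ : ℝ} (hτ : 0 < τ) (k : ℕ) : (k : ℝ) ≤ τ⁻¹ * Real.exp (τ * k) := by
  have := Real.add_one_le_exp (τ * k)
  rw [← div_eq_inv_mul, le_div_iff₀ hτ]
  linarith

/-- Finite exponential sums. -/
theorem exists_sum_bound {R : ℕ → ℝ} {τ c : ℝ} (hτ : 0 < τ)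
    (hR : Monotone R) (hR0 : ∀ k, 0 ≤ R k) (hge : ∀ k : ℕ, (k : ℝ) ≤ R k + c) :
    ∃ G : ℝ, 0 ≤ G ∧ ∀ (x y A : ℝ) (u : ℕ → ℕ → ℝ), 0 ≤ A →
      (∀ k l, l < k → u k l ≤ A * (Real.exp (x * (R k - R (l + 1))) * Real.exp (y * R (l + 1)))) →
      ∀ k, ∑ l ∈ Finset.range k, u k l ≤ A * G * Real.exp ((max x y + τ) * R k) := by
  refine ⟨τ⁻¹ * Real.exp (τ * c), by positivity, fun x y A u hA hu k => ?_⟩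
  have h1 : ∀ l ∈ Finset.range k, u k l ≤ A * Real.exp (max x y * R k) := by
    intro l hl
    have hl' := Finset.mem_range.1 hl
    refine (hu k l hl').trans (mul_le_mul_of_nonneg_left ?_ hA)
    rw [← Real.exp_add, Real.exp_le_exp]
    have h2 : 0 ≤ R k - R (l + 1) := sub_nonneg.2 (hR hl')
    have h3 := mul_le_mul_of_nonneg_right (le_max_left x y) h2
    have h4 := mul_le_mul_of_nonneg_right (le_max_right x y) (hR0 (l + 1))
    linarith
  refine (Finset.sum_le_sum h1).trans ?_
  rw [Finset.sum_const, Finset.card_range, nsmul_eq_mul]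
  have h5 : (k : ℝ) ≤ τ⁻¹ * Real.exp (τ * c) * Real.exp (τ * R k) := by
    refine (natCast_le_exp hτ k).trans ?_
    rw [mul_assoc, ← Real.exp_add]
    refine mul_le_mul_of_nonneg_left (Real.exp_le_exp.2 ?_) (inv_pos.2 hτ).le
    have := mul_le_mul_of_nonneg_left (hge k) hτ.le
    linarith
  calc (k : ℝ) * (A * Real.exp (max x y * R k))
      ≤ (τ⁻¹ * Real.exp (τ * c) * Real.exp (τ * R k)) * (A * Real.exp (max x y * R k)) :=
        mul_le_mul_of_nonneg_right h5 (by positivity)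
    _ = A * (τ⁻¹ * Real.exp (τ * c)) * (Real.exp (max x y * R k) * Real.exp (τ * R k)) := by ring
    _ = _ := by rw [← Real.exp_add, ← add_mul]

namespace IETData

/-! ### The function `⟨s⟩^a` -/

theorem one_le_bracket {a s : ℝ} (hs : 1 ≤ s) : 1 ≤ bracket a s := by
  rw [bracket]
  split_ifs with ha
  · exact Real.one_le_rpow hs ha.le
  · linarith [Real.log_nonneg hs]

theorem bracket_mono {a s t : ℝ} (hs : 0 < s) (hst : s ≤ t) : bracket a s ≤ bracket a t := by
  rw [bracket, bracket]
  split_ifs with ha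
  · exact Real.rpow_le_rpow hs.le hst ha.le
  · linarith [Real.log_le_log hs hst]

theorem exists_bracket_le {a τ c b : ℝ} (ha : 0 ≤ a) (hτ : 0 < τ) (hc : 1 ≤ c) (hb : 0 ≤ b) :
    ∃ G : ℝ, 0 ≤ G ∧ ∀ (k : ℕ) (s : ℝ), 1 ≤ s → s ≤ c * Real.exp (b * k) →
      bracket a s ≤ G * Real.exp ((a * b + τ) * k) := by
  have hc0 : 0 < c := by linarith
  rcases ha.eq_or_lt with rfl | ha'
  · refine ⟨1 + Real.log c + b * τ⁻¹, ?_, fun k s hs1 hs => ?_⟩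
    · have := Real.log_nonneg hc
      positivity
    · have h1 := Real.log_le_log (by linarith) hs
      rw [Real.log_mul hc0.ne' (Real.exp_ne_zero _), Real.log_exp] at h1
      rw [bracket, if_neg (lt_irrefl _), zero_mul, zero_add]
      have h2 : 1 ≤ Real.exp (τ * k) := Real.one_le_exp (by positivity)
      have h3 := mul_le_mul_of_nonneg_left (natCast_le_exp hτ k) hb
      have h4 : 1 + Real.log c ≤ (1 + Real.log c) * Real.exp (τ * k) :=
        le_mul_of_one_le_right (by linarith [Real.log_nonneg hc]) h2
      calc 1 + Real.log s ≤ (1 + Real.log c) + b * k := by linarith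
        _ ≤ (1 + Real.log c) * Real.exp (τ * k) + b * (τ⁻¹ * Real.exp (τ * k)) := by linarith
        _ = _ := by ring
  · refine ⟨c ^ a, by positivity, fun k s hs1 hs => ?_⟩
    rw [bracket, if_pos ha']
    refine (Real.rpow_le_rpow (by linarith) hs ha'.le).trans ?_
    rw [Real.mul_rpow hc0.le (Real.exp_pos _).le, ← Real.exp_mul]
    refine mul_le_mul_of_nonneg_left (Real.exp_le_exp.2 ?_) (by positivity)
    have : 0 ≤ τ * k := by positivity
    linarith

/-! ### Consequences of the Diophantine condition -/

section Oseledets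

variable {T : IETData 𝒜 d} {m : ℕ → ℕ} {g : ℕ} {lam : ℕ → ℝ} {E : ℤ → Submodule ℝ (𝒜 → ℝ)}

theorem IsOseledets.lam_antitone (h : T.IsOseledets m g lam E) {i k : ℕ} (hi : 1 ≤ i)
    (hik : i ≤ k) (hk : k ≤ g + 1) : lam k ≤ lam i := by
  induction k, hik using Nat.le_induction with
  | base => exact le_rfl
  | succ k hik ih => exact (h.lam_anti k (hi.trans hik) (by omega)).le.trans (ih (by omega))

theorem IsOseledets.lam_nonneg (h : T.IsOseledets m g lam E) {i : ℕ} (hi : 1 ≤ i)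
    (hig : i ≤ g + 1) : 0 ≤ lam i := by
  rw [← h.lam_zero]
  exact h.lam_antitone hi hig le_rfl

theorem IsOseledets.le_two (h : T.IsOseledets m g lam E) {i : ℕ} (hi : 2 ≤ i) (hig : i ≤ g + 1) :
    E i ≤ E ((2 : ℕ) : ℤ) := by
  induction i, hi using Nat.le_induction with
  | base => exact le_rfl
  | succ i hi ih =>
    have := h.E_pos_le i (by omega) (by omega)
    rw [Nat.cast_succ]
    exact this.trans (ih (by omega))

theorem IsOseledets.finrank_two (h : T.IsOseledets m g lam E) (hg : 1 ≤ g) :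
    Module.finrank ℝ (E ((2 : ℕ) : ℤ)) + 1 = Fintype.card 𝒜 := by
  have h1 := h.dim_pos 1 le_rfl hg
  rw [Nat.cast_one, h.E_one, finrank_top, Module.finrank_fintype_fun_eq_card] at h1
  rw [h1]
  rfl

theorem IsOseledets.ne_top (h : T.IsOseledets m g lam E) {i : ℕ} (hi : 2 ≤ i) (hig : i ≤ g + 1) :
    E i ≠ ⊤ := by
  intro htop
  have h1 := h.finrank_two (by omega)
  have h2 := h.le_two hi hig
  rw [htop, top_le_iff] at h2
  rw [h2, finrank_top, Module.finrank_fintype_fun_eq_card] at h1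
  omega

theorem IsOseledets.pos_card (h : T.IsOseledets m g lam E) (hg : 1 ≤ g) : 0 < d := by
  have h1 := h.finrank_two hg
  have h2 : ∀ i : ℕ, 1 ≤ i → i ≤ g → E (-((1 : ℕ) : ℤ)) ≤ E (-(i : ℤ)) := by
    intro i hi
    induction i, hi using Nat.le_induction with
    | base => exact fun _ => le_rfl
    | succ i hi ih =>
      intro hig
      have := h.E_neg_le (i + 1) (by omega) hig
      rw [Nat.cast_succ, neg_add, neg_add_cancel_right, ← neg_add] at this
      rw [Nat.cast_succ]
      exact (ih (by omega)).trans this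
  have h3 : E (-((1 : ℕ) : ℤ)) ≤ E ((2 : ℕ) : ℤ) :=
    (h2 g hg le_rfl).trans (h.E_center.trans (h.le_two (i := g + 1) (by omega) le_rfl))
  have h4 := h.dim_neg 1 le_rfl hg
  have h5 := Submodule.finrank_mono h3
  have h6 : Fintype.card 𝒜 = d + 1 := by rw [Fintype.card_congr T.π₀, Fintype.card_fin]
  omega

end Oseledets

theorem FFDC.regular {T : IETData 𝒜 d} {g : ℕ} {lam : ℕ → ℝ} {E : ℤ → Submodule ℝ (𝒜 → ℝ)}
    (h : T.FFDC g lam E) (hg : 1 ≤ g) : T.Regular := by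
  obtain ⟨m, -, hm⟩ := h.oseledets
  exact ⟨h.isIET, h.keane, hm.pos_card hg⟩

/-- The estimates provided by a frame, with a common constant. -/
structure FrameBounds (T : IETData 𝒜 d) (g : ℕ) (lam : ℕ → ℝ) (E : ℤ → Submodule ℝ (𝒜 → ℝ))
    (τ : ℝ) (D : Frame 𝒜) (C : ℝ) : Prop where
  one_le : 1 ≤ C
  mono : Monotone D.n
  strictMono : StrictMono D.n
  n_zero : D.n 0 = 0
  compl : ∀ j : ℤ, -(g : ℤ) ≤ j → j ≤ (g : ℤ) + 1 → IsCompl (E j) (D.U j)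
  rsum_mono : Monotone (D.rsum 0)
  rsum_nonneg : ∀ k, 0 ≤ D.rsum 0 k
  le_rsum : ∀ k : ℕ, (k : ℝ) ≤ D.rsum 0 k + C
  rsum_le : ∀ k : ℕ, D.rsum 0 k ≤ (1 + τ) * k + C
  normQ_pos : ∀ k l : ℕ, k ≤ l → ∀ j : ℕ, 1 ≤ j → j ≤ g + 1 →
    T.normQ D.n (E j) k l ≤ C * Real.exp ((lam j + τ) * (D.rsum 0 l - D.rsum 0 k))
  normQ_neg : ∀ k l : ℕ, k ≤ l → ∀ j : ℕ, 1 ≤ j → j ≤ g →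
    T.normQ D.n (E (-(j : ℤ))) k l ≤ C * Real.exp ((-lam j + τ) * (D.rsum 0 l - D.rsum 0 k))
  normQInv_pos : ∀ k l : ℕ, k ≤ l → ∀ j : ℕ, 2 ≤ j → j ≤ g + 1 →
    T.normQInv D.n (D.U j) k l ≤ C * Real.exp ((-lam (j - 1) + τ) * (D.rsum 0 l - D.rsum 0 k))
  normQInv_neg : ∀ k l : ℕ, k ≤ l → ∀ j : ℕ, j ≤ g →
    T.normQInv D.n (D.U (-(j : ℤ))) k l ≤
      C * Real.exp ((lam (j + 1) + τ) * (D.rsum 0 l - D.rsum 0 k))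
  opNorm_Z : ∀ k : ℕ, opNorm (T.Z D.n (k + 1)) ≤ C * Real.exp (τ * k)
  exp_le_opNorm : ∀ k : ℕ, Real.exp (lam 1 * k) ≤ C * opNorm (T.Q D.n 0 k)
  opNorm_le : ∀ k : ℕ, opNorm (T.Q D.n 0 k) ≤ C * Real.exp (lam 1 * (1 + τ) * k)
  balanced : ∀ (k : ℕ) (α : 𝒜), (T.acc D.n k).total / (T.acc D.n k).len α ≤ C
  norm_proj : ∀ (k : ℕ) (j : ℤ), -(g : ℤ) ≤ j → j ≤ (g : ℤ) + 1 → ∀ v : 𝒜 → ℝ,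
    ‖T.pushProj D.n (E j) (D.U j) k v‖ ≤ C * opNorm (T.Q D.n 0 k) ^ τ * ‖v‖ ∧
    ‖v - T.pushProj D.n (E j) (D.U j) k v‖ ≤ C * opNorm (T.Q D.n 0 k) ^ τ * ‖v‖

theorem Frame.rsum_sub (D : Frame 𝒜) {k l : ℕ} (h : k ≤ l) :
    D.rsum k l = D.rsum 0 l - D.rsum 0 k := by
  simp only [Frame.rsum]
  rw [eq_sub_iff_add_eq, add_comm, Finset.sum_Ico_consecutive _ (Nat.zero_le k) h]

theorem Frame.rsum_nonneg (D : Frame 𝒜) (k l : ℕ) : 0 ≤ D.rsum k l :=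
  Finset.sum_nonneg fun _ _ => Nat.cast_nonneg _

theorem Frame.rsum_zero_mono (D : Frame 𝒜) : Monotone (D.rsum 0) := fun k l h => by
  rw [← sub_nonneg, ← D.rsum_sub h]
  exact D.rsum_nonneg k l

theorem IsFrame.exists_rsum_bounds {T : IETData 𝒜 d} {g : ℕ} {lam : ℕ → ℝ}
    {E : ℤ → Submodule ℝ (𝒜 → ℝ)} {τ : ℝ} {D : Frame 𝒜} (h : T.IsFrame g lam E τ D)
    (hτ : 0 < τ) :
    ∃ c : ℝ, ∀ k : ℕ, (k : ℝ) ≤ D.rsum 0 k + c ∧ D.rsum 0 k ≤ (1 + τ) * k + c := by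
  obtain ⟨L, hL1, hL2, hL⟩ := h.r_lim
  obtain ⟨N, hN⟩ := eventually_atTop.1
    ((hL.eventually (lt_mem_nhds hL1)).and (hL.eventually (gt_mem_nhds hL2)))
  refine ⟨N + 1 + D.rsum 0 (N + 1), fun k => ?_⟩
  have h0 := D.rsum_nonneg 0 k
  have h1 := D.rsum_nonneg 0 (N + 1)
  have hk0 : (0 : ℝ) ≤ k := Nat.cast_nonneg k
  have hN0 : (0 : ℝ) ≤ N := Nat.cast_nonneg N
  rcases le_or_gt (N + 1) k with hk | hk
  · obtain ⟨h2, h3⟩ := hN k (by omega)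
    have hkpos : (0 : ℝ) < k := Nat.cast_pos.2 (by omega)
    rw [lt_div_iff₀ hkpos] at h2
    rw [div_lt_iff₀ hkpos] at h3
    constructor <;> linarith
  · have h4 := D.rsum_zero_mono hk.le
    have h5 : (k : ℝ) ≤ N + 1 := by exact_mod_cast hk.le
    have h6 : 0 ≤ (1 + τ) * k := by positivity
    constructor <;> linarith

theorem IsFrame.frameBounds {T : IETData 𝒜 d} (hT : T.Regular) {g : ℕ} {lam : ℕ → ℝ}
    {E : ℤ → Submodule ℝ (𝒜 → ℝ)} {τ : ℝ} {D : Frame 𝒜} (h : T.IsFrame g lam E τ D)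
    (hτ : 0 < τ) : ∃ C : ℝ, T.FrameBounds g lam E τ D C := by
  obtain ⟨c₁, hc₁⟩ := h.exists_rsum_bounds hτ
  obtain ⟨C, κ, c, hC, hκ, hc, b1, b2, b3, b4, b5, b6, b7, b8⟩ := h.bounds
  have hmono : Monotone D.n := h.accelerating.2.monotone
  have hcinv : 0 < c⁻¹ := inv_pos.2 hc
  set N : ℝ := ((Fintype.card 𝒜 : ℕ) : ℝ) with hN
  have hN0 : 0 ≤ N := Nat.cast_nonneg _
  set C' := |c₁| + C + κ + (1 + c⁻¹) * (N + 1) with hC'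
  have hX : 0 ≤ (1 + c⁻¹) * (N + 1) := by positivity
  have habs := abs_nonneg c₁
  have hcC' : c₁ ≤ C' := by linarith [le_abs_self c₁]
  have hCC' : C ≤ C' := by linarith
  have hκC' : κ ≤ C' := by linarith
  have hPC' : (1 + c⁻¹) * (N + 1) ≤ C' := by linarith
  have hC'1 : 1 ≤ C' := hC.trans hCC'
  have hQ1 : ∀ k, 1 ≤ opNorm (T.Q D.n 0 k) := fun k =>
    (hT.tower_acc hmono (Nat.zero_le k)).one_le_opNorm
  have hexp : ∀ (M W : _) (x : ℝ) (k l : ℕ), k ≤ l → opNormOn (𝒜 := 𝒜) M W ≤ 1 ∨ k ≠ l →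
      (k < l → opNormOn M W ≤ C * Real.exp (x * D.rsum k l)) →
      opNormOn M W ≤ C' * Real.exp (x * (D.rsum 0 l - D.rsum 0 k)) := by
    intro M W x k l hkl h1 hlt
    rcases hkl.eq_or_lt with rfl | hkl'
    · rw [sub_self, mul_zero, Real.exp_zero, mul_one]
      rcases h1 with h1 | h1
      · exact h1.trans hC'1
      · exact absurd rfl h1
    · rw [← D.rsum_sub hkl]
      exact (hlt hkl').trans (mul_le_mul_of_nonneg_right hCC' (Real.exp_pos _).le)
  have hself : ∀ (W : Submodule ℝ (𝒜 → ℝ)) (k l : ℕ), opNormOn (T.Q D.n k l) W ≤ 1 ∨ k ≠ l := by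
    intro W k l
    by_cases hkl : k = l
    · subst hkl
      rw [Q_self]
      exact Or.inl (opNormOn_one_le W)
    · exact Or.inr hkl
  have hself' : ∀ (W : Submodule ℝ (𝒜 → ℝ)) (k l : ℕ),
      opNormOn (T.Q D.n k l)⁻¹ W ≤ 1 ∨ k ≠ l := by
    intro W k l
    by_cases hkl : k = l
    · subst hkl
      rw [Q_self, inv_one]
      exact Or.inl (opNormOn_one_le W)
    · exact Or.inr hkl
  refine ⟨C', hC'1, hmono, h.accelerating.2, h.accelerating.1, h.complementary.compl,
    D.rsum_zero_mono, D.rsum_nonneg 0, ?_, ?_, ?_, ?_, ?_, ?_, ?_, ?_, ?_, ?_, ?_⟩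
  · exact fun k => (hc₁ k).1.trans (by linarith)
  · exact fun k => (hc₁ k).2.trans (by linarith)
  · exact fun k l hkl j hj hjg =>
      hexp _ _ _ k l hkl (hself _ k l) fun hlt => b1 k l hlt j hj hjg
  · exact fun k l hkl j hj hjg =>
      hexp _ _ _ k l hkl (hself _ k l) fun hlt => b2 k l hlt j hj hjg
  · exact fun k l hkl j hj hjg =>
      hexp _ _ _ k l hkl (hself' _ k l) fun hlt => b3 k l hlt j hj hjg
  · exact fun k l hkl j hjg =>
      hexp _ _ _ k l hkl (hself' _ k l) fun hlt => b4 k l hlt j hjg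
  · exact fun k => (b5 k).trans (mul_le_mul_of_nonneg_right hCC' (Real.exp_pos _).le)
  · intro k
    have h1 := (b6 k).1
    rw [inv_mul_le_iff₀ (by linarith)] at h1
    exact h1.trans (mul_le_mul_of_nonneg_right hCC' (opNorm_nonneg _))
  · exact fun k => (b6 k).2.trans (mul_le_mul_of_nonneg_right hCC' (Real.exp_pos _).le)
  · exact fun k α => (b7 k α).trans hκC'
  · intro k j hj hjg v
    have hcompl := hT.isCompl_push D.n k (h.complementary.compl j hj hjg)
    have hq := hQ1 k
    set q := opNorm (T.Q D.n 0 k) with hqdef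
    have hqτ : 1 ≤ q ^ τ := Real.one_le_rpow hq hτ.le
    have hqτ' : 0 < q ^ (-τ) := Real.rpow_pos_of_pos (by linarith) _
    have hinv : (c * q ^ (-τ))⁻¹ = c⁻¹ * q ^ τ := by
      rw [mul_inv, Real.rpow_neg (by linarith), inv_inv]
    have hfac : (1 + (c * q ^ (-τ))⁻¹) * (N + 1) ≤ C' * q ^ τ := by
      rw [hinv]
      calc (1 + c⁻¹ * q ^ τ) * (N + 1) ≤ (q ^ τ + c⁻¹ * q ^ τ) * (N + 1) := by gcongr
        _ = (1 + c⁻¹) * (N + 1) * q ^ τ := by ring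
        _ ≤ C' * q ^ τ := mul_le_mul_of_nonneg_right hPC' (by linarith)
    have hu : T.pushProj D.n (E j) (D.U j) k v ∈ T.push D.n k (D.U j) := projAlong_mem hcompl v
    have he : v - T.pushProj D.n (E j) (D.U j) k v ∈ T.push D.n k (E j) :=
      sub_projAlong_mem hcompl v
    have hang := b8 k j hj hjg _ he _ hu
    constructor
    · have := norm_le_of_angle (mul_pos hc hqτ') hang
      rw [add_sub_cancel] at this
      exact this.trans (mul_le_mul_of_nonneg_right hfac (norm_nonneg v))
    · have := norm_le_of_angle (e := T.pushProj D.n (E j) (D.U j) k v)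
        (u := v - T.pushProj D.n (E j) (D.U j) k v) (mul_pos hc hqτ') (fun hu0 he0 => by
        rw [InnerProductGeometry.angle_comm]
        exact hang he0 hu0)
      rw [sub_add_cancel] at this
      exact this.trans (mul_le_mul_of_nonneg_right hfac (norm_nonneg v))

end IETData

theorem exp_mul_le_exp_mul {x y r : ℝ} (hxy : x ≤ y) (hr : 0 ≤ r) :
    Real.exp (x * r) ≤ Real.exp (y * r) :=
  Real.exp_le_exp.2 (mul_le_mul_of_nonneg_right hxy hr)

namespace IETData

section Estimates

variable {T : IETData 𝒜 d} {g : ℕ} {lam : ℕ → ℝ} {E : ℤ → Submodule ℝ (𝒜 → ℝ)} {τ : ℝ}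
  {D : Frame 𝒜} {C : ℝ}

theorem FrameBounds.tower (hF : T.FrameBounds g lam E τ D C) (hT : T.Regular) {k l : ℕ}
    (hkl : k ≤ l) : Tower (T.acc D.n k) (T.acc D.n l) (T.Qnat D.n k l) :=
  hT.tower_acc hF.mono hkl

theorem FrameBounds.acc_zero (hF : T.FrameBounds g lam E τ D C) : T.acc D.n 0 = T := by
  rw [acc, hF.n_zero, Function.iterate_zero, id_eq]

theorem FrameBounds.one_le_opNorm (hF : T.FrameBounds g lam E τ D C) (hT : T.Regular) (k l : ℕ)
    (hkl : k ≤ l) : 1 ≤ opNorm (T.Q D.n k l) := (hF.tower hT hkl).one_le_opNorm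

/-- Exponential growth in the index is controlled by exponential growth in `r(0, ·)`. -/
theorem FrameBounds.exp_le (hF : T.FrameBounds g lam E τ D C) {x : ℝ} (hx : 0 ≤ x) (k : ℕ) :
    Real.exp (x * k) ≤ Real.exp (x * C) * Real.exp (x * D.rsum 0 k) := by
  rw [← Real.exp_add, Real.exp_le_exp]
  have := mul_le_mul_of_nonneg_left (hF.le_rsum k) hx
  linarith

theorem FrameBounds.exists_Z_mul_le (hF : T.FrameBounds g lam E τ D C)
    (hτ : 0 < τ) (h1 : 0 ≤ lam 1) : ∃ A : ℝ, 0 ≤ A ∧ ∀ l,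
      opNorm (T.Z D.n (l + 1)) * opNorm (T.Q D.n 0 (l + 1)) ^ τ ≤
        A * Real.exp ((τ + τ * lam 1 * (1 + τ)) * D.rsum 0 (l + 1)) := by
  have hC : 0 ≤ C := zero_le_one.trans hF.one_le
  set x := τ + τ * lam 1 * (1 + τ) with hx
  have hx0 : 0 ≤ x := by positivity
  refine ⟨C * C ^ τ * Real.exp (x * C), by positivity, fun l => ?_⟩
  have hz : opNorm (T.Z D.n (l + 1)) ≤ C * Real.exp (τ * (l + 1 : ℕ)) := by
    refine (hF.opNorm_Z l).trans (mul_le_mul_of_nonneg_left (Real.exp_le_exp.2 ?_) hC)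
    push_cast
    linarith
  have hq : opNorm (T.Q D.n 0 (l + 1)) ^ τ ≤
      C ^ τ * Real.exp (τ * lam 1 * (1 + τ) * (l + 1 : ℕ)) := by
    refine (Real.rpow_le_rpow (opNorm_nonneg _) (hF.opNorm_le (l + 1)) hτ.le).trans (le_of_eq ?_)
    rw [Real.mul_rpow hC (Real.exp_pos _).le, ← Real.exp_mul]
    ring_nf
  calc opNorm (T.Z D.n (l + 1)) * opNorm (T.Q D.n 0 (l + 1)) ^ τ
      ≤ (C * Real.exp (τ * (l + 1 : ℕ))) *
          (C ^ τ * Real.exp (τ * lam 1 * (1 + τ) * (l + 1 : ℕ))) :=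
        mul_le_mul hz hq (Real.rpow_nonneg (opNorm_nonneg _) _) (by positivity)
    _ = C * C ^ τ * Real.exp (x * (l + 1 : ℕ)) := by
        rw [hx, add_mul, Real.exp_add]; ring
    _ ≤ C * C ^ τ * (Real.exp (x * C) * Real.exp (x * D.rsum 0 (l + 1))) :=
        mul_le_mul_of_nonneg_left (hF.exp_le hx0 (l + 1)) (by positivity)
    _ = _ := by ring

theorem FrameBounds.exists_bracket_mul_le (hF : T.FrameBounds g lam E τ D C) (hT : T.Regular)
    (hτ : 0 < τ) (h1 : 0 ≤ lam 1) {a : ℝ} (ha : 0 ≤ a) : ∃ A : ℝ, 0 ≤ A ∧ ∀ l,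
      opNorm (T.Z D.n (l + 1)) * bracket a (opNorm (T.Q D.n 0 l)) *
          opNorm (T.Q D.n 0 (l + 1)) ^ τ ≤
        A * Real.exp ((a * lam 1 + 2 * τ + τ * lam 1 * (a + 1 + τ)) * D.rsum 0 (l + 1)) := by
  obtain ⟨A, hA, hle⟩ := hF.exists_Z_mul_le hτ h1
  obtain ⟨G, hG, hGle⟩ := exists_bracket_le (b := lam 1 * (1 + τ)) ha hτ hF.one_le (by positivity)
  set x := a * (lam 1 * (1 + τ)) + τ with hx
  have hx0 : 0 ≤ x := by positivity
  refine ⟨A * (G * Real.exp (x * C)), by positivity, fun l => ?_⟩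
  have hb : bracket a (opNorm (T.Q D.n 0 l)) ≤
      G * (Real.exp (x * C) * Real.exp (x * D.rsum 0 (l + 1))) := by
    refine (hGle l _ (hF.one_le_opNorm hT 0 l (Nat.zero_le l)) (hF.opNorm_le l)).trans
      (mul_le_mul_of_nonneg_left ((hF.exp_le hx0 l).trans ?_) hG)
    refine mul_le_mul_of_nonneg_left (Real.exp_le_exp.2 ?_) (Real.exp_pos _).le
    exact mul_le_mul_of_nonneg_left (hF.rsum_mono (Nat.le_succ l)) hx0
  have hb0 : 0 ≤ bracket a (opNorm (T.Q D.n 0 l)) :=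
    zero_le_one.trans (one_le_bracket (hF.one_le_opNorm hT 0 l (Nat.zero_le l)))
  calc opNorm (T.Z D.n (l + 1)) * bracket a (opNorm (T.Q D.n 0 l)) *
        opNorm (T.Q D.n 0 (l + 1)) ^ τ
      = opNorm (T.Z D.n (l + 1)) * opNorm (T.Q D.n 0 (l + 1)) ^ τ *
          bracket a (opNorm (T.Q D.n 0 l)) := by ring
    _ ≤ A * Real.exp ((τ + τ * lam 1 * (1 + τ)) * D.rsum 0 (l + 1)) *
          (G * (Real.exp (x * C) * Real.exp (x * D.rsum 0 (l + 1)))) :=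
        mul_le_mul (hle l) hb hb0 (by positivity)
    _ = A * (G * Real.exp (x * C)) * (Real.exp ((τ + τ * lam 1 * (1 + τ)) * D.rsum 0 (l + 1)) *
          Real.exp (x * D.rsum 0 (l + 1))) := by ring
    _ = _ := by
        rw [← Real.exp_add, ← add_mul, hx]
        congr 3
        ring

theorem FrameBounds.Kterm_nonneg (hF : T.FrameBounds g lam E τ D C) (hT : T.Regular) (a : ℝ)
    (i k l : ℕ) : 0 ≤ T.Kterm D a i τ k l :=
  mul_nonneg (mul_nonneg (mul_nonneg (opNormOn_nonneg _ _) (opNorm_nonneg _))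
    (zero_le_one.trans (one_le_bracket (hF.one_le_opNorm hT 0 l (Nat.zero_le l)))))
    (Real.rpow_nonneg (opNorm_nonneg _) _)

theorem FrameBounds.Kseries_nonneg (hF : T.FrameBounds g lam E τ D C) (hT : T.Regular) (a : ℝ)
    (i k : ℕ) : 0 ≤ T.Kseries D a i τ k := tsum_nonneg fun _ => hF.Kterm_nonneg hT a i k _

theorem FrameBounds.Cseries_nonneg (hF : T.FrameBounds g lam E τ D C) (hT : T.Regular) (a : ℝ)
    (i k : ℕ) : 0 ≤ T.Cseries E D a i τ k :=
  Finset.sum_nonneg fun l _ => mul_nonneg (mul_nonneg (mul_nonneg (opNormOn_nonneg _ _)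
    (opNorm_nonneg _))
    (zero_le_one.trans (one_le_bracket (hF.one_le_opNorm hT 0 l (Nat.zero_le l)))))
    (Real.rpow_nonneg (opNorm_nonneg _) _)

theorem FrameBounds.total_pos (hT : T.Regular) (n : ℕ → ℕ) (k : ℕ) : 0 < (T.acc n k).total :=
  IETData.total_pos (hT.acc n k).len_pos

theorem FrameBounds.sSeq_nonneg (hF : T.FrameBounds g lam E τ D C) (hT : T.Regular) (a : ℝ)
    (i k : ℕ) : 0 ≤ T.sSeq E D a i τ k :=
  mul_nonneg (FrameBounds.total_pos hT D.n k).le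
    (add_nonneg (hF.Kseries_nonneg hT a i k) (hF.Cseries_nonneg hT a i k))

theorem FrameBounds.Kseries_bound (hF : T.FrameBounds g lam E τ D C) (hT : T.Regular)
    (hτ : 0 < τ) (hτ1 : τ ≤ 1) (h1 : 0 ≤ lam 1) {a : ℝ} (ha : 0 ≤ a) (ha1 : a < 1) {i : ℕ}
    (hi : 2 ≤ i) (hig : i ≤ g + 1) (hlam : lam (i - 1) ≤ lam 1)
    (hτi : 3 * τ * (1 + lam 1) < lam (i - 1) - lam 1 * a) :
    (∀ k, Summable fun m => T.Kterm D a i τ k (k + m)) ∧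
    ∃ A : ℝ, 0 ≤ A ∧ ∀ k, T.Kseries D a i τ k ≤
      A * Real.exp ((lam 1 * a + 3 * τ * (1 + lam 1)) * D.rsum 0 k) := by
  have hC : 0 ≤ C := zero_le_one.trans hF.one_le
  obtain ⟨A, hA, hle⟩ := hF.exists_bracket_mul_le hT hτ h1 ha
  set x := -lam (i - 1) + τ with hx
  set y := a * lam 1 + 2 * τ + τ * lam 1 * (a + 1 + τ) with hy
  have hτl : 0 ≤ τ * lam 1 := by positivity
  have h3 : τ * lam 1 * (a + 1 + τ) ≤ τ * lam 1 * 3 := mul_le_mul_of_nonneg_left (by linarith) hτl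
  have hxy : x + y < 0 := by
    rw [hx, hy]; linarith
  obtain ⟨G, hG, hbound⟩ := exists_tail_bound hτ hC hF.rsum_nonneg hF.le_rsum hF.rsum_le hxy
  have hterm : ∀ k m, T.Kterm D a i τ k (k + m) ≤ (C * A) *
      (Real.exp (x * (D.rsum 0 (k + m + 1) - D.rsum 0 k)) *
        Real.exp (y * D.rsum 0 (k + m + 1))) := by
    intro k m
    have e1 := hF.normQInv_pos k (k + m + 1) (by omega) i hi hig
    have e2 := hle (k + m)
    calc T.Kterm D a i τ k (k + m) = T.normQInv D.n (D.U i) k (k + m + 1) *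
          (opNorm (T.Z D.n (k + m + 1)) * bracket a (opNorm (T.Q D.n 0 (k + m))) *
            opNorm (T.Q D.n 0 (k + m + 1)) ^ τ) := by rw [Kterm]; ring
      _ ≤ (C * Real.exp (x * (D.rsum 0 (k + m + 1) - D.rsum 0 k))) *
          (A * Real.exp (y * D.rsum 0 (k + m + 1))) := by
          refine mul_le_mul e1 e2 ?_ (by positivity)
          refine mul_nonneg (mul_nonneg (opNorm_nonneg _) ?_)
            (Real.rpow_nonneg (opNorm_nonneg _) _)
          exact zero_le_one.trans (one_le_bracket (hF.one_le_opNorm hT 0 _ (Nat.zero_le _)))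
      _ = _ := by ring
  have hres := hbound (C * A) (fun k m => T.Kterm D a i τ k (k + m)) (by positivity)
    (fun k m => hF.Kterm_nonneg hT a i k _) hterm
  refine ⟨fun k => (hres k).1, C * A * G, by positivity, fun k => ((hres k).2).trans ?_⟩
  refine mul_le_mul_of_nonneg_left (exp_mul_le_exp_mul ?_ (hF.rsum_nonneg k)) (by positivity)
  have e3 : τ * -(x + y) ≤ τ * (lam 1 - lam 1 * a) := by
    refine mul_le_mul_of_nonneg_left ?_ hτ.le
    rw [hx, hy]
    have : 0 ≤ τ * lam 1 * (a + 1 + τ) := by positivity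
    linarith
  have e4 : τ * lam 1 * (2 + τ) ≤ τ * lam 1 * 3 := mul_le_mul_of_nonneg_left (by linarith) hτl
  have e5 : y + τ * (lam 1 - lam 1 * a) = lam 1 * a + 2 * τ + τ * lam 1 * (2 + τ) := by
    rw [hy]; ring
  linarith

theorem FrameBounds.Cseries_bound (hF : T.FrameBounds g lam E τ D C) (hT : T.Regular)
    (hτ : 0 < τ) (hτ1 : τ ≤ 1) (h1 : 0 ≤ lam 1) {a : ℝ} (ha : 0 ≤ a) (ha1 : a < 1) {i : ℕ}
    (hi : 1 ≤ i) (hig : i ≤ g + 1) :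
    ∃ A : ℝ, 0 ≤ A ∧ ∀ k, T.Cseries E D a i τ k ≤
      A * Real.exp ((max (lam i) (lam 1 * a) + 3 * τ * (1 + lam 1)) * D.rsum 0 k) := by
  have hC : 0 ≤ C := zero_le_one.trans hF.one_le
  obtain ⟨A, hA, hle⟩ := hF.exists_bracket_mul_le hT hτ h1 ha
  set x := lam i + τ with hx
  set y := a * lam 1 + 2 * τ + τ * lam 1 * (a + 1 + τ) with hy
  have hτl : 0 ≤ τ * lam 1 := by positivity
  have h3 : τ * lam 1 * (a + 1 + τ) ≤ τ * lam 1 * 3 := mul_le_mul_of_nonneg_left (by linarith) hτl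
  obtain ⟨G, hG, hbound⟩ := exists_sum_bound hτ hF.rsum_mono hF.rsum_nonneg hF.le_rsum
  have hres := hbound x y (C * A) (fun k l => T.normQ D.n (E i) (l + 1) k *
    opNorm (T.Z D.n (l + 1)) * bracket a (opNorm (T.Q D.n 0 l)) *
      opNorm (T.Q D.n 0 (l + 1)) ^ τ) (by positivity) ?_
  · refine ⟨C * A * G, by positivity, fun k => (hres k).trans ?_⟩
    refine mul_le_mul_of_nonneg_left (exp_mul_le_exp_mul ?_ (hF.rsum_nonneg k)) (by positivity)
    have e1 := le_max_left (lam i) (lam 1 * a)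
    have e2 := le_max_right (lam i) (lam 1 * a)
    have e3 : max x y ≤ max (lam i) (lam 1 * a) + 3 * τ * (1 + lam 1) - τ := by
      refine max_le ?_ ?_
      · rw [hx]; linarith
      · rw [hy]; linarith
    linarith
  · intro k l hlk
    have e1 := hF.normQ_pos (l + 1) k hlk i hi hig
    have e2 := hle l
    calc T.normQ D.n (E i) (l + 1) k * opNorm (T.Z D.n (l + 1)) *
          bracket a (opNorm (T.Q D.n 0 l)) * opNorm (T.Q D.n 0 (l + 1)) ^ τ
        = T.normQ D.n (E i) (l + 1) k * (opNorm (T.Z D.n (l + 1)) *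
          bracket a (opNorm (T.Q D.n 0 l)) * opNorm (T.Q D.n 0 (l + 1)) ^ τ) := by ring
      _ ≤ (C * Real.exp (x * (D.rsum 0 k - D.rsum 0 (l + 1)))) *
          (A * Real.exp (y * D.rsum 0 (l + 1))) := by
          refine mul_le_mul e1 e2 ?_ (by positivity)
          refine mul_nonneg (mul_nonneg (opNorm_nonneg _) ?_)
            (Real.rpow_nonneg (opNorm_nonneg _) _)
          exact zero_le_one.trans (one_le_bracket (hF.one_le_opNorm hT 0 _ (Nat.zero_le _)))
      _ = _ := by ring

/-- The normalized part `K_k + C_k` of the sequence `s_k`. -/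
theorem FrameBounds.Kseries_add_Cseries_bound (hF : T.FrameBounds g lam E τ D C)
    (hT : T.Regular) (hτ : 0 < τ) (hτ1 : τ ≤ 1) (h1 : 0 ≤ lam 1) {a : ℝ} (ha : 0 ≤ a)
    (ha1 : a < 1) {i : ℕ} (hi : 2 ≤ i) (hig : i ≤ g + 1) (hlam : lam (i - 1) ≤ lam 1)
    (hτi : 3 * τ * (1 + lam 1) < lam (i - 1) - lam 1 * a) :
    ∃ A : ℝ, 0 ≤ A ∧ ∀ k, T.Kseries D a i τ k + T.Cseries E D a i τ k ≤
      A * Real.exp ((max (lam i) (lam 1 * a) + 3 * τ * (1 + lam 1)) * D.rsum 0 k) := by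
  obtain ⟨-, A, hA, hle⟩ := hF.Kseries_bound hT hτ hτ1 h1 ha ha1 hi hig hlam hτi
  obtain ⟨A', hA', hle'⟩ := hF.Cseries_bound hT hτ hτ1 h1 ha ha1 (by omega : 1 ≤ i) hig
  refine ⟨A + A', by positivity, fun k => ?_⟩
  rw [add_mul]
  refine add_le_add ((hle k).trans ?_) (hle' k)
  refine mul_le_mul_of_nonneg_left (exp_mul_le_exp_mul ?_ (hF.rsum_nonneg k)) hA
  linarith [le_max_right (lam i) (lam 1 * a)]

theorem FrameBounds.total_bound (hF : T.FrameBounds g lam E τ D C) (hT : T.Regular) (k : ℕ) :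
    (T.acc D.n k).total ≤ C * C * T.total * Real.exp (-lam 1 * k) := by
  have hC : 0 ≤ C := zero_le_one.trans hF.one_le
  have ht := FrameBounds.total_pos hT D.n k
  have h1 := (hF.tower hT (Nat.zero_le k)).opNorm_mul_total_le (hF.balanced k)
  rw [hF.acc_zero] at h1
  have h2 := hF.exp_le_opNorm k
  have h3 : Real.exp (lam 1 * k) * (T.acc D.n k).total ≤ C * C * T.total := by
    calc Real.exp (lam 1 * k) * (T.acc D.n k).total
        ≤ C * opNorm (T.Q D.n 0 k) * (T.acc D.n k).total := mul_le_mul_of_nonneg_right h2 ht.le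
      _ = C * (opNorm (T.Q D.n 0 k) * (T.acc D.n k).total) := by ring
      _ ≤ C * (C * T.total) := mul_le_mul_of_nonneg_left h1 hC
      _ = _ := by ring
  rw [neg_mul, Real.exp_neg, ← div_eq_mul_inv, le_div_iff₀ (Real.exp_pos _), mul_comm]
  exact h3

theorem FrameBounds.sSeq_bound (hF : T.FrameBounds g lam E τ D C) (hT : T.Regular)
    (hτ : 0 < τ) (hτ1 : τ ≤ 1) (h1 : 0 ≤ lam 1) {a : ℝ} (ha : 0 ≤ a) (ha1 : a < 1) {i : ℕ}
    (hi : 2 ≤ i) (hig : i ≤ g + 1) (hlam : lam (i - 1) ≤ lam 1) (hli : 0 ≤ lam i)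
    (hτi : 3 * τ * (1 + lam 1) < lam (i - 1) - lam 1 * a) :
    ∃ A : ℝ, 0 ≤ A ∧ ∀ k, T.sSeq E D a i τ k ≤
      A * Real.exp ((max (lam i) (lam 1 * a) - lam 1 + 4 * τ * (1 + lam 1)) *
        D.rsum 0 (k + 1)) := by
  have hC : 0 ≤ C := zero_le_one.trans hF.one_le
  obtain ⟨A, hA, hle⟩ := hF.Kseries_add_Cseries_bound hT hτ hτ1 h1 ha ha1 hi hig hlam hτi
  have htot := (IETData.total_pos hT.len_pos).le
  set M := max (lam i) (lam 1 * a) with hM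
  have hM0 : 0 ≤ M := hli.trans (le_max_left _ _)
  refine ⟨C * C * T.total * Real.exp (lam 1) * Real.exp (lam 1 * C) * A, by positivity,
    fun k => ?_⟩
  have h2 : Real.exp (-lam 1 * k) ≤ Real.exp (lam 1) * (Real.exp (lam 1 * C) *
      Real.exp ((-lam 1 + τ * lam 1) * D.rsum 0 (k + 1))) := by
    refine le_trans (le_of_eq ?_) (mul_le_mul_of_nonneg_left
      (exp_neg_mul_le hτ hC h1 hF.rsum_nonneg hF.rsum_le (k + 1)) (Real.exp_pos _).le)
    rw [← Real.exp_add]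
    push_cast
    ring_nf
  have h3 : T.Kseries D a i τ k + T.Cseries E D a i τ k ≤
      A * Real.exp ((M + 3 * τ * (1 + lam 1)) * D.rsum 0 (k + 1)) := by
    refine (hle k).trans (mul_le_mul_of_nonneg_left (Real.exp_le_exp.2 ?_) hA)
    exact mul_le_mul_of_nonneg_left (hF.rsum_mono (Nat.le_succ k)) (by positivity)
  calc T.sSeq E D a i τ k
      ≤ (C * C * T.total * (Real.exp (lam 1) * (Real.exp (lam 1 * C) *
          Real.exp ((-lam 1 + τ * lam 1) * D.rsum 0 (k + 1))))) *
          (A * Real.exp ((M + 3 * τ * (1 + lam 1)) * D.rsum 0 (k + 1))) := by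
        refine mul_le_mul ((hF.total_bound hT k).trans
          (mul_le_mul_of_nonneg_left h2 (by positivity))) h3 ?_ (by positivity)
        exact add_nonneg (hF.Kseries_nonneg hT a i k) (hF.Cseries_nonneg hT a i k)
    _ = (C * C * T.total * Real.exp (lam 1) * Real.exp (lam 1 * C) * A) *
          (Real.exp ((-lam 1 + τ * lam 1) * D.rsum 0 (k + 1)) *
            Real.exp ((M + 3 * τ * (1 + lam 1)) * D.rsum 0 (k + 1))) := by ring
    _ ≤ _ := by
        rw [← Real.exp_add, ← add_mul]
        refine mul_le_mul_of_nonneg_left (exp_mul_le_exp_mul ?_ (hF.rsum_nonneg _))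
          (by positivity)
        linarith

theorem Vterm_nonneg (T : IETData 𝒜 d) (D : Frame 𝒜) (j : ℕ) {s : ℕ → ℝ} (hs : ∀ k, 0 ≤ s k)
    (τ : ℝ) (k l : ℕ) : 0 ≤ T.Vterm D j τ s k l :=
  mul_nonneg (mul_nonneg (mul_nonneg (opNormOn_nonneg _ _)
    (Real.rpow_nonneg (opNorm_nonneg _) _)) (opNorm_nonneg _)) (hs l)

theorem FrameBounds.Vseries_bound (hF : T.FrameBounds g lam E τ D C)
    (hτ : 0 < τ) (hτ1 : τ ≤ 1) (h1 : 0 ≤ lam 1) {j : ℕ} (hjg : j ≤ g) {s : ℕ → ℝ}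
    (hs0 : ∀ k, 0 ≤ s k) {A M : ℝ} (hA : 0 ≤ A) (hM : 0 ≤ M) (hl : 0 ≤ lam (j + 1))
    (hs : ∀ k, s k ≤ A * Real.exp ((M - lam 1 + 4 * τ * (1 + lam 1)) * D.rsum 0 (k + 1)))
    (hτj : 9 * τ * (1 + lam 1) < lam 1 - lam (j + 1) - M) :
    (∀ k, Summable fun m => T.Vterm D j τ s k (k + m)) ∧
    ∃ A' : ℝ, 0 ≤ A' ∧ ∀ k, T.Vseries D j τ s k ≤
      A' * Real.exp ((M - lam 1 + 8 * τ * (1 + lam 1)) * D.rsum 0 k) := by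
  have hC : 0 ≤ C := zero_le_one.trans hF.one_le
  obtain ⟨B, hB, hle⟩ := hF.exists_Z_mul_le hτ h1
  set x := lam (j + 1) + τ with hx
  set y := (τ + τ * lam 1 * (1 + τ)) + (M - lam 1 + 4 * τ * (1 + lam 1)) with hy
  have hτl : 0 ≤ τ * lam 1 := by positivity
  have h3 : τ * lam 1 * (1 + τ) ≤ τ * lam 1 * 2 := mul_le_mul_of_nonneg_left (by linarith) hτl
  have hxy : x + y < 0 := by
    rw [hx, hy]; linarith
  obtain ⟨G, hG, hbound⟩ := exists_tail_bound hτ hC hF.rsum_nonneg hF.le_rsum hF.rsum_le hxy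
  have hterm : ∀ k m, T.Vterm D j τ s k (k + m) ≤ (C * B * A) *
      (Real.exp (x * (D.rsum 0 (k + m + 1) - D.rsum 0 k)) *
        Real.exp (y * D.rsum 0 (k + m + 1))) := by
    intro k m
    have e1 := hF.normQInv_neg k (k + m + 1) (by omega) j hjg
    have e2 := hle (k + m)
    calc T.Vterm D j τ s k (k + m) = T.normQInv D.n (D.U (-(j : ℤ))) k (k + m + 1) *
          ((opNorm (T.Z D.n (k + m + 1)) * opNorm (T.Q D.n 0 (k + m + 1)) ^ τ) * s (k + m)) := by
          rw [Vterm]; ring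
      _ ≤ (C * Real.exp (x * (D.rsum 0 (k + m + 1) - D.rsum 0 k))) *
          ((B * Real.exp ((τ + τ * lam 1 * (1 + τ)) * D.rsum 0 (k + m + 1))) *
            (A * Real.exp ((M - lam 1 + 4 * τ * (1 + lam 1)) * D.rsum 0 (k + m + 1)))) := by
          refine mul_le_mul e1 (mul_le_mul e2 (hs _) (hs0 _) (by positivity)) ?_ (by positivity)
          exact mul_nonneg (mul_nonneg (opNorm_nonneg _) (Real.rpow_nonneg (opNorm_nonneg _) _))
            (hs0 _)
      _ = _ := by
          rw [hy, add_mul (τ + τ * lam 1 * (1 + τ)),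
            Real.exp_add ((τ + τ * lam 1 * (1 + τ)) * _)]
          ring
  have hres := hbound (C * B * A) (fun k m => T.Vterm D j τ s k (k + m)) (by positivity)
    (fun k m => T.Vterm_nonneg D j hs0 τ k _) hterm
  refine ⟨fun k => (hres k).1, C * B * A * G, by positivity, fun k => ((hres k).2).trans ?_⟩
  refine mul_le_mul_of_nonneg_left (exp_mul_le_exp_mul ?_ (hF.rsum_nonneg k)) (by positivity)
  have e3 : τ * -(x + y) ≤ τ * lam 1 := by
    refine mul_le_mul_of_nonneg_left ?_ hτ.le
    rw [hx, hy]
    have : 0 ≤ τ * lam 1 * (1 + τ) := by positivity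
    linarith
  rw [hy] at e3 ⊢
  linarith

theorem FrameBounds.Wseries_bound (hF : T.FrameBounds g lam E τ D C)
    (hτ : 0 < τ) (hτ1 : τ ≤ 1) (h1 : 0 ≤ lam 1) {j : ℕ} (hj1 : 1 ≤ j) (hjg : j ≤ g) {s : ℕ → ℝ}
    (hs0 : ∀ k, 0 ≤ s k) {A M : ℝ} (hA : 0 ≤ A)
    (hs : ∀ k, s k ≤ A * Real.exp ((M - lam 1 + 4 * τ * (1 + lam 1)) * D.rsum 0 (k + 1))) :
    ∃ A' : ℝ, 0 ≤ A' ∧ ∀ k, T.Wseries E D j τ s k ≤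
      A' * Real.exp ((max (M - lam 1) (-lam j) + 9 * τ * (1 + lam 1)) * D.rsum 0 k) := by
  have hC : 0 ≤ C := zero_le_one.trans hF.one_le
  obtain ⟨B, hB, hle⟩ := hF.exists_Z_mul_le hτ h1
  set x := -lam j + τ with hx
  set y := (τ + τ * lam 1 * (1 + τ)) + (M - lam 1 + 4 * τ * (1 + lam 1)) with hy
  have hτl : 0 ≤ τ * lam 1 := by positivity
  have h3 : τ * lam 1 * (1 + τ) ≤ τ * lam 1 * 2 := mul_le_mul_of_nonneg_left (by linarith) hτl
  obtain ⟨G, hG, hbound⟩ := exists_sum_bound hτ hF.rsum_mono hF.rsum_nonneg hF.le_rsum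
  have hres := hbound x y (C * B * A) (fun k l => T.normQ D.n (E (-(j : ℤ))) (l + 1) k *
    opNorm (T.Q D.n 0 (l + 1)) ^ τ * opNorm (T.Z D.n (l + 1)) * s l) (by positivity) ?_
  · refine ⟨C * B * A * G, by positivity, fun k => (hres k).trans ?_⟩
    refine mul_le_mul_of_nonneg_left (exp_mul_le_exp_mul ?_ (hF.rsum_nonneg k)) (by positivity)
    have e1 := le_max_left (M - lam 1) (-lam j)
    have e2 := le_max_right (M - lam 1) (-lam j)
    have e3 : max x y ≤ max (M - lam 1) (-lam j) + 9 * τ * (1 + lam 1) - τ := by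
      refine max_le ?_ ?_
      · rw [hx]; linarith
      · rw [hy]; linarith
    linarith
  · intro k l hlk
    have e1 := hF.normQ_neg (l + 1) k hlk j hj1 hjg
    have e2 := hle l
    calc T.normQ D.n (E (-(j : ℤ))) (l + 1) k * opNorm (T.Q D.n 0 (l + 1)) ^ τ *
          opNorm (T.Z D.n (l + 1)) * s l
        = T.normQ D.n (E (-(j : ℤ))) (l + 1) k *
          ((opNorm (T.Z D.n (l + 1)) * opNorm (T.Q D.n 0 (l + 1)) ^ τ) * s l) := by ring
      _ ≤ (C * Real.exp (x * (D.rsum 0 k - D.rsum 0 (l + 1)))) *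
          ((B * Real.exp ((τ + τ * lam 1 * (1 + τ)) * D.rsum 0 (l + 1))) *
            (A * Real.exp ((M - lam 1 + 4 * τ * (1 + lam 1)) * D.rsum 0 (l + 1)))) := by
          refine mul_le_mul e1 (mul_le_mul e2 (hs _) (hs0 _) (by positivity)) ?_ (by positivity)
          exact mul_nonneg (mul_nonneg (opNorm_nonneg _) (Real.rpow_nonneg (opNorm_nonneg _) _))
            (hs0 _)
      _ = _ := by
          rw [hy, add_mul (τ + τ * lam 1 * (1 + τ)),
            Real.exp_add ((τ + τ * lam 1 * (1 + τ)) * _)]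
          ring

end Estimates

section Corrections

variable {T : IETData 𝒜 d} {g : ℕ} {lam : ℕ → ℝ} {E : ℤ → Submodule ℝ (𝒜 → ℝ)} {τ : ℝ}
  {D : Frame 𝒜} {C : ℝ}

theorem integral_abs_stepFun_le {T : IETData 𝒜 d} (hpos : ∀ α, 0 < T.len α) (h : 𝒜 → ℝ) :
    ∫ x in T.domain, |T.stepFun h x| ≤ T.total * ‖h‖ := by
  have hint := (integrableOn_stepFun hpos h).abs
  rw [integral_domain_eq_sum hpos hint, total, Finset.sum_mul]
  refine Finset.sum_le_sum fun α _ => ?_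
  have : ∫ x in T.piece α, |T.stepFun h x| = ∫ _ in T.piece α, |h α| :=
    setIntegral_congr_fun (T.measurableSet_piece α) fun x hx => by
      simp only [stepFun_apply hpos h hx]
  rw [this, integral_piece_const hpos]
  exact mul_le_mul_of_nonneg_left (norm_le_pi_norm h α) (hpos α).le

theorem Regular.tower_zero (hT : T.Regular) (hF : T.FrameBounds g lam E τ D C) (k : ℕ) :
    Tower T (T.acc D.n k) (T.Qnat D.n 0 k) := by
  have := hF.tower hT (Nat.zero_le k)
  rwa [hF.acc_zero] at this

theorem FrameBounds.S_eq (hF : T.FrameBounds g lam E τ D C) (k : ℕ) (f : ℝ → ℝ) :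
    T.S D.n 0 k f = bsum T (T.acc D.n k) (T.Qnat D.n 0 k) f := by
  have : T.S D.n 0 k f = bsum (T.acc D.n 0) (T.acc D.n k) (T.Qnat D.n 0 k) f := rfl
  rw [this, hF.acc_zero]

theorem FrameBounds.mean_zero (hF : T.FrameBounds g lam E τ D C) (hT : T.Regular) (f : ℝ → ℝ) :
    (T.acc D.n 0).mean (T.S D.n 0 0 f) = T.mean f := by
  have h := hT.tower_zero hF 0
  have hQ : T.Qnat D.n 0 0 = 1 := by simp [Qnat, cocycle]
  rw [hF.S_eq]
  rw [hF.acc_zero] at h ⊢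
  rw [hQ] at h ⊢
  refine mean_congr T fun α x hx => ?_
  rw [h.bsum_apply f (T.inner_subset_piece α hx)]
  simp [Matrix.one_apply]

theorem FrameBounds.integrableOn_S (hF : T.FrameBounds g lam E τ D C) (hT : T.Regular)
    {f : ℝ → ℝ} (hf : IntegrableOn f T.domain) (k : ℕ) :
    IntegrableOn (T.S D.n 0 k f) (T.acc D.n k).domain := by
  rw [hF.S_eq]
  exact (hT.tower_zero hF k).integrableOn_bsum hf

/-- The mean values of Birkhoff sums form a quasi-orbit of the cocycle, with an error controlled
by the mean oscillation. -/
theorem FrameBounds.norm_mean_succ_sub_le (hF : T.FrameBounds g lam E τ D C) (hT : T.Regular)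
    {f : ℝ → ℝ} (hf : IntegrableOn f T.domain) {k : ℕ} {o : ℝ} (ho0 : 0 ≤ o)
    (ho : ∫ x in (T.acc D.n k).domain, |T.S D.n 0 k f x -
      (T.acc D.n k).stepFun ((T.acc D.n k).mean (T.S D.n 0 k f)) x| ≤ (T.acc D.n k).total * o) :
    ‖(T.acc D.n (k + 1)).mean (T.S D.n 0 (k + 1) f) -
      (T.Z D.n (k + 1)).mulVec ((T.acc D.n k).mean (T.S D.n 0 k f))‖ ≤
      C * (opNorm (T.Z D.n (k + 1)) * o) := by
  have hC : 0 ≤ C := zero_le_one.trans hF.one_le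
  have h1 := hT.tower_zero hF k
  have h2 := hF.tower hT (Nat.le_add_right k 1)
  have h3 := hT.tower_zero hF (k + 1)
  have hmul : T.Qnat D.n 0 (k + 1) = T.Qnat D.n k (k + 1) * T.Qnat D.n 0 k :=
    (Qnat_mul T hF.mono (Nat.zero_le k) (Nat.le_succ k)).symm
  have hpos := h2.pos
  have hpos' := h2.pos'
  set m := (T.acc D.n k).mean (T.S D.n 0 k f) with hm
  have hint := hF.integrableOn_S hT hf k
  have hints := integrableOn_stepFun hpos m
  have hdiff : IntegrableOn (fun x => T.S D.n 0 k f x - (T.acc D.n k).stepFun m x)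
      (T.acc D.n k).domain := hint.sub hints
  have hb := h2.integrableOn_bsum hdiff
  have key : (T.acc D.n (k + 1)).mean (T.S D.n 0 (k + 1) f) - (T.Z D.n (k + 1)).mulVec m =
      (T.acc D.n (k + 1)).mean (bsum (T.acc D.n k) (T.acc D.n (k + 1)) (T.Qnat D.n k (k + 1))
        (fun x => T.S D.n 0 k f x - (T.acc D.n k).stepFun m x)) := by
    have e1 : (T.acc D.n (k + 1)).mean (bsum (T.acc D.n k) (T.acc D.n (k + 1))
        (T.Qnat D.n k (k + 1)) (fun x => T.S D.n 0 k f x - (T.acc D.n k).stepFun m x)) =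
        (T.acc D.n (k + 1)).mean (fun x => T.S D.n 0 (k + 1) f x -
          (T.acc D.n (k + 1)).stepFun ((T.Z D.n (k + 1)).mulVec m) x) := by
      refine mean_congr _ fun α x hx => ?_
      have hxd : x ∈ (T.acc D.n (k + 1)).domain :=
        piece_subset_domain hpos' α (inner_subset_piece _ α hx)
      rw [bsum_sub, h2.bsum_stepFun m hxd, hF.S_eq, hF.S_eq]
      rw [hmul] at h3 ⊢
      rw [h1.bsum_comp h2 h3 f hxd]
      rfl
    rw [e1, mean_sub hpos' (hF.integrableOn_S hT hf (k + 1)) (integrableOn_stepFun hpos' _),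
      mean_stepFun hpos']
  rw [key]
  have ht := IETData.total_pos hpos'
  have ht2 : (T.acc D.n k).total ≤ opNorm (T.Z D.n (k + 1)) * (T.acc D.n (k + 1)).total :=
    h2.total_le_opNorm_mul
  calc _ ≤ C / (T.acc D.n (k + 1)).total * ∫ x in (T.acc D.n (k + 1)).domain,
        |bsum (T.acc D.n k) (T.acc D.n (k + 1)) (T.Qnat D.n k (k + 1))
          (fun x => T.S D.n 0 k f x - (T.acc D.n k).stepFun m x) x| :=
        norm_mean_le hpos' (hF.balanced (k + 1)) hb
    _ ≤ C / (T.acc D.n (k + 1)).total * ((T.acc D.n k).total * o) :=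
        mul_le_mul_of_nonneg_left ((h2.integral_abs_bsum_le hdiff).trans ho) (by positivity)
    _ ≤ C / (T.acc D.n (k + 1)).total *
          (opNorm (T.Z D.n (k + 1)) * (T.acc D.n (k + 1)).total * o) :=
        mul_le_mul_of_nonneg_left (mul_le_mul_of_nonneg_right ht2 ho0) (by positivity)
    _ = _ := by field_simp

/-- Existence of the correction, and bounds on the mean values when it vanishes. -/
theorem FrameBounds.correction (hF : T.FrameBounds g lam E τ D C) (hT : T.Regular) {j : ℤ}
    (hj : -(g : ℤ) ≤ j) (hj' : j ≤ (g : ℤ) + 1) {f : ℝ → ℝ} (hf : IntegrableOn f T.domain)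
    {o : ℕ → ℝ} (ho0 : ∀ k, 0 ≤ o k) {G : ℝ} (hG : 0 ≤ G)
    (ho : ∀ k, ∫ x in (T.acc D.n k).domain, |T.S D.n 0 k f x -
      (T.acc D.n k).stepFun ((T.acc D.n k).mean (T.S D.n 0 k f)) x| ≤
        (T.acc D.n k).total * (G * o k))
    (hsum : ∀ k, Summable fun l => T.normQInv D.n (D.U j) k (k + l + 1) *
      opNorm (T.Q D.n 0 (k + l + 1)) ^ τ * opNorm (T.Z D.n (k + l + 1)) * o (k + l)) :
    (∃ x ∈ D.U j, T.IsCorrection E D j f x ∧ ‖x‖ ≤ C * C * (‖T.mean f‖ +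
      G * ∑' l, T.normQInv D.n (D.U j) 0 (0 + l + 1) * opNorm (T.Q D.n 0 (0 + l + 1)) ^ τ *
        opNorm (T.Z D.n (0 + l + 1)) * o (0 + l))) ∧
    (T.IsCorrection E D j f 0 → ∀ k, ‖(T.acc D.n k).mean (T.S D.n 0 k f)‖ ≤ C * C *
      (G * ((∑ l ∈ Finset.range k, T.normQ D.n (E j) (l + 1) k *
          opNorm (T.Q D.n 0 (l + 1)) ^ τ * opNorm (T.Z D.n (l + 1)) * o l) +
        ∑' l, T.normQInv D.n (D.U j) k (k + l + 1) * opNorm (T.Q D.n 0 (k + l + 1)) ^ τ *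
          opNorm (T.Z D.n (k + l + 1)) * o (k + l)) +
        T.normQ D.n (E j) 0 k * ‖T.mean f‖)) := by
  have hC1 := hF.one_le
  have hC : 0 ≤ C := zero_le_one.trans hC1
  have hq0 : ∀ k, 0 ≤ C * opNorm (T.Q D.n 0 k) ^ τ := fun k =>
    mul_nonneg hC (Real.rpow_nonneg (opNorm_nonneg _) _)
  have hterm : ∀ k l, T.normQInv D.n (D.U j) k (k + l + 1) *
      ((C * opNorm (T.Q D.n 0 (k + l + 1)) ^ τ) *
        (C * (opNorm (T.Z D.n (k + l + 1)) * (G * o (k + l))))) =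
      C * C * G * (T.normQInv D.n (D.U j) k (k + l + 1) *
      opNorm (T.Q D.n 0 (k + l + 1)) ^ τ * opNorm (T.Z D.n (k + l + 1)) * o (k + l)) :=
    fun k l => by ring
  have hmain := hT.quasiOrbit hF.mono (hF.compl j hj hj')
    (m := fun k => (T.acc D.n k).mean (T.S D.n 0 k f))
    (b := fun k => C * (opNorm (T.Z D.n (k + 1)) * (G * o k)))
    (q := fun k => C * opNorm (T.Q D.n 0 k) ^ τ)
    (fun k v => (hF.norm_proj k j hj hj' v).1) (fun k v => (hF.norm_proj k j hj hj' v).2) hq0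
    (fun k => hF.norm_mean_succ_sub_le hT hf (mul_nonneg hG (ho0 k)) (ho k))
    (fun k => by simp only [hterm]; exact (hsum k).mul_left _)
  simp only [hterm, tsum_mul_left] at hmain
  rw [hF.mean_zero hT f] at hmain
  have hq00 : C * opNorm (T.Q D.n 0 0) ^ τ ≤ C * C := by
    have : opNorm (T.Q D.n 0 0) = 1 := le_antisymm (by rw [Q_self]; exact opNorm_one_le)
      (hF.one_le_opNorm hT 0 0 le_rfl)
    rw [this, Real.one_rpow]
    exact mul_le_mul_of_nonneg_left hC1 hC
  have hq00' := mul_le_mul_of_nonneg_right hq00 (norm_nonneg (T.mean f))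
  obtain ⟨⟨x, hx, hlim, hle⟩, h2⟩ := hmain
  refine ⟨⟨x, hx, hlim, hle.trans ?_⟩, fun h0 k => (h2 h0 k).trans ?_⟩
  · linarith
  · have e1 : ∑ l ∈ Finset.range k, T.normQ D.n (E j) (l + 1) k *
        ((C * opNorm (T.Q D.n 0 (l + 1)) ^ τ) * (C * (opNorm (T.Z D.n (l + 1)) * (G * o l)))) =
        C * C * G * ∑ l ∈ Finset.range k, T.normQ D.n (E j) (l + 1) k *
          opNorm (T.Q D.n 0 (l + 1)) ^ τ * opNorm (T.Z D.n (l + 1)) * o l := by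
      rw [Finset.mul_sum]
      exact Finset.sum_congr rfl fun l _ => by ring
    rw [e1]
    have e2 := mul_le_mul_of_nonneg_left hq00'
      (opNormOn_nonneg (T.Q D.n 0 k) (T.push D.n 0 (E j)))
    change T.normQ D.n (E j) 0 k * _ ≤ T.normQ D.n (E j) 0 k * _ at e2
    linarith

theorem exists_mem_ne_zero_of_isCompl {E U : Submodule ℝ (𝒜 → ℝ)} (h : IsCompl E U)
    (hE : E ≠ ⊤) : ∃ v ∈ U, v ≠ 0 := by
  refine U.exists_mem_ne_zero_of_ne_bot fun hU => hE ?_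
  have := h.sup_eq_top
  rwa [hU, sup_bot_eq] at this

theorem FrameBounds.bracket_le_Kseries (hF : T.FrameBounds g lam E τ D C) (hT : T.Regular)
    (hτ : 0 < τ) {i : ℕ} (hig : i ≤ g + 1) (hi : E i ≠ ⊤) {a : ℝ}
    (hsum : ∀ k, Summable fun m => T.Kterm D a i τ k (k + m)) (k : ℕ) :
    bracket a (opNorm (T.Q D.n 0 k)) ≤ T.Kseries D a i τ k := by
  have hb : 1 ≤ bracket a (opNorm (T.Q D.n 0 k)) :=
    one_le_bracket (hF.one_le_opNorm hT 0 k (Nat.zero_le k))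
  obtain ⟨v, hv, hv0⟩ := exists_mem_ne_zero_of_isCompl
    (hF.compl i (by omega) (by exact_mod_cast hig)) hi
  have hq : 1 ≤ opNorm (T.Q D.n 0 (k + 1)) ^ τ :=
    Real.one_le_rpow (hF.one_le_opNorm hT 0 (k + 1) (Nat.zero_le _)) hτ.le
  have hz : 1 ≤ T.normQInv D.n (D.U i) k (k + 1) * opNorm (T.Z D.n (k + 1)) := by
    set w := (T.Q D.n 0 k).mulVec v with hw
    have hw0 : 0 < ‖w‖ := by
      refine norm_pos_iff.2 fun h => hv0 ?_
      rw [← hT.Q_inv_mulVec D.n 0 k v, ← hw, h, Matrix.mulVec_zero]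
    have hmem : (T.Q D.n k (k + 1)).mulVec w ∈ T.push D.n (k + 1) (D.U i) :=
      mulVec_mem_push hF.mono (Nat.le_succ k) (mem_push.2 ⟨v, hv, rfl⟩)
    have h1 := norm_mulVec_le_opNormOn (T.Q D.n k (k + 1))⁻¹ hmem
    rw [hT.Q_inv_mulVec] at h1
    have h2 := norm_mulVec_le_opNorm (T.Q D.n k (k + 1)) w
    have h3 := h1.trans (mul_le_mul_of_nonneg_left h2 (opNormOn_nonneg _ _))
    rw [← mul_assoc] at h3
    exact le_of_mul_le_mul_right (by rwa [one_mul]) hw0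
  calc bracket a (opNorm (T.Q D.n 0 k)) ≤ T.Kterm D a i τ k k := by
        rw [Kterm]
        have h1 : bracket a (opNorm (T.Q D.n 0 k)) ≤ T.normQInv D.n (D.U i) k (k + 1) *
            opNorm (T.Z D.n (k + 1)) * bracket a (opNorm (T.Q D.n 0 k)) :=
          le_mul_of_one_le_left (by linarith) hz
        exact h1.trans (le_mul_of_one_le_right (by linarith) hq)
    _ ≤ _ := (hsum k).le_tsum 0 fun l _ => hF.Kterm_nonneg hT a i k _

theorem FrameBounds.normQ_le_series (hF : T.FrameBounds g lam E τ D C) (hT : T.Regular)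
    (hτ : 0 < τ) {i : ℕ} (hig : i ≤ g + 1) (hi : E i ≠ ⊤) {a : ℝ}
    (hsum : ∀ k, Summable fun m => T.Kterm D a i τ k (k + m)) (k : ℕ) :
    T.normQ D.n (E i) 0 k ≤ T.Kseries D a i τ k + T.Cseries E D a i τ k := by
  have hK := hF.bracket_le_Kseries hT hτ hig hi hsum k
  have hb := one_le_bracket (a := a) (hF.one_le_opNorm hT 0 k (Nat.zero_le k))
  have hC0 := hF.Cseries_nonneg (E := E) hT a i k
  rcases Nat.eq_zero_or_pos k with rfl | hk
  · have : T.normQ D.n (E i) 0 0 ≤ 1 := by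
      rw [normQ, Q_self]
      exact opNormOn_one_le _
    linarith
  · have hz0 : 0 ≤ opNorm (T.Z D.n 1) := opNorm_nonneg _
    have h1 : T.normQ D.n (E i) 0 k ≤ T.normQ D.n (E i) (0 + 1) k * opNorm (T.Z D.n (0 + 1)) := by
      refine opNormOn_le _ (mul_nonneg (opNormOn_nonneg _ _) hz0) fun v hv => ?_
      rw [← Q_mulVec_mulVec T hF.mono (Nat.zero_le 1) hk, mul_assoc]
      exact (norm_mulVec_le_opNormOn _ (mulVec_mem_push hF.mono (Nat.zero_le 1) hv)).trans
        (mul_le_mul_of_nonneg_left (norm_mulVec_le_opNorm _ _) (opNormOn_nonneg _ _))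
    have h0 : 0 ≤ T.normQ D.n (E i) (0 + 1) k * opNorm (T.Z D.n (0 + 1)) :=
      mul_nonneg (opNormOn_nonneg _ _) hz0
    have hb0 := one_le_bracket (a := a) (hF.one_le_opNorm hT 0 0 le_rfl)
    have hq : 1 ≤ opNorm (T.Q D.n 0 (0 + 1)) ^ τ :=
      Real.one_le_rpow (hF.one_le_opNorm hT 0 (0 + 1) (Nat.zero_le _)) hτ.le
    have h2 : T.normQ D.n (E i) (0 + 1) k * opNorm (T.Z D.n (0 + 1)) ≤
        T.normQ D.n (E i) (0 + 1) k * opNorm (T.Z D.n (0 + 1)) *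
          bracket a (opNorm (T.Q D.n 0 0)) * opNorm (T.Q D.n 0 (0 + 1)) ^ τ :=
      (le_mul_of_one_le_right h0 hb0).trans
        (le_mul_of_one_le_right (mul_nonneg h0 (by linarith)) hq)
    have h3 := Finset.single_le_sum (f := fun l => T.normQ D.n (E i) (l + 1) k *
      opNorm (T.Z D.n (l + 1)) * bracket a (opNorm (T.Q D.n 0 l)) *
        opNorm (T.Q D.n 0 (l + 1)) ^ τ) (s := Finset.range k)
      (fun l _ => mul_nonneg (mul_nonneg (mul_nonneg (opNormOn_nonneg _ _) (opNorm_nonneg _))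
        (zero_le_one.trans (one_le_bracket (hF.one_le_opNorm hT 0 l (Nat.zero_le l)))))
        (Real.rpow_nonneg (opNorm_nonneg _) _)) (Finset.mem_range.2 hk)
    have h4 := (h1.trans h2).trans h3
    change _ ≤ T.Cseries E D a i τ k at h4
    linarith

/-- Corrections of functions with singularities of order `a` at the ends of the exchanged
intervals. -/
theorem FrameBounds.correction_of_singBound (hF : T.FrameBounds g lam E τ D C) (hT : T.Regular)
    (hτ : 0 < τ) {i : ℕ} (hi1 : 1 ≤ i) (hig : i ≤ g + 1) (hi : E i ≠ ⊤) {a : ℝ} (ha0 : 0 ≤ a)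
    (ha1 : a < 1) (hsum : ∀ k, Summable fun m => T.Kterm D a i τ k (k + m)) :
    ∃ B : ℝ, 0 ≤ B ∧ ∀ (P : ℝ) (ψ : ℝ → ℝ), T.SingBound a P ψ →
      (∃ h ∈ D.U i, T.IsCorrection E D i ψ h ∧ ‖h‖ ≤ B * ((∫ x in T.domain, |ψ x|) + P)) ∧
      (T.IsCorrection E D i ψ 0 → ∀ k, ∫ x in (T.acc D.n k).domain, |T.S D.n 0 k ψ x| ≤
        B * ((∫ x in T.domain, |ψ x|) + P) * T.sSeq E D a i τ k) := by
  have hC : 0 ≤ C := zero_le_one.trans hF.one_le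
  have hpos := hT.len_pos
  have htot := IETData.total_pos hpos
  obtain ⟨C₁, hC₁, hosc⟩ := exists_integral_bsum_sub_mean_le hpos ha0 ha1
  have hK0 := hF.Kseries_nonneg hT a i 0
  set K₀ := T.Kseries D a i τ 0 with hK₀
  have hCt : 0 ≤ C / T.total := by positivity
  set B := C₁ + C * C * (C₁ + C / T.total + C₁ * K₀) with hB
  have hcK : 0 ≤ C₁ * K₀ := by positivity
  have hB0 : 0 ≤ B := by positivity
  refine ⟨B, hB0, fun P ψ hψ => ?_⟩
  have hP := hψ.nonneg hpos
  have hint := hψ.integrableOn hpos ha1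
  have hI : 0 ≤ ∫ x in T.domain, |ψ x| := integral_nonneg fun x => abs_nonneg _
  set I := ∫ x in T.domain, |ψ x| with hIdef
  have hb0 : ∀ k, 0 ≤ bracket a (opNorm (T.Q D.n 0 k)) := fun k =>
    zero_le_one.trans (one_le_bracket (hF.one_le_opNorm hT 0 k (Nat.zero_le k)))
  have ho : ∀ k, ∫ x in (T.acc D.n k).domain, |T.S D.n 0 k ψ x -
      (T.acc D.n k).stepFun ((T.acc D.n k).mean (T.S D.n 0 k ψ)) x| ≤
        (T.acc D.n k).total * (C₁ * P * bracket a (opNorm (T.Q D.n 0 k))) := by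
    intro k
    have h1 := hT.tower_zero hF k
    have ht := FrameBounds.total_pos hT D.n k
    have h2 : bracket a (T.total / (T.acc D.n k).total) ≤ bracket a (opNorm (T.Q D.n 0 k)) :=
      bracket_mono (by positivity) ((div_le_iff₀ ht).2 h1.total_le_opNorm_mul)
    rw [hF.S_eq]
    refine (hosc _ _ h1 P ψ hψ).trans ?_
    have h3 : 0 ≤ C₁ * P * (T.acc D.n k).total := by positivity
    have := mul_le_mul_of_nonneg_left h2 h3
    linarith
  have hterm : ∀ k l, T.normQInv D.n (D.U i) k (k + l + 1) *
      opNorm (T.Q D.n 0 (k + l + 1)) ^ τ * opNorm (T.Z D.n (k + l + 1)) *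
        bracket a (opNorm (T.Q D.n 0 (k + l))) = T.Kterm D a i τ k (k + l) := fun k l => by
    rw [Kterm]; ring
  have hmain := hF.correction hT (j := (i : ℤ)) (by omega) (by exact_mod_cast hig) hint
    hb0 (mul_nonneg hC₁ hP) ho (fun k => by simp only [hterm]; exact hsum k)
  simp only [hterm] at hmain
  have hm0 : ‖T.mean ψ‖ ≤ C / T.total * I := by
    have hbal := hF.balanced 0
    rw [hF.acc_zero] at hbal
    exact norm_mean_le hpos hbal hint
  have hcP : 0 ≤ C₁ * P := by positivity
  obtain ⟨⟨h, hh, hcor, hle⟩, h2⟩ := hmain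
  refine ⟨⟨h, hh, hcor, hle.trans ?_⟩, fun h0 k => ?_⟩
  · have e1 : ∑' l, T.Kterm D a i τ 0 (0 + l) = K₀ := rfl
    rw [e1]
    calc C * C * (‖T.mean ψ‖ + C₁ * P * K₀)
        ≤ C * C * ((C₁ + C / T.total + C₁ * K₀) * (I + P)) := by
          refine mul_le_mul_of_nonneg_left ?_ (by positivity)
          have : 0 ≤ C₁ * (I + P) + C / T.total * P + C₁ * K₀ * I := by positivity
          linarith
      _ ≤ B * (I + P) := by
          rw [hB]
          have : 0 ≤ C₁ * (I + P) := by positivity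
          linarith
  · have hmk := h2 h0 k
    have hKk := hF.bracket_le_Kseries hT hτ hig hi hsum k
    have hQk := hF.normQ_le_series hT hτ hig hi hsum k
    have hK0 := hF.Kseries_nonneg hT a i k
    have hC0 := hF.Cseries_nonneg (E := E) hT a i k
    have e1 : ∑' l, T.Kterm D a i τ k (k + l) = T.Kseries D a i τ k := rfl
    have e2 : ∑ l ∈ Finset.range k, T.normQ D.n (E i) (l + 1) k *
          opNorm (T.Q D.n 0 (l + 1)) ^ τ * opNorm (T.Z D.n (l + 1)) *
          bracket a (opNorm (T.Q D.n 0 l)) = T.Cseries E D a i τ k :=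
      Finset.sum_congr rfl fun l _ => by ring
    rw [e1, e2] at hmk
    have hposk := (hT.acc D.n k).len_pos
    have ht := (FrameBounds.total_pos hT D.n k).le
    set m := (T.acc D.n k).mean (T.S D.n 0 k ψ) with hm
    set X := T.Kseries D a i τ k + T.Cseries E D a i τ k with hX
    have hX0 : 0 ≤ X := add_nonneg hK0 hC0
    have hintk := hF.integrableOn_S hT hint k
    have hints := integrableOn_stepFun hposk m
    have hdiff : IntegrableOn (fun x => T.S D.n 0 k ψ x - (T.acc D.n k).stepFun m x)
      (T.acc D.n k).domain := hintk.sub hints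
    have hmk2 : ‖m‖ ≤ C * C * ((C₁ + C / T.total + C₁ * K₀) * (I + P)) * X := by
      calc ‖m‖ ≤ C * C * (C₁ * P * (T.Cseries E D a i τ k + T.Kseries D a i τ k) +
            T.normQ D.n (E i) 0 k * ‖T.mean ψ‖) := hmk
        _ ≤ C * C * (C₁ * P * X + X * (C / T.total * I)) := by
            refine mul_le_mul_of_nonneg_left (add_le_add (le_of_eq (by rw [hX]; ring)) ?_)
              (by positivity)
            exact mul_le_mul hQk hm0 (norm_nonneg _) hX0
        _ ≤ _ := by
            have e3 : 0 ≤ C * C * ((C₁ * I + C / T.total * P + C₁ * K₀ * (I + P)) * X) := by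
              positivity
            linarith
    calc ∫ x in (T.acc D.n k).domain, |T.S D.n 0 k ψ x|
        ≤ ∫ x in (T.acc D.n k).domain, (|T.S D.n 0 k ψ x - (T.acc D.n k).stepFun m x| +
            |(T.acc D.n k).stepFun m x|) := by
          refine integral_mono hintk.abs (hdiff.abs.add hints.abs) fun x => ?_
          have := abs_add_le (T.S D.n 0 k ψ x - (T.acc D.n k).stepFun m x)
            ((T.acc D.n k).stepFun m x)
          rwa [sub_add_cancel] at this
      _ = (∫ x in (T.acc D.n k).domain, |T.S D.n 0 k ψ x - (T.acc D.n k).stepFun m x|) +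
            ∫ x in (T.acc D.n k).domain, |(T.acc D.n k).stepFun m x| :=
          integral_add hdiff.abs hints.abs
      _ ≤ (T.acc D.n k).total * (C₁ * P * X) + (T.acc D.n k).total *
            (C * C * ((C₁ + C / T.total + C₁ * K₀) * (I + P)) * X) := by
          refine add_le_add ((ho k).trans (mul_le_mul_of_nonneg_left
            (mul_le_mul_of_nonneg_left (by linarith) hcP) ht))
            ((integral_abs_stepFun_le hposk m).trans (mul_le_mul_of_nonneg_left hmk2 ht))
      _ ≤ B * (I + P) * ((T.acc D.n k).total * X) := by
          rw [hB]
          have : 0 ≤ C₁ * I * ((T.acc D.n k).total * X) := by positivity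
          linarith
      _ = _ := rfl

/-- Corrections of functions whose derivative has controlled Birkhoff sums. -/
theorem FrameBounds.correction_of_pieceDeriv (hF : T.FrameBounds g lam E τ D C)
    (hT : T.Regular) {j : ℕ} (hjg : j ≤ g) {φ ψ : ℝ → ℝ} (hφ : T.PieceDeriv φ ψ)
    (hψ : IntegrableOn ψ T.domain) {s : ℕ → ℝ} (hs0 : ∀ k, 0 ≤ s k) {G : ℝ} (hG : 0 ≤ G)
    (hs : ∀ k, ∫ x in (T.acc D.n k).domain, |T.S D.n 0 k ψ x| ≤ G * s k)
    (hsum : ∀ k, Summable fun m => T.Vterm D j τ s k (k + m)) :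
    (∃ h ∈ D.U (-(j : ℤ)), T.IsCorrection E D (-(j : ℤ)) φ h ∧
      ‖h‖ ≤ C * C * (‖T.mean φ‖ + G * T.Vseries D j τ s 0)) ∧
    (T.IsCorrection E D (-(j : ℤ)) φ 0 → ∀ k, ‖(T.acc D.n k).mean (T.S D.n 0 k φ)‖ ≤
      C * C * (G * (T.Wseries E D j τ s k + T.Vseries D j τ s k) +
        T.normQ D.n (E (-(j : ℤ))) 0 k * ‖T.mean φ‖)) := by
  have ho : ∀ k, ∫ x in (T.acc D.n k).domain, |T.S D.n 0 k φ x -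
      (T.acc D.n k).stepFun ((T.acc D.n k).mean (T.S D.n 0 k φ)) x| ≤
        (T.acc D.n k).total * (G * s k) := by
    intro k
    have h1 := hT.tower_zero hF k
    have h2 := (h1.pieceDeriv hφ).integral_sub_mean_le h1.pos' (h1.integrableOn_bsum hψ)
    rw [← hF.S_eq, ← hF.S_eq] at h2
    exact h2.trans (mul_le_mul_of_nonneg_left (hs k) (FrameBounds.total_pos hT D.n k).le)
  exact hF.correction hT (by omega) (by omega) (hφ.integrableOn hT.len_pos hψ) hs0 hG ho hsum

theorem FrameBounds.var_S_le (hF : T.FrameBounds g lam E τ D C) (hT : T.Regular)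
    {φ ψ : ℝ → ℝ} (hφ : T.PieceDeriv φ ψ) (hψ : IntegrableOn ψ T.domain) (k : ℕ) :
    (T.acc D.n k).Var (T.S D.n 0 k φ) ≤
      ENNReal.ofReal (∫ x in (T.acc D.n k).domain, |T.S D.n 0 k ψ x|) := by
  have h1 := hT.tower_zero hF k
  rw [hF.S_eq, hF.S_eq]
  exact (h1.pieceDeriv hφ).var_le h1.pos' (h1.integrableOn_bsum hψ)

end Corrections

section FunctionSpaces

variable {T : IETData 𝒜 d} {a : ℝ} {φ : ℝ → ℝ}

theorem normPa_zero (T : IETData 𝒜 d) (a : ℝ) (ψ : ℝ → ℝ) :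
    T.normPa a 0 ψ = (∫ x in T.domain, |ψ x|) + T.pa a ψ := by
  simp [normPa]

theorem normPa_one (T : IETData 𝒜 d) (a : ℝ) (φ : ℝ → ℝ) :
    T.normPa a 1 φ = (∫ x in T.domain, |φ x|) + T.normPa a 0 (deriv φ) := by
  rw [normPa_zero, normPa, Finset.sum_range_succ, Finset.sum_range_one, iteratedDeriv_zero,
    iteratedDeriv_one, add_assoc]

theorem normPa_deriv_le (T : IETData 𝒜 d) (a : ℝ) (φ : ℝ → ℝ) :
    T.normPa a 0 (deriv φ) ≤ T.normPa a 1 φ := by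
  rw [normPa_one]
  exact le_add_of_nonneg_left (integral_nonneg fun _ => abs_nonneg _)

theorem isOpen_inner (T : IETData 𝒜 d) (α : 𝒜) : IsOpen (T.inner α) := isOpen_Ioo

theorem singBound_deriv (hφ : φ ∈ T.CPaG a 1) : T.SingBound a (T.pa a (deriv φ)) (deriv φ) := by
  obtain ⟨h1, h2, -⟩ := hφ
  rw [iteratedDeriv_one] at h2
  exact ⟨fun α => (h1 α).deriv_of_isOpen (T.isOpen_inner α) (by norm_num),
    fun α x hx => le_csSup h2 ⟨α, x, hx, rfl⟩⟩

theorem pieceDeriv_deriv (hφ : φ ∈ T.CPaG a 1) : T.PieceDeriv φ (deriv φ) := by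
  obtain ⟨h1, -⟩ := hφ
  refine fun α => ⟨(h1 α).continuousOn_deriv_of_isOpen (T.isOpen_inner α) (by norm_num),
    fun x hx => ?_⟩
  exact (((h1 α).differentiableOn (by norm_num)).differentiableAt
    ((T.isOpen_inner α).mem_nhds hx)).hasDerivAt

theorem integrableOn_deriv (hpos : ∀ α, 0 < T.len α) (ha1 : a < 1) (hφ : φ ∈ T.CPaG a 1) :
    IntegrableOn (deriv φ) T.domain := (singBound_deriv hφ).integrableOn hpos ha1

theorem integrableOn_of_mem (hpos : ∀ α, 0 < T.len α) (ha1 : a < 1) (hφ : φ ∈ T.CPaG a 1) :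
    IntegrableOn φ T.domain :=
  (pieceDeriv_deriv hφ).integrableOn hpos (integrableOn_deriv hpos ha1 hφ)

theorem normPa_deriv_nonneg (hpos : ∀ α, 0 < T.len α) (hφ : φ ∈ T.CPaG a 1) :
    0 ≤ T.normPa a 0 (deriv φ) := by
  rw [normPa_zero]
  exact add_nonneg (integral_nonneg fun _ => abs_nonneg _) ((singBound_deriv hφ).nonneg hpos)

theorem abs_le_norm_mean_add {T : IETData 𝒜 d} {φ ψ : ℝ → ℝ} (hφ : T.PieceDeriv φ ψ)
    (hpos : ∀ α, 0 < T.len α)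
    (hψ : IntegrableOn ψ T.domain) {α : 𝒜} {x : ℝ} (hx : x ∈ T.inner α) :
    |φ x| ≤ ‖T.mean φ‖ + ∫ t in T.domain, |ψ t| := by
  have h1 := (hφ.abs_sub_mean_le hpos hψ hx).trans (integral_piece_le_domain hpos hψ α)
  have h2 : |T.mean φ α| ≤ ‖T.mean φ‖ := norm_le_pi_norm (T.mean φ) α
  have h3 := abs_sub_abs_le_abs_sub (φ x) (T.mean φ α)
  linarith

theorem bddAbove_abs_image (hpos : ∀ α, 0 < T.len α) (ha1 : a < 1) (hφ : φ ∈ T.CPaG a 1) :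
    BddAbove ((fun x => |φ x|) '' ⋃ α, T.inner α) := by
  refine ⟨‖T.mean φ‖ + ∫ t in T.domain, |deriv φ t|, ?_⟩
  rintro _ ⟨x, hx, rfl⟩
  obtain ⟨α, hα⟩ := mem_iUnion.1 hx
  exact abs_le_norm_mean_add (pieceDeriv_deriv hφ) hpos (integrableOn_deriv hpos ha1 hφ) hα

theorem norm_mean_le_supNorm (hpos : ∀ α, 0 < T.len α) (ha1 : a < 1) (hφ : φ ∈ T.CPaG a 1) :
    ‖T.mean φ‖ ≤ T.supNorm φ := by
  have hb := bddAbove_abs_image hpos ha1 hφ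
  have h0 : 0 ≤ T.supNorm φ := Real.sSup_nonneg (by rintro _ ⟨x, -, rfl⟩; exact abs_nonneg _)
  refine (pi_norm_le_iff_of_nonneg h0).2 fun α => ?_
  rw [mean_apply, norm_mul, norm_inv, Real.norm_of_nonneg (hpos α).le, inv_mul_le_iff₀ (hpos α),
    integral_piece_eq_inner]
  have h1 : ∀ x ∈ T.inner α, ‖φ x‖ ≤ T.supNorm φ := fun x hx =>
    le_csSup hb ⟨x, mem_iUnion.2 ⟨α, hx⟩, rfl⟩
  have h2 := norm_setIntegral_le_of_norm_le_const (μ := volume) (s := T.inner α)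
    (by rw [inner, Real.volume_Ioo]; exact ENNReal.ofReal_lt_top) h1
  have h3 : volume.real (T.inner α) = T.len α := by
    have := integral_piece_const hpos α 1
    rw [integral_piece_eq_inner, setIntegral_const, smul_eq_mul, mul_one, mul_one] at this
    exact this
  rw [h3] at h2
  linarith

theorem integrable_stepFun (T : IETData 𝒜 d) (h : 𝒜 → ℝ) : Integrable (T.stepFun h) := by
  refine integrable_finsetSum _ fun α _ => ?_
  rw [integrable_indicator_iff (T.measurableSet_piece α)]
  exact integrableOn_const (by rw [piece, Real.volume_Ico]; exact ENNReal.ofReal_ne_top)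

theorem primitive_sub (T : IETData 𝒜 d) (h : 𝒜 → ℝ) (x y : ℝ) :
    T.primitive h y - T.primitive h x = ∫ t in x..y, T.stepFun h t :=
  intervalIntegral.integral_interval_sub_left (T.integrable_stepFun h).intervalIntegrable
    (T.integrable_stepFun h).intervalIntegrable

theorem primitive_linear (T : IETData 𝒜 d) (s t : ℝ) (h h' : 𝒜 → ℝ) (x : ℝ) :
    T.primitive (s • h + t • h') x = s * T.primitive h x + t * T.primitive h' x := by
  have : T.stepFun (s • h + t • h') = fun y => s * T.stepFun h y + t * T.stepFun h' y := by
    funext y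
    simp only [stepFun, Finset.mul_sum, ← Finset.sum_add_distrib]
    refine Finset.sum_congr rfl fun α _ => ?_
    by_cases hy : y ∈ T.piece α <;> simp [hy]
  rw [primitive, this, intervalIntegral.integral_add
    ((T.integrable_stepFun h).intervalIntegrable.const_mul s)
    ((T.integrable_stepFun h').intervalIntegrable.const_mul t),
    intervalIntegral.integral_const_mul, intervalIntegral.integral_const_mul]
  rfl

theorem primitive_eq_affine (hpos : ∀ α, 0 < T.len α) (h : 𝒜 → ℝ) (α : 𝒜) :
    EqOn (T.primitive h) (fun x => (T.primitive h (T.left α) - h α * T.left α) + h α * x)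
      (T.inner α) := by
  intro x hx
  have h1 := T.primitive_sub h (T.left α) x
  have h2 : ∫ t in (T.left α)..x, T.stepFun h t = ∫ _ in (T.left α)..x, h α :=
    intervalIntegral.integral_congr_ae (ae_of_all _ fun t ht => by
      rw [uIoc_of_le hx.1.le] at ht
      exact stepFun_apply hpos h ⟨ht.1.le, ht.2.trans_lt hx.2⟩)
  rw [h2, intervalIntegral.integral_const, smul_eq_mul] at h1
  simp only
  linarith

theorem abs_primitive_le (hpos : ∀ α, 0 < T.len α) (h : 𝒜 → ℝ) {x : ℝ} (hx : x ∈ T.domain) :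
    |T.primitive h x| ≤ T.total * ‖h‖ := by
  refine le_trans ?_ (integral_abs_stepFun_le hpos h)
  refine (intervalIntegral.abs_integral_le_integral_abs hx.1).trans ?_
  rw [intervalIntegral.integral_of_le hx.1, integral_Ioc_eq_integral_Ioo]
  exact setIntegral_mono_set (integrableOn_stepFun hpos h).abs
    (ae_of_all _ fun _ => abs_nonneg _)
    (LE.le.eventuallyLE fun y hy => ⟨hy.1.le, hy.2.trans hx.2⟩)

theorem deriv_sub_primitive (hpos : ∀ α, 0 < T.len α) (hφ : φ ∈ T.CPaG a 1) (h : 𝒜 → ℝ)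
    (α : 𝒜) : EqOn (deriv fun x => φ x - T.primitive h x) (fun x => deriv φ x - h α)
      (T.inner α) := by
  intro x hx
  have h1 := (pieceDeriv_deriv hφ α).2 x hx
  have h2 : HasDerivAt (T.primitive h) (h α) x := by
    have h3 : HasDerivAt (fun x => (T.primitive h (T.left α) - h α * T.left α) + h α * x)
        (h α) x := by
      simpa using ((hasDerivAt_id x).const_mul (h α)).const_add
        (T.primitive h (T.left α) - h α * T.left α)
    exact h3.congr_of_eventuallyEq
      ((primitive_eq_affine hpos h α).eventuallyEq_of_mem ((T.isOpen_inner α).mem_nhds hx))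
  exact (h1.sub h2).deriv

theorem deriv_sub_primitive_eq_stepFun (hpos : ∀ α, 0 < T.len α) (hφ : φ ∈ T.CPaG a 1)
    (h : 𝒜 → ℝ) (α : 𝒜) : EqOn (deriv fun x => φ x - T.primitive h x)
      (fun x => deriv φ x - T.stepFun h x) (T.inner α) := fun x hx => by
  simp only [deriv_sub_primitive hpos hφ h α hx, stepFun_apply hpos h (T.inner_subset_piece α hx)]

theorem deriv_deriv_sub_primitive (hpos : ∀ α, 0 < T.len α) (hφ : φ ∈ T.CPaG a 1) (h : 𝒜 → ℝ)
    (α : 𝒜) : EqOn (deriv (deriv fun x => φ x - T.primitive h x)) (deriv (deriv φ))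
      (T.inner α) := by
  intro x hx
  have h1 := ((deriv_sub_primitive hpos hφ h α).eventuallyEq_of_mem
    ((T.isOpen_inner α).mem_nhds hx)).deriv_eq
  rw [h1, deriv_sub_const]

theorem paSet_sub_primitive (hpos : ∀ α, 0 < T.len α) (hφ : φ ∈ T.CPaG a 1) (h : 𝒜 → ℝ) :
    T.paSet a (deriv fun x => φ x - T.primitive h x) = T.paSet a (deriv φ) := by
  have key := fun α => deriv_deriv_sub_primitive hpos hφ h α
  ext y
  constructor <;> rintro ⟨α, x, hx, rfl⟩ <;> exact ⟨α, x, hx, by rw [key α hx]⟩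

theorem sub_primitive_mem (hpos : ∀ α, 0 < T.len α) (hφ : φ ∈ T.CPaG a 1) (h : 𝒜 → ℝ) :
    (fun x => φ x - T.primitive h x) ∈ T.CPaG a 1 := by
  obtain ⟨h1, h2, cp, cm, h3, h4, h5⟩ := id hφ
  have key := fun α => deriv_deriv_sub_primitive hpos hφ h α
  have hit : ∀ f : ℝ → ℝ, iteratedDeriv (1 + 1) f = deriv (deriv f) := fun f => by
    rw [iteratedDeriv_succ, iteratedDeriv_one]
  simp only [hit] at h3 h4
  refine ⟨fun α => ?_, ?_, cp, cm, fun α => ?_, fun α => ?_, h5⟩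
  · refine (h1 α).sub (ContDiffOn.congr ?_ (primitive_eq_affine hpos h α))
    exact (contDiff_const.add (contDiff_const.mul contDiff_id)).contDiffOn
  · rw [iteratedDeriv_one] at h2 ⊢
    rwa [paSet_sub_primitive hpos hφ h]
  · simp only [hit]
    refine (h3 α).congr' ?_
    filter_upwards [Ioo_mem_nhdsGT (T.left_lt_right hpos α)] with x hx
    rw [key α hx]
  · simp only [hit]
    refine (h4 α).congr' ?_
    filter_upwards [Ioo_mem_nhdsLT (T.left_lt_right hpos α)] with x hx
    rw [key α hx]

theorem integral_abs_sub_le {s : Set ℝ} {f g : ℝ → ℝ} (hf : IntegrableOn f s)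
    (hg : IntegrableOn g s) :
    ∫ x in s, |f x - g x| ≤ (∫ x in s, |f x|) + ∫ x in s, |g x| := by
  rw [← integral_add hf.abs hg.abs]
  exact integral_mono (hf.sub hg).abs (hf.abs.add hg.abs) fun x => abs_sub _ _

theorem normPa_sub_primitive_le (hpos : ∀ α, 0 < T.len α) (ha1 : a < 1) (hφ : φ ∈ T.CPaG a 1)
    (h : 𝒜 → ℝ) : T.normPa a 1 (fun x => φ x - T.primitive h x) ≤
      T.normPa a 1 φ + (T.total * T.total + T.total) * ‖h‖ := by
  have hmem := sub_primitive_mem hpos hφ h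
  have ht := IETData.total_pos hpos
  have hp : IntegrableOn (T.primitive h) T.domain := by
    refine ((integrableOn_of_mem hpos ha1 hφ).sub (integrableOn_of_mem hpos ha1 hmem)).congr
      (ae_of_all _ fun x => ?_)
    simp
  have e1 : ∫ x in T.domain, |φ x - T.primitive h x| ≤
      (∫ x in T.domain, |φ x|) + T.total * (T.total * ‖h‖) := by
    refine (integral_abs_sub_le (integrableOn_of_mem hpos ha1 hφ) hp).trans
      (add_le_add le_rfl ?_)
    have h1 := setIntegral_mono_on hp.abs
      (integrableOn_const (C := T.total * ‖h‖)
        (by rw [domain, Real.volume_Ico]; exact ENNReal.ofReal_ne_top))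
      measurableSet_Ico (fun x hx => abs_primitive_le hpos h hx)
    rw [setIntegral_const, domain, measureReal_def, Real.volume_Ico, sub_zero,
      ENNReal.toReal_ofReal ht.le, smul_eq_mul] at h1
    exact h1
  have e2 : ∫ x in T.domain, |deriv (fun x => φ x - T.primitive h x) x| ≤
      (∫ x in T.domain, |deriv φ x|) + T.total * ‖h‖ := by
    rw [integral_domain_congr hpos (g := fun x => |deriv φ x - T.stepFun h x|)
      (fun α x hx => by simp only [deriv_sub_primitive_eq_stepFun hpos hφ h α hx])
      (integrableOn_deriv hpos ha1 hmem).abs]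
    exact (integral_abs_sub_le (integrableOn_deriv hpos ha1 hφ) (integrableOn_stepFun hpos h)).trans
      (add_le_add le_rfl (integral_abs_stepFun_le hpos h))
  rw [normPa_one, normPa_one, normPa_zero, normPa_zero, pa, pa, paSet_sub_primitive hpos hφ h]
  linarith

end FunctionSpaces

section CorrectionCalculus

variable {T : IETData 𝒜 d} {g : ℕ} {lam : ℕ → ℝ} {E : ℤ → Submodule ℝ (𝒜 → ℝ)} {τ : ℝ}
  {D : Frame 𝒜} {C : ℝ} {j : ℤ}

theorem IsCorrection.unique {f : ℝ → ℝ} {x y : 𝒜 → ℝ} (hx : T.IsCorrection E D j f x)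
    (hy : T.IsCorrection E D j f y) : x = y := tendsto_nhds_unique hx hy

theorem FrameBounds.isCorrection_congr (hF : T.FrameBounds g lam E τ D C) (hT : T.Regular)
    {f f' : ℝ → ℝ} (h : ∀ α, EqOn f f' (T.inner α)) {x : 𝒜 → ℝ}
    (hx : T.IsCorrection E D j f x) : T.IsCorrection E D j f' x := by
  have : ∀ k, (T.acc D.n k).mean (T.S D.n 0 k f) =
      (T.acc D.n k).mean (T.S D.n 0 k f') := fun k => by
    rw [hF.S_eq, hF.S_eq]
    exact mean_congr _ ((hT.tower_zero hF k).bsum_congr h)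
  simpa only [IsCorrection, this] using hx

theorem FrameBounds.isCorrection_linear (hF : T.FrameBounds g lam E τ D C) (hT : T.Regular)
    {f f' : ℝ → ℝ} (hf : IntegrableOn f T.domain) (hf' : IntegrableOn f' T.domain)
    {x x' : 𝒜 → ℝ} (hx : T.IsCorrection E D j f x) (hx' : T.IsCorrection E D j f' x') (s t : ℝ) :
    T.IsCorrection E D j (fun y => s * f y + t * f' y) (s • x + t • x') := by
  have : ∀ k, (T.acc D.n k).mean (T.S D.n 0 k fun y => s * f y + t * f' y) =
      s • (T.acc D.n k).mean (T.S D.n 0 k f) + t • (T.acc D.n k).mean (T.S D.n 0 k f') := by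
    intro k
    rw [← mean_linear (hT.acc D.n k).len_pos (hF.integrableOn_S hT hf k)
      (hF.integrableOn_S hT hf' k)]
    congr 1
    funext y
    rw [hF.S_eq, hF.S_eq, hF.S_eq, bsum_linear]
  simp only [IsCorrection, this, map_add, map_smul, Matrix.mulVec_add, Matrix.mulVec_smul]
  exact (hx.const_smul s).add (hx'.const_smul t)

theorem FrameBounds.mean_S_stepFun (hF : T.FrameBounds g lam E τ D C) (hT : T.Regular)
    (h : 𝒜 → ℝ) (k : ℕ) :
    (T.acc D.n k).mean (T.S D.n 0 k (T.stepFun h)) = (T.Q D.n 0 k).mulVec h := by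
  have h1 := hT.tower_zero hF k
  rw [hF.S_eq, mean_congr (g := (T.acc D.n k).stepFun ((T.Q D.n 0 k).mulVec h)) _ fun α x hx =>
    h1.bsum_stepFun h (piece_subset_domain h1.pos' α (inner_subset_piece _ α hx)),
    mean_stepFun h1.pos']

theorem FrameBounds.isCorrection_stepFun (hF : T.FrameBounds g lam E τ D C) (hT : T.Regular)
    (hj : -(g : ℤ) ≤ j) (hj' : j ≤ (g : ℤ) + 1) {h : 𝒜 → ℝ} (hh : h ∈ D.U j) :
    T.IsCorrection E D j (T.stepFun h) h := by
  refine tendsto_const_nhds.congr fun k => ?_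
  rw [hF.mean_S_stepFun hT]
  have : projAlong (T.push D.n k (D.U j)) (T.push D.n k (E j)) ((T.Q D.n 0 k).mulVec h) =
      (T.Q D.n 0 k).mulVec h := by
    have := projAlong_eq (hT.isCompl_push D.n k (hF.compl j hj hj'))
      (mem_push.2 ⟨h, hh, rfl⟩) (zero_mem (T.push D.n k (E j)))
    rwa [add_zero] at this
  rw [this, hT.Q_inv_mulVec]

theorem FrameBounds.isCorrection_sub_stepFun (hF : T.FrameBounds g lam E τ D C) (hT : T.Regular)
    (hj : -(g : ℤ) ≤ j) (hj' : j ≤ (g : ℤ) + 1) {f : ℝ → ℝ} (hf : IntegrableOn f T.domain)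
    {h : 𝒜 → ℝ} (hh : h ∈ D.U j) (hc : T.IsCorrection E D j f h) :
    T.IsCorrection E D j (fun y => f y - T.stepFun h y) 0 := by
  have := hF.isCorrection_linear hT hf (integrableOn_stepFun hT.len_pos h) hc
    (hF.isCorrection_stepFun hT hj hj' hh) 1 (-1)
  simpa [sub_eq_add_neg] using this

open Classical in
/-- The limit defining the correction, when it exists. -/
def corr (T : IETData 𝒜 d) (E : ℤ → Submodule ℝ (𝒜 → ℝ)) (D : Frame 𝒜) (j : ℤ)
    (f : ℝ → ℝ) : 𝒜 → ℝ := if h : ∃ x, T.IsCorrection E D j f x then h.choose else 0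

theorem IsCorrection.corr_eq {f : ℝ → ℝ} {x : 𝒜 → ℝ} (hx : T.IsCorrection E D j f x) :
    T.corr E D j f = x := by
  have h : ∃ x, T.IsCorrection E D j f x := ⟨x, hx⟩
  rw [corr, dif_pos h]
  exact h.choose_spec.unique hx

end CorrectionCalculus

/-- The conditions on the exponents and on `τ` under which the operators are constructed. -/
structure Admissible (g : ℕ) (lam : ℕ → ℝ) (a : ℝ) (i j : ℕ) (τ : ℝ) : Prop where
  pos : 0 < τ
  le_one : τ ≤ 1
  lam_one_pos : 0 < lam 1
  a_nonneg : 0 ≤ a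
  a_lt_one : a < 1
  two_le : 2 ≤ i
  le_succ : i ≤ g + 1
  lam_pred_le : lam (i - 1) ≤ lam 1
  lam_nonneg : 0 ≤ lam i
  one_le : 1 ≤ j
  le : j ≤ g
  lam_succ_nonneg : 0 ≤ lam (j + 1)
  gap_i : 3 * τ * (1 + lam 1) < lam (i - 1) - lam 1 * a
  gap_j : 9 * τ * (1 + lam 1) < lam 1 - lam (j + 1) - max (lam i) (lam 1 * a)

section Estimates

variable {T : IETData 𝒜 d} {g : ℕ} {lam : ℕ → ℝ} {E : ℤ → Submodule ℝ (𝒜 → ℝ)} {a τ : ℝ}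
  {i j : ℕ} {D : Frame 𝒜} {C : ℝ}

theorem FrameBounds.series_bounds (hF : T.FrameBounds g lam E τ D C) (hT : T.Regular)
    (hA : Admissible g lam a i j τ) :
    (∀ k, Summable fun m => T.Kterm D a i τ k (k + m)) ∧
    (∀ k, Summable fun m => T.Vterm D j τ (T.sSeq E D a i τ) k (k + m)) ∧
    (∃ A : ℝ, 0 ≤ A ∧ ∀ k, T.Kseries D a i τ k + T.Cseries E D a i τ k ≤
      A * Real.exp ((max (lam i) (lam 1 * a) + 3 * τ * (1 + lam 1)) * D.rsum 0 k)) ∧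
    (∃ A : ℝ, 0 ≤ A ∧ ∀ k, T.sSeq E D a i τ k ≤
      A * Real.exp ((max (lam i) (lam 1 * a) - lam 1 + 4 * τ * (1 + lam 1)) *
        D.rsum 0 (k + 1))) ∧
    (∃ A : ℝ, 0 ≤ A ∧ ∀ k, T.Vseries D j τ (T.sSeq E D a i τ) k ≤
      A * Real.exp ((max (lam i) (lam 1 * a) - lam 1 + 8 * τ * (1 + lam 1)) * D.rsum 0 k)) ∧
    (∃ A : ℝ, 0 ≤ A ∧ ∀ k, T.Wseries E D j τ (T.sSeq E D a i τ) k ≤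
      A * Real.exp ((max (max (lam i - lam 1) (lam 1 * a - lam 1)) (-lam j) +
        9 * τ * (1 + lam 1)) * D.rsum 0 k)) := by
  have h1 := hA.lam_one_pos.le
  have hK := hF.Kseries_bound hT hA.pos hA.le_one h1 hA.a_nonneg hA.a_lt_one hA.two_le hA.le_succ
    hA.lam_pred_le hA.gap_i
  have hKC := hF.Kseries_add_Cseries_bound hT hA.pos hA.le_one h1 hA.a_nonneg hA.a_lt_one
    hA.two_le hA.le_succ hA.lam_pred_le hA.gap_i
  obtain ⟨A, hA0, hs⟩ := hF.sSeq_bound hT hA.pos hA.le_one h1 hA.a_nonneg hA.a_lt_one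
    hA.two_le hA.le_succ hA.lam_pred_le hA.lam_nonneg hA.gap_i
  have hs0 := fun k => hF.sSeq_nonneg (E := E) hT a i k
  have hM : 0 ≤ max (lam i) (lam 1 * a) := hA.lam_nonneg.trans (le_max_left _ _)
  obtain ⟨hV, hV'⟩ := hF.Vseries_bound hA.pos hA.le_one h1 hA.le hs0 hA0 hM
    hA.lam_succ_nonneg hs hA.gap_j
  have hW := hF.Wseries_bound hA.pos hA.le_one h1 hA.one_le hA.le hs0 hA0 hs
  rw [← max_sub_sub_right] at hW
  exact ⟨hK.1, hV, hKC, ⟨A, hA0, hs⟩, hV', hW⟩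

theorem FrameBounds.Vseries_nonneg (hF : T.FrameBounds g lam E τ D C) (hT : T.Regular) (k : ℕ) :
    0 ≤ T.Vseries D j τ (T.sSeq E D a i τ) k :=
  tsum_nonneg fun _ => T.Vterm_nonneg D j (fun l => hF.sSeq_nonneg hT a i l) τ k _

theorem FrameBounds.Wseries_nonneg (hF : T.FrameBounds g lam E τ D C) (hT : T.Regular) (k : ℕ) :
    0 ≤ T.Wseries E D j τ (T.sSeq E D a i τ) k :=
  Finset.sum_nonneg fun l _ => mul_nonneg (mul_nonneg (mul_nonneg (opNormOn_nonneg _ _)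
    (Real.rpow_nonneg (opNorm_nonneg _) _)) (opNorm_nonneg _)) (hF.sSeq_nonneg hT a i l)

theorem FrameBounds.exists_correction_deriv (hF : T.FrameBounds g lam E τ D C) (hT : T.Regular)
    (hA : Admissible g lam a i j τ) (hi : E i ≠ ⊤) :
    ∃ B : ℝ, 0 ≤ B ∧ ∀ φ ∈ T.CPaG a 1,
      (∃ h ∈ D.U i, T.IsCorrection E D i (deriv φ) h ∧ ‖h‖ ≤ B * T.normPa a 0 (deriv φ)) ∧
      (T.IsCorrection E D i (deriv φ) 0 → ∀ k,
        ∫ x in (T.acc D.n k).domain, |T.S D.n 0 k (deriv φ) x| ≤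
          B * T.normPa a 0 (deriv φ) * T.sSeq E D a i τ k) := by
  obtain ⟨hK, -⟩ := hF.series_bounds hT hA
  have hi2 := hA.two_le
  obtain ⟨B, hB, h⟩ := hF.correction_of_singBound hT hA.pos (by omega : 1 ≤ i) hA.le_succ hi
    hA.a_nonneg hA.a_lt_one hK
  refine ⟨B, hB, fun φ hφ => ?_⟩
  have := h _ _ (singBound_deriv hφ)
  rwa [← normPa_zero] at this

/-- Corrections of functions whose derivative is the derivative of an element of
`C_i^{1+P_aG}`. -/
theorem FrameBounds.exists_correction_neg (hF : T.FrameBounds g lam E τ D C) (hT : T.Regular)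
    (hA : Admissible g lam a i j τ) (hi : E i ≠ ⊤) :
    ∃ B : ℝ, 0 ≤ B ∧ ∀ φ ∈ T.CiPaG E D a i, ∀ χ, T.PieceDeriv χ (deriv φ) →
      (∃ h ∈ D.U (-(j : ℤ)), T.IsCorrection E D (-(j : ℤ)) χ h ∧
        ‖h‖ ≤ B * (‖T.mean χ‖ + T.normPa a 0 (deriv φ))) ∧
      (T.IsCorrection E D (-(j : ℤ)) χ 0 → ∀ k, ‖(T.acc D.n k).mean (T.S D.n 0 k χ)‖ ≤
        B * ((T.Wseries E D j τ (T.sSeq E D a i τ) k + T.Vseries D j τ (T.sSeq E D a i τ) k) *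
          T.normPa a 0 (deriv φ) + T.normQ D.n (E (-(j : ℤ))) 0 k * ‖T.mean χ‖)) := by
  have hC : 0 ≤ C := zero_le_one.trans hF.one_le
  obtain ⟨-, hV, -⟩ := hF.series_bounds hT hA
  obtain ⟨B, hB, h⟩ := hF.exists_correction_deriv hT hA hi
  have hV0 := hF.Vseries_nonneg (E := E) (a := a) (i := i) (j := j) hT 0
  set V₀ := T.Vseries D j τ (T.sSeq E D a i τ) 0 with hV₀
  refine ⟨C * C * (1 + B * V₀ + B), by positivity, fun φ hφ χ hχ => ?_⟩
  have hN := normPa_deriv_nonneg hT.len_pos hφ.1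
  set N := T.normPa a 0 (deriv φ) with hNdef
  have hBN : 0 ≤ B * N := mul_nonneg hB hN
  obtain ⟨⟨x, hx, hc, hle⟩, h2⟩ := hF.correction_of_pieceDeriv hT hA.le hχ
    (integrableOn_deriv hT.len_pos hA.a_lt_one hφ.1)
    (fun k => hF.sSeq_nonneg (E := E) hT a i k) hBN ((h φ hφ.1).2 hφ.2) hV
  have hm := norm_nonneg (T.mean χ)
  refine ⟨⟨x, hx, hc, hle.trans ?_⟩, fun h0 k => (h2 h0 k).trans ?_⟩
  · rw [mul_assoc (C * C)]
    refine mul_le_mul_of_nonneg_left ?_ (by positivity)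
    have : 0 ≤ (B * V₀ + B) * ‖T.mean χ‖ + (1 + B) * N := by positivity
    linarith
  · rw [mul_assoc (C * C)]
    refine mul_le_mul_of_nonneg_left ?_ (by positivity)
    have e1 := hF.Vseries_nonneg (E := E) (a := a) (i := i) (j := j) hT k
    have e2 := hF.Wseries_nonneg (E := E) (a := a) (i := i) (j := j) hT k
    have e3 : 0 ≤ T.normQ D.n (E (-(j : ℤ))) 0 k := opNormOn_nonneg _ _
    set X := T.Wseries E D j τ (T.sSeq E D a i τ) k + T.Vseries D j τ (T.sSeq E D a i τ) k
    have e4 : 0 ≤ X := add_nonneg e2 e1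
    have : 0 ≤ (1 + B * V₀) * (X * N) +
      (B * V₀ + B) * (T.normQ D.n (E (-(j : ℤ))) 0 k * ‖T.mean χ‖) := by positivity
    linarith

theorem FrameBounds.exists_hstar (hF : T.FrameBounds g lam E τ D C) (hT : T.Regular)
    (hA : Admissible g lam a i j τ) (hi : E i ≠ ⊤) :
    ∃ B : ℝ, 0 ≤ B ∧ ∀ φ ∈ T.CiPaG E D a i, T.corr E D (-(j : ℤ)) φ ∈ D.U (-(j : ℤ)) ∧
      T.IsCorrection E D (-(j : ℤ)) φ (T.corr E D (-(j : ℤ)) φ) ∧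
      ‖T.corr E D (-(j : ℤ)) φ‖ ≤ B * T.normPa a 1 φ := by
  obtain ⟨B, hB, h⟩ := hF.exists_correction_neg hT hA hi
  have hC : 0 ≤ C := zero_le_one.trans hF.one_le
  have hpos := hT.len_pos
  have ht := IETData.total_pos hpos
  refine ⟨B * (C / T.total + 1), by positivity, fun φ hφ => ?_⟩
  obtain ⟨x, hx, hc, hle⟩ := (h φ hφ φ (pieceDeriv_deriv hφ.1)).1
  rw [hc.corr_eq]
  refine ⟨hx, hc, hle.trans ?_⟩
  rw [mul_assoc]
  refine mul_le_mul_of_nonneg_left ?_ hB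
  have hbal := hF.balanced 0
  rw [hF.acc_zero] at hbal
  have h1 := norm_mean_le hpos hbal (integrableOn_of_mem hpos hA.a_lt_one hφ.1)
  have hN := normPa_deriv_nonneg hpos hφ.1
  have h2 : 0 ≤ ∫ x in T.domain, |φ x| := integral_nonneg fun _ => abs_nonneg _
  have h3 : 0 ≤ C / T.total * T.normPa a 0 (deriv φ) := by positivity
  rw [normPa_one]
  linarith

theorem FrameBounds.linearOn_corr (hF : T.FrameBounds g lam E τ D C) (hT : T.Regular)
    (ha1 : a < 1) {V : Set (ℝ → ℝ)} (hV : V ⊆ T.CPaG a 1) {l : ℤ}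
    (h : ∀ φ ∈ V, T.IsCorrection E D l φ (T.corr E D l φ)) : LinearOn V (T.corr E D l) :=
  fun s t φ ψ hφ hψ _ => (hF.isCorrection_linear hT (integrableOn_of_mem hT.len_pos ha1 (hV hφ))
    (integrableOn_of_mem hT.len_pos ha1 (hV hψ)) (h φ hφ) (h ψ hψ) s t).corr_eq

/-- The bounds for elements of `C_i^{1+P_aG}` with vanishing correction. -/
theorem FrameBounds.exists_estimates (hF : T.FrameBounds g lam E τ D C) (hT : T.Regular)
    (hA : Admissible g lam a i j τ) (hi : E i ≠ ⊤) :
    ∃ B : ℝ, 1 ≤ B ∧ ∀ φ ∈ T.CiPaG E D a i, T.IsCorrection E D (-(j : ℤ)) φ 0 → ∀ k : ℕ,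
      (T.acc D.n k).Var (T.S D.n 0 k φ) ≤
        ENNReal.ofReal (B * T.sSeq E D a i τ k * T.normPa a 0 (deriv φ)) ∧
      ‖(T.acc D.n k).mean (T.S D.n 0 k φ)‖ ≤
        B * ((T.Wseries E D j τ (T.sSeq E D a i τ) k +
              T.Vseries D j τ (T.sSeq E D a i τ) k) * T.normPa a 0 (deriv φ) +
            T.normQ D.n (E (-(j : ℤ))) 0 k * T.supNorm φ) := by
  obtain ⟨B₁, hB₁, h₁⟩ := hF.exists_correction_deriv hT hA hi
  obtain ⟨B₂, hB₂, h₂⟩ := hF.exists_correction_neg hT hA hi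
  have hpos := hT.len_pos
  refine ⟨B₁ + B₂ + 1, by linarith, fun φ hφ h0 k => ⟨?_, ?_⟩⟩
  · refine (hF.var_S_le hT (pieceDeriv_deriv hφ.1)
      (integrableOn_deriv hpos hA.a_lt_one hφ.1) k).trans (ENNReal.ofReal_le_ofReal ?_)
    refine ((h₁ φ hφ.1).2 hφ.2 k).trans ?_
    have h3 := mul_nonneg (hF.sSeq_nonneg (E := E) hT a i k) (normPa_deriv_nonneg hpos hφ.1)
    have h4 : 0 ≤ (B₂ + 1) * (T.sSeq E D a i τ k * T.normPa a 0 (deriv φ)) := by positivity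
    linarith
  · refine ((h₂ φ hφ φ (pieceDeriv_deriv hφ.1)).2 h0 k).trans ?_
    have hN := normPa_deriv_nonneg hpos hφ.1
    have hV := hF.Vseries_nonneg (E := E) (a := a) (i := i) (j := j) hT k
    have hW := hF.Wseries_nonneg (E := E) (a := a) (i := i) (j := j) hT k
    have hQ : 0 ≤ T.normQ D.n (E (-(j : ℤ))) 0 k := opNormOn_nonneg _ _
    have hs := norm_mean_le_supNorm hpos hA.a_lt_one hφ.1
    have hs0 := (norm_nonneg _).trans hs
    refine mul_le_mul (by linarith) (add_le_add le_rfl (mul_le_mul_of_nonneg_left hs hQ))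
      (by positivity) (by linarith)

end Estimates

section TwoFrames

variable {T : IETData 𝒜 d} {g : ℕ} {lam : ℕ → ℝ} {E : ℤ → Submodule ℝ (𝒜 → ℝ)} {τ τ' : ℝ}
  {D D' : Frame 𝒜} {C C' : ℝ}

theorem Regular.tower_of_le (hT : T.Regular) {n n' : ℕ → ℕ} {k l : ℕ} (h : n k ≤ n' l) :
    Tower (T.acc n k) (T.acc n' l) ((T.acc n k).cocycle (n' l - n k)).transpose := by
  have := (hT.acc n k).tower (n' l - n k)
  rwa [IETData.acc, ← Function.iterate_add_apply, Nat.sub_add_cancel h] at this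

theorem FrameBounds.Qnat_zero (hF : T.FrameBounds g lam E τ D C) (k : ℕ) :
    T.Qnat D.n 0 k = (T.cocycle (D.n k)).transpose := by
  rw [Qnat, hF.acc_zero, hF.n_zero, Nat.sub_zero]

theorem FrameBounds.S_comp (hF : T.FrameBounds g lam E τ D C)
    (hF' : T.FrameBounds g lam E τ' D' C') (hT : T.Regular) {k l : ℕ} (h : D.n k ≤ D'.n l)
    (f : ℝ → ℝ) {x : ℝ} (hx : x ∈ (T.acc D'.n l).domain) :
    T.S D'.n 0 l f x = bsum (T.acc D.n k) (T.acc D'.n l)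
      ((T.acc D.n k).cocycle (D'.n l - D.n k)).transpose (T.S D.n 0 k f) x := by
  have h1 := hT.tower_zero hF k
  have h2 := hT.tower_of_le h
  have h3 := hT.tower_zero hF' l
  have hmul : T.Qnat D'.n 0 l =
      ((T.acc D.n k).cocycle (D'.n l - D.n k)).transpose * T.Qnat D.n 0 k := by
    rw [hF'.Qnat_zero, hF.Qnat_zero, ← Matrix.transpose_mul, IETData.acc, ← cocycle_add,
      Nat.add_sub_cancel' h]
  rw [hF.S_eq, hF'.S_eq]
  rw [hmul] at h3 ⊢
  exact h1.bsum_comp h2 h3 f hx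

theorem FrameBounds.integral_abs_S_le (hF : T.FrameBounds g lam E τ D C)
    (hF' : T.FrameBounds g lam E τ' D' C') (hT : T.Regular) {k l : ℕ} (h : D.n k ≤ D'.n l)
    {f : ℝ → ℝ} (hf : IntegrableOn f T.domain) :
    ∫ x in (T.acc D'.n l).domain, |T.S D'.n 0 l f x| ≤
      ∫ x in (T.acc D.n k).domain, |T.S D.n 0 k f x| := by
  have h2 := hT.tower_of_le h
  refine le_trans (le_of_eq (setIntegral_congr_fun measurableSet_Ico fun x hx => ?_))
    (h2.integral_abs_bsum_le (hF.integrableOn_S hT hf k))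
  simp only [hF.S_comp hF' hT h f hx]

theorem FrameBounds.total_le_opNorm_mul_total (hF : T.FrameBounds g lam E τ D C)
    (hT : T.Regular) {k l : ℕ} (h : D'.n l ≤ D.n (k + 1)) :
    (T.acc D.n k).total ≤ opNorm (T.Z D.n (k + 1)) * (T.acc D'.n l).total :=
  (hF.tower hT (Nat.le_add_right k 1)).total_le_opNorm_mul.trans
    (mul_le_mul_of_nonneg_left (hT.tower_of_le h).total_le (opNorm_nonneg _))

/-- Comparison of the indices of two frames. -/
theorem FrameBounds.exists_index_le (hF : T.FrameBounds g lam E τ D C)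
    (hF' : T.FrameBounds g lam E τ' D' C') (hT : T.Regular) (h1 : 0 < lam 1) :
    ∃ c : ℝ, ∀ k l : ℕ, D.n k ≤ D'.n l → (k : ℝ) ≤ (1 + τ') * l + c := by
  have hC : 0 < C := zero_lt_one.trans_le hF.one_le
  have hC' : 0 < C' := zero_lt_one.trans_le hF'.one_le
  refine ⟨Real.log (C * C * C') / lam 1, fun k l h => ?_⟩
  have ht := IETData.total_pos hT.len_pos
  have e1 := hF.total_bound hT k
  have e2 := (hT.tower_zero hF' l).total_le_opNorm_mul
  change T.total ≤ opNorm (T.Q D'.n 0 l) * _ at e2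
  have e3 := (hT.tower_of_le h).total_le
  have e4 := hF'.opNorm_le l
  have e5 : T.total ≤ T.total * ((C * C * C') *
      (Real.exp (lam 1 * (1 + τ') * l) * Real.exp (-lam 1 * k))) := by
    calc T.total ≤ opNorm (T.Q D'.n 0 l) * (T.acc D'.n l).total := e2
      _ ≤ (C' * Real.exp (lam 1 * (1 + τ') * l)) * (C * C * T.total * Real.exp (-lam 1 * k)) :=
        mul_le_mul e4 (e3.trans e1) (FrameBounds.total_pos hT D'.n l).le (by positivity)
      _ = _ := by ring
  have e6 := le_of_mul_le_mul_left ((mul_one T.total).le.trans e5) ht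
  rw [← Real.exp_add] at e6
  have e7 := Real.log_le_log one_pos e6
  rw [Real.log_one, Real.log_mul (by positivity) (Real.exp_pos _).ne', Real.log_exp] at e7
  have e8 : lam 1 * k ≤ lam 1 * ((1 + τ') * l + Real.log (C * C * C') / lam 1) := by
    rw [mul_add, mul_div_cancel₀ _ h1.ne']
    linarith
  exact le_of_mul_le_mul_left e8 h1

theorem FrameBounds.exists_rsum_le_index (hF : T.FrameBounds g lam E τ D C)
    (hF' : T.FrameBounds g lam E τ' D' C') (hT : T.Regular) (h1 : 0 < lam 1) (hτ : 0 < τ) :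
    ∃ c : ℝ, 0 ≤ c ∧ ∀ k l : ℕ, D.n k ≤ D'.n l → D.rsum 0 k ≤ (1 + τ) * (1 + τ') * l + c := by
  obtain ⟨c, hc⟩ := hF.exists_index_le hF' hT h1
  refine ⟨|(1 + τ) * c + C|, abs_nonneg _, fun k l h => ?_⟩
  have e1 := hF.rsum_le k
  have e2 := mul_le_mul_of_nonneg_left (hc k l h) (by linarith : 0 ≤ 1 + τ)
  have e3 := le_abs_self ((1 + τ) * c + C)
  linarith

theorem FrameBounds.exists_between (hF : T.FrameBounds g lam E τ D C) (N : ℕ) :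
    ∃ m, D.n m ≤ N ∧ N < D.n (m + 1) := by
  have h : ∃ m, N < D.n m := ⟨N + 1, hF.strictMono.le_apply⟩
  classical
  have h0 : Nat.find h ≠ 0 := fun h0 => by
    have := Nat.find_spec h
    rw [h0, hF.n_zero] at this
    omega
  obtain ⟨m, hm⟩ := Nat.exists_eq_succ_of_ne_zero h0
  refine ⟨m, ?_, ?_⟩
  · exact not_lt.1 (Nat.find_min h (by omega))
  · have := Nat.find_spec h
    rwa [hm] at this

theorem FrameBounds.tendsto_rsum (hF : T.FrameBounds g lam E τ D C) :
    Tendsto (D.rsum 0) atTop atTop := by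
  refine tendsto_atTop_mono (fun k => sub_le_iff_le_add.2 (hF.le_rsum k)) ?_
  exact tendsto_atTop_add_const_right _ (-C) tendsto_natCast_atTop_atTop

theorem FrameBounds.tendsto_exp_rsum (hF : T.FrameBounds g lam E τ D C) {x : ℝ} (hx : x < 0) :
    Tendsto (fun k => Real.exp (x * D.rsum 0 k)) atTop (𝓝 0) :=
  Real.tendsto_exp_atBot.comp (hF.tendsto_rsum.const_mul_atTop_of_neg hx)

/-- Vectors of `U` whose images grow slower than the cocycle expands on `U` vanish. -/
theorem Regular.eq_zero_of_tendsto (hT : T.Regular) {n : ℕ → ℕ}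
    {U : Submodule ℝ (𝒜 → ℝ)} {h : 𝒜 → ℝ} (hh : h ∈ U) {b : ℕ → ℝ}
    (hb : ∀ k, T.normQInv n U 0 k * ‖(T.Q n 0 k).mulVec h‖ ≤ b k)
    (hlim : Tendsto b atTop (𝓝 0)) : h = 0 := by
  have hle : ∀ k, ‖h‖ ≤ b k := fun k => by
    have h1 := norm_mulVec_le_opNormOn (T.Q n 0 k)⁻¹
      (mem_push.2 ⟨h, hh, rfl⟩ : (T.Q n 0 k).mulVec h ∈ T.push n k U)
    rw [hT.Q_inv_mulVec] at h1
    exact h1.trans (hb k)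
  exact norm_le_zero_iff.1 (ge_of_tendsto' hlim hle)

end TwoFrames

section Transfer

variable {T : IETData 𝒜 d} {g : ℕ} {lam : ℕ → ℝ} {E : ℤ → Submodule ℝ (𝒜 → ℝ)} {a τ τ' : ℝ}
  {i j : ℕ} {D D' : Frame 𝒜} {C C' : ℝ}

theorem Frame.rsum_self (D : Frame 𝒜) : D.rsum 0 0 = 0 := by simp [Frame.rsum]

theorem FrameBounds.exists_Z_le (hF : T.FrameBounds g lam E τ D C) (hτ : 0 < τ) :
    ∃ A : ℝ, 0 ≤ A ∧ ∀ k, opNorm (T.Z D.n (k + 1)) ≤ A * Real.exp (τ * D.rsum 0 k) := by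
  have hC : 0 ≤ C := zero_le_one.trans hF.one_le
  refine ⟨C * Real.exp (τ * C), by positivity, fun k => (hF.opNorm_Z k).trans ?_⟩
  rw [mul_assoc]
  exact mul_le_mul_of_nonneg_left (hF.exp_le hτ.le k) hC

theorem FrameBounds.mulVec_eq_mean_sub (hF : T.FrameBounds g lam E τ D C) (hT : T.Regular)
    {f χ : ℝ → ℝ} (hf : IntegrableOn f T.domain) {h : 𝒜 → ℝ}
    (hχ : ∀ α, EqOn χ (fun x => f x - T.stepFun h x) (T.inner α)) (k : ℕ) :
    (T.Q D.n 0 k).mulVec h = (T.acc D.n k).mean (T.S D.n 0 k f) -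
      (T.acc D.n k).mean (T.S D.n 0 k χ) := by
  have hs := integrableOn_stepFun hT.len_pos h
  have e1 : (T.acc D.n k).mean (T.S D.n 0 k χ) =
      (T.acc D.n k).mean (fun x => T.S D.n 0 k f x - T.S D.n 0 k (T.stepFun h) x) := by
    rw [hF.S_eq, hF.S_eq, hF.S_eq]
    refine mean_congr _ fun α x hx => ?_
    rw [(hT.tower_zero hF k).bsum_congr hχ α hx, bsum_sub]
  rw [e1, mean_sub (hT.acc D.n k).len_pos (hF.integrableOn_S hT hf k)
    (hF.integrableOn_S hT hs k), hF.mean_S_stepFun hT, sub_sub_cancel]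

/-- Vanishing of `𝔥_i` does not depend on the frame. -/
theorem FrameBounds.isCorrection_transfer (hF : T.FrameBounds g lam E τ D C)
    (hF' : T.FrameBounds g lam E τ' D' C') (hT : T.Regular) (hA : Admissible g lam a i j τ)
    (hA' : Admissible g lam a i j τ') (hi : E i ≠ ⊤)
    (h1 : (max (lam i) (lam 1 * a) + 4 * τ * (1 + lam 1)) * ((1 + τ) * (1 + τ')) + τ' <
      lam (i - 1))
    (h2 : max (lam i) (lam 1 * a) + 3 * τ' * (1 + lam 1) + τ' < lam (i - 1))
    {φ : ℝ → ℝ} (hφ : φ ∈ T.CPaG a 1) (h0 : T.IsCorrection E D i (deriv φ) 0) :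
    T.IsCorrection E D' i (deriv φ) 0 := by
  have hC' : 0 ≤ C' := zero_le_one.trans hF'.one_le
  have hpos := hT.len_pos
  have hτ := hA.pos
  have hτ' := hA'.pos
  have hl := hA.lam_one_pos
  have hi2 := hA.two_le
  obtain ⟨B, hB, hest⟩ := hF.exists_correction_deriv hT hA hi
  obtain ⟨B', hB', hest'⟩ := hF'.exists_correction_deriv hT hA' hi
  obtain ⟨-, -, ⟨A, hA0, hX⟩, -⟩ := hF.series_bounds hT hA
  obtain ⟨-, -, ⟨A', hA0', hX'⟩, -⟩ := hF'.series_bounds hT hA'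
  obtain ⟨Y, hY, hZ⟩ := hF.exists_Z_le hτ
  obtain ⟨c, hc, hR⟩ := hF.exists_rsum_le_index hF' hT hl hτ
  obtain ⟨h, hh, hcor, -⟩ := (hest' φ hφ).1
  set χ : ℝ → ℝ := fun x => φ x - T.primitive h x with hχ
  have hχm : χ ∈ T.CPaG a 1 := sub_primitive_mem hpos hφ h
  have hdχ : ∀ α, EqOn (deriv χ) (fun x => deriv φ x - T.stepFun h x) (T.inner α) := fun α =>
    deriv_sub_primitive_eq_stepFun hpos hφ h α
  have hint := integrableOn_deriv hpos hA.a_lt_one hφ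
  have hintχ := integrableOn_deriv hpos hA.a_lt_one hχm
  have hχ0 : T.IsCorrection E D' i (deriv χ) 0 :=
    hF'.isCorrection_congr hT (fun α => (hdχ α).symm)
      (hF'.isCorrection_sub_stepFun hT (by omega) (by exact_mod_cast hA.le_succ) hint hh hcor)
  have hbχ := (hest' χ hχm).2 hχ0
  have hbφ := (hest φ hφ).2 h0
  have hN := normPa_deriv_nonneg hpos hφ
  have hN' := normPa_deriv_nonneg hpos hχm
  set N := T.normPa a 0 (deriv φ)
  set N' := T.normPa a 0 (deriv χ)
  set M := max (lam i) (lam 1 * a) with hM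
  have hM0 : 0 ≤ M := hA.lam_nonneg.trans (le_max_left _ _)
  set p := (1 + τ) * (1 + τ') with hp
  have hp0 : 0 ≤ p := by positivity
  set y := M + 4 * τ * (1 + lam 1) with hy
  have hy0 : 0 ≤ y := by positivity
  set G := Real.exp (y * (p * C' + c)) with hG
  suffices h = 0 by rwa [this] at hcor
  refine hT.eq_zero_of_tendsto (n := D'.n) hh (b := fun k =>
    C' * C' * (B * N * A * Y * G) * Real.exp ((y * p + τ' - lam (i - 1)) * D'.rsum 0 k) +
    C' * C' * (B' * N' * A') * Real.exp ((M + 3 * τ' * (1 + lam 1) + τ' - lam (i - 1)) *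
      D'.rsum 0 k)) (fun k => ?_) ?_
  · obtain ⟨m, hm, hm'⟩ := hF.exists_between (D'.n k)
    have htk := FrameBounds.total_pos hT D'.n k
    have e1 : ∫ x in (T.acc D'.n k).domain, |T.S D'.n 0 k (deriv φ) x| ≤
        (T.acc D'.n k).total * (B * N * A * Y * Real.exp (y * D.rsum 0 m)) := by
      have hEE : Real.exp (τ * D.rsum 0 m) *
          Real.exp ((M + 3 * τ * (1 + lam 1)) * D.rsum 0 m) ≤ Real.exp (y * D.rsum 0 m) := by
        rw [← Real.exp_add, ← add_mul]
        refine exp_mul_le_exp_mul ?_ (hF.rsum_nonneg m)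
        have : 0 ≤ τ * lam 1 := by positivity
        rw [hy]; linarith
      calc ∫ x in (T.acc D'.n k).domain, |T.S D'.n 0 k (deriv φ) x|
          ≤ B * N * T.sSeq E D a i τ m := (hF.integral_abs_S_le hF' hT hm hint).trans (hbφ m)
        _ ≤ B * N * (Y * Real.exp (τ * D.rsum 0 m) * (T.acc D'.n k).total *
              (A * Real.exp ((M + 3 * τ * (1 + lam 1)) * D.rsum 0 m))) := by
            refine mul_le_mul_of_nonneg_left ?_ (by positivity)
            refine mul_le_mul ((hF.total_le_opNorm_mul_total hT hm'.le).trans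
              (mul_le_mul_of_nonneg_right (hZ m) htk.le)) (hX m)
              (add_nonneg (hF.Kseries_nonneg hT a i m) (hF.Cseries_nonneg hT a i m))
              (by positivity)
        _ = B * N * A * Y * (T.acc D'.n k).total * (Real.exp (τ * D.rsum 0 m) *
              Real.exp ((M + 3 * τ * (1 + lam 1)) * D.rsum 0 m)) := by ring
        _ ≤ B * N * A * Y * (T.acc D'.n k).total * Real.exp (y * D.rsum 0 m) :=
            mul_le_mul_of_nonneg_left hEE (by positivity)
        _ = _ := by ring
    have e2 : Real.exp (y * D.rsum 0 m) ≤ G * Real.exp (y * p * D'.rsum 0 k) := by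
      rw [hG, ← Real.exp_add, Real.exp_le_exp]
      have e3 := hR m k hm
      have e4 := mul_le_mul_of_nonneg_left (hF'.le_rsum k) hp0
      have e5 : D.rsum 0 m ≤ p * D'.rsum 0 k + (p * C' + c) := by linarith
      have e6 := mul_le_mul_of_nonneg_left e5 hy0
      linarith
    have e3 : ∫ x in (T.acc D'.n k).domain, |T.S D'.n 0 k (deriv χ) x| ≤
        (T.acc D'.n k).total * (B' * N' * A' *
          Real.exp ((M + 3 * τ' * (1 + lam 1)) * D'.rsum 0 k)) := by
      calc _ ≤ B' * N' * ((T.acc D'.n k).total *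
            (A' * Real.exp ((M + 3 * τ' * (1 + lam 1)) * D'.rsum 0 k))) :=
          (hbχ k).trans (mul_le_mul_of_nonneg_left
            (mul_le_mul_of_nonneg_left (hX' k) htk.le) (by positivity))
        _ = _ := by ring
    have hposk := (hT.acc D'.n k).len_pos
    have e4 := norm_mean_le hposk (hF'.balanced k) (hF'.integrableOn_S hT hint k)
    have e5 := norm_mean_le hposk (hF'.balanced k) (hF'.integrableOn_S hT hintχ k)
    have e6 : ‖(T.Q D'.n 0 k).mulVec h‖ ≤
        C' * (B * N * A * Y * (G * Real.exp (y * p * D'.rsum 0 k))) +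
        C' * (B' * N' * A' * Real.exp ((M + 3 * τ' * (1 + lam 1)) * D'.rsum 0 k)) := by
      rw [hF'.mulVec_eq_mean_sub hT hint hdχ k]
      refine (norm_sub_le _ _).trans (add_le_add (e4.trans ?_) (e5.trans ?_))
      · rw [div_mul_eq_mul_div, div_le_iff₀ htk]
        refine (mul_le_mul_of_nonneg_left (e1.trans (mul_le_mul_of_nonneg_left
          (mul_le_mul_of_nonneg_left e2 (by positivity)) htk.le)) hC').trans (le_of_eq (by ring))
      · rw [div_mul_eq_mul_div, div_le_iff₀ htk]
        exact (mul_le_mul_of_nonneg_left e3 hC').trans (le_of_eq (by ring))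
    have e7 := hF'.normQInv_pos 0 k (Nat.zero_le k) i hi2 hA.le_succ
    rw [D'.rsum_self, sub_zero] at e7
    refine (mul_le_mul e7 e6 (norm_nonneg _) (by positivity)).trans (le_of_eq ?_)
    have x1 : Real.exp ((y * p + τ' - lam (i - 1)) * D'.rsum 0 k) =
        Real.exp ((-lam (i - 1) + τ') * D'.rsum 0 k) * Real.exp (y * p * D'.rsum 0 k) := by
      rw [← Real.exp_add]; ring_nf
    have x2 : Real.exp ((M + 3 * τ' * (1 + lam 1) + τ' - lam (i - 1)) * D'.rsum 0 k) =
        Real.exp ((-lam (i - 1) + τ') * D'.rsum 0 k) *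
          Real.exp ((M + 3 * τ' * (1 + lam 1)) * D'.rsum 0 k) := by
      rw [← Real.exp_add]; ring_nf
    rw [x1, x2]
    ring
  · have t1 := (hF'.tendsto_exp_rsum (x := y * p + τ' - lam (i - 1)) (by linarith)).const_mul
      (C' * C' * (B * N * A * Y * G))
    have t2 := (hF'.tendsto_exp_rsum (x := M + 3 * τ' * (1 + lam 1) + τ' - lam (i - 1))
      (by linarith)).const_mul (C' * C' * (B' * N' * A'))
    simpa using t1.add t2

theorem FrameBounds.exists_mean_bound (hF : T.FrameBounds g lam E τ D C) (hT : T.Regular)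
    (hA : Admissible g lam a i j τ) (hi : E i ≠ ⊤) :
    ∃ B : ℝ, 0 ≤ B ∧ ∀ φ ∈ T.CiPaG E D a i, ∀ χ, T.PieceDeriv χ (deriv φ) →
      T.IsCorrection E D (-(j : ℤ)) χ 0 → ∀ k, ‖(T.acc D.n k).mean (T.S D.n 0 k χ)‖ ≤
        B * Real.exp ((max (max (lam i - lam 1) (lam 1 * a - lam 1)) (-lam j) +
          9 * τ * (1 + lam 1)) * D.rsum 0 k) * (‖T.mean χ‖ + T.normPa a 0 (deriv φ)) := by
  have hC : 0 ≤ C := zero_le_one.trans hF.one_le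
  have hτ := hA.pos
  have hl := hA.lam_one_pos
  obtain ⟨B, hB, hest⟩ := hF.exists_correction_neg hT hA hi
  obtain ⟨-, -, -, -, ⟨A₁, hA₁, hV⟩, A₂, hA₂, hW⟩ := hF.series_bounds hT hA
  refine ⟨B * (A₂ + A₁ + C), by positivity, fun φ hφ χ hχ h0 k =>
    ((hest φ hφ χ hχ).2 h0 k).trans ?_⟩
  have hN := normPa_deriv_nonneg hT.len_pos hφ.1
  set N := T.normPa a 0 (deriv φ)
  have hR := hF.rsum_nonneg k
  have hτl : 0 ≤ τ * lam 1 := by positivity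
  rw [max_sub_sub_right]
  rw [max_sub_sub_right] at hW
  have e1 := le_max_left (max (lam i) (lam 1 * a) - lam 1) (-lam j)
  have e2 := le_max_right (max (lam i) (lam 1 * a) - lam 1) (-lam j)
  set X := max (max (lam i) (lam 1 * a) - lam 1) (-lam j)
  set Ex := Real.exp ((X + 9 * τ * (1 + lam 1)) * D.rsum 0 k) with hEx
  have hEx0 : 0 ≤ Ex := (Real.exp_pos _).le
  have e3 := (hV k).trans (mul_le_mul_of_nonneg_left
    (exp_mul_le_exp_mul (by linarith : _ ≤ X + 9 * τ * (1 + lam 1)) hR) hA₁)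
  have e4 := hF.normQ_neg 0 k (Nat.zero_le k) j hA.one_le hA.le
  rw [D.rsum_self, sub_zero] at e4
  have e5 := e4.trans (mul_le_mul_of_nonneg_left
    (exp_mul_le_exp_mul (by linarith : _ ≤ X + 9 * τ * (1 + lam 1)) hR) hC)
  rw [← hEx] at e3 e5
  rw [mul_assoc B, mul_assoc B]
  refine mul_le_mul_of_nonneg_left ?_ hB
  have hm := norm_nonneg (T.mean χ)
  have f1 := mul_le_mul_of_nonneg_right (add_le_add (hW k) e3) hN
  have f2 := mul_le_mul_of_nonneg_right e5 hm
  have f3 : 0 ≤ (A₂ + A₁) * Ex * ‖T.mean χ‖ + C * Ex * N := by positivity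
  linarith

theorem FrameBounds.exists_sup_bound (hF : T.FrameBounds g lam E τ D C) (hT : T.Regular)
    (hA : Admissible g lam a i j τ) (hi : E i ≠ ⊤) :
    ∃ B : ℝ, 0 ≤ B ∧ ∀ φ ∈ T.CiPaG E D a i, T.IsCorrection E D (-(j : ℤ)) φ 0 →
      ∀ k α, ∀ x ∈ (T.acc D.n k).inner α, |T.S D.n 0 k φ x| ≤
        B * Real.exp ((max (max (lam i - lam 1) (lam 1 * a - lam 1)) (-lam j) +
          9 * τ * (1 + lam 1)) * D.rsum 0 k) * T.normPa a 1 φ := by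
  have hC : 0 ≤ C := zero_le_one.trans hF.one_le
  have hτ := hA.pos
  have hl := hA.lam_one_pos
  have hpos := hT.len_pos
  have ht := IETData.total_pos hpos
  obtain ⟨B₁, hB₁, h₁⟩ := hF.exists_mean_bound hT hA hi
  obtain ⟨B₂, hB₂, h₂⟩ := hF.exists_correction_deriv hT hA hi
  obtain ⟨-, -, -, ⟨A, hA0, hs⟩, -⟩ := hF.series_bounds hT hA
  refine ⟨B₁ * (C / T.total + 1) + B₂ * A, by positivity, fun φ hφ h0 k α x hx => ?_⟩
  have e1 := h₁ φ hφ φ (pieceDeriv_deriv hφ.1) h0 k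
  have e2 := (h₂ φ hφ.1).2 hφ.2 k
  have hint := integrableOn_deriv hpos hA.a_lt_one hφ.1
  have h3 := hT.tower_zero hF k
  have hpd := h3.pieceDeriv (pieceDeriv_deriv hφ.1)
  rw [← hF.S_eq, ← hF.S_eq] at hpd
  have e3 := abs_le_norm_mean_add hpd h3.pos' (hF.integrableOn_S hT hint k) hx
  have hN := normPa_deriv_nonneg hpos hφ.1
  have hI : 0 ≤ ∫ x in T.domain, |φ x| := integral_nonneg fun _ => abs_nonneg _
  have hbal := hF.balanced 0
  rw [hF.acc_zero] at hbal
  have e4 := norm_mean_le hpos hbal (integrableOn_of_mem hpos hA.a_lt_one hφ.1)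
  have hR := hF.rsum_nonneg k
  have hτl : 0 ≤ τ * lam 1 := by positivity
  have hgap := hA.gap_j
  have hlj := hA.lam_succ_nonneg
  rw [max_sub_sub_right] at e1 ⊢
  have e5 := le_max_left (max (lam i) (lam 1 * a) - lam 1) (-lam j)
  set X := max (max (lam i) (lam 1 * a) - lam 1) (-lam j)
  set Ex := Real.exp ((X + 9 * τ * (1 + lam 1)) * D.rsum 0 k) with hEx
  have hEx0 : 0 ≤ Ex := (Real.exp_pos _).le
  have e6 : T.sSeq E D a i τ k ≤ A * Ex := by
    refine (hs k).trans (mul_le_mul_of_nonneg_left ?_ hA0)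
    refine (Real.exp_le_exp.2 (mul_le_mul_of_nonpos_left (hF.rsum_mono (Nat.le_succ k)) ?_)).trans
      (exp_mul_le_exp_mul (by linarith) hR)
    linarith
  rw [normPa_one]
  set N := T.normPa a 0 (deriv φ)
  set I := ∫ x in T.domain, |φ x|
  have f1 : ‖T.mean φ‖ + N ≤ (C / T.total + 1) * (I + N) := by
    have : 0 ≤ C / T.total * N + I := by positivity
    linarith
  have f2 := mul_le_mul_of_nonneg_left f1 (mul_nonneg hB₁ hEx0)
  have f3 := mul_le_mul_of_nonneg_left e6 (mul_nonneg hB₂ hN)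
  have f4 : 0 ≤ B₂ * A * Ex * I := by positivity
  linarith

theorem integral_abs_le_of_inner {T : IETData 𝒜 d} (hpos : ∀ α, 0 < T.len α) {f : ℝ → ℝ}
    (hf : IntegrableOn f T.domain) {K : ℝ} (hK : ∀ α, ∀ x ∈ T.inner α, |f x| ≤ K) :
    ∫ x in T.domain, |f x| ≤ T.total * K := by
  rw [integral_domain_eq_sum hpos hf.abs, total, Finset.sum_mul]
  refine Finset.sum_le_sum fun α _ => ?_
  rw [← integral_piece_const hpos, integral_piece_eq_inner, integral_piece_eq_inner]
  refine setIntegral_mono_on ?_ ?_ (T.measurableSet_inner α) (hK α)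
  · rw [← integrableOn_piece_iff_inner]
    exact ((integrableOn_domain_iff hpos).1 hf α).abs
  · exact integrableOn_const (by rw [inner, Real.volume_Ioo]; exact ENNReal.ofReal_ne_top)

theorem PieceDeriv.sub_stepFun {T : IETData 𝒜 d} (hpos : ∀ α, 0 < T.len α) {φ ψ : ℝ → ℝ}
    (hφ : T.PieceDeriv φ ψ) (h : 𝒜 → ℝ) : T.PieceDeriv (fun x => φ x - T.stepFun h x) ψ := by
  refine fun α => ⟨(hφ α).1, fun x hx => ?_⟩
  refine (((hφ α).2 x hx).sub_const (h α)).congr_of_eventuallyEq ?_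
  filter_upwards [(T.isOpen_inner α).mem_nhds hx] with y hy
  rw [stepFun_apply hpos h (T.inner_subset_piece α hy)]

/-- Vanishing of `𝔥*_j` does not depend on the frame. -/
theorem FrameBounds.isCorrection_neg_transfer (hF : T.FrameBounds g lam E τ D C)
    (hF' : T.FrameBounds g lam E τ' D' C') (hT : T.Regular) (hA : Admissible g lam a i j τ)
    (hA' : Admissible g lam a i j τ') (hi : E i ≠ ⊤) {y : ℝ} (hy : 0 < y)
    (h1 : max (max (lam i - lam 1) (lam 1 * a - lam 1)) (-lam j) + 10 * τ * (1 + lam 1) ≤ -y)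
    (h2 : max (max (lam i - lam 1) (lam 1 * a - lam 1)) (-lam j) + 9 * τ' * (1 + lam 1) +
      (lam (j + 1) + τ') < 0)
    (h3 : (lam (j + 1) + τ') * ((1 + τ) * (1 + τ')) < y)
    {φ : ℝ → ℝ} (hφ : φ ∈ T.CiPaG E D a i) (hφ' : φ ∈ T.CiPaG E D' a i)
    (h0 : T.IsCorrection E D (-(j : ℤ)) φ 0) : T.IsCorrection E D' (-(j : ℤ)) φ 0 := by
  have hC' : 0 ≤ C' := zero_le_one.trans hF'.one_le
  have hpos := hT.len_pos
  have hτ := hA.pos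
  have hτ' := hA'.pos
  have hl := hA.lam_one_pos
  obtain ⟨B, hB, hsup⟩ := hF.exists_sup_bound hT hA hi
  obtain ⟨B', hB', hmean⟩ := hF'.exists_mean_bound hT hA' hi
  obtain ⟨_, _, hst⟩ := hF'.exists_hstar hT hA' hi
  obtain ⟨hu, hcor, -⟩ := hst φ hφ'
  obtain ⟨Y, hY, hZ⟩ := hF.exists_Z_le hτ
  obtain ⟨c, hc, hR⟩ := hF'.exists_rsum_le_index hF hT hl hτ'
  set u := T.corr E D' (-(j : ℤ)) φ
  have hint := integrableOn_of_mem hpos hA.a_lt_one hφ.1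
  set χ : ℝ → ℝ := fun x => φ x - T.stepFun u x with hχ
  have hintχ : IntegrableOn χ T.domain := hint.sub (integrableOn_stepFun hpos u)
  have hχd := (pieceDeriv_deriv hφ.1).sub_stepFun hpos u
  have hχ0 : T.IsCorrection E D' (-(j : ℤ)) χ 0 :=
    hF'.isCorrection_sub_stepFun hT (by have := hA.le; omega) (by omega) hint hu hcor
  have hmχ := hmean φ hφ' χ hχd hχ0
  have hsφ := hsup φ hφ h0
  have hI : 0 ≤ ∫ x in T.domain, |φ x| := integral_nonneg fun _ => abs_nonneg _
  have hN : 0 ≤ T.normPa a 1 φ := by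
    rw [normPa_one]
    exact add_nonneg hI (normPa_deriv_nonneg hpos hφ.1)
  have hN' : 0 ≤ ‖T.mean χ‖ + T.normPa a 0 (deriv φ) :=
    add_nonneg (norm_nonneg _) (normPa_deriv_nonneg hpos hφ.1)
  set N := T.normPa a 1 φ
  set N' := ‖T.mean χ‖ + T.normPa a 0 (deriv φ)
  set X := max (max (lam i - lam 1) (lam 1 * a - lam 1)) (-lam j)
  set p := (1 + τ) * (1 + τ') with hp
  have hp0 : 0 < p := by positivity
  set G := Real.exp (y * ((p + c) / p + C)) with hG
  suffices u = 0 by rwa [this] at hcor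
  refine hT.eq_zero_of_tendsto (n := D'.n) hu (b := fun k =>
    C' * C' * (Y * B * N * G) * Real.exp ((lam (j + 1) + τ' - y / p) * D'.rsum 0 k) +
    C' * (B' * N') * Real.exp ((X + 9 * τ' * (1 + lam 1) + (lam (j + 1) + τ')) *
      D'.rsum 0 k)) (fun k => ?_) ?_
  · obtain ⟨m, hm, hm'⟩ := hF.exists_between (D'.n k)
    have htk := FrameBounds.total_pos hT D'.n k
    have hposm := (hT.acc D.n m).len_pos
    have e1 : ∫ x in (T.acc D'.n k).domain, |T.S D'.n 0 k φ x| ≤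
        (T.acc D'.n k).total * (Y * B * N * Real.exp (-y * D.rsum 0 m)) := by
      have hEE : Real.exp (τ * D.rsum 0 m) *
          Real.exp ((X + 9 * τ * (1 + lam 1)) * D.rsum 0 m) ≤ Real.exp (-y * D.rsum 0 m) := by
        rw [← Real.exp_add, ← add_mul]
        refine exp_mul_le_exp_mul ?_ (hF.rsum_nonneg m)
        have : 0 ≤ τ * lam 1 := by positivity
        linarith
      calc ∫ x in (T.acc D'.n k).domain, |T.S D'.n 0 k φ x|
          ≤ (T.acc D.n m).total *
              (B * Real.exp ((X + 9 * τ * (1 + lam 1)) * D.rsum 0 m) * N) :=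
            (hF.integral_abs_S_le hF' hT hm hint).trans
              (integral_abs_le_of_inner hposm (hF.integrableOn_S hT hint m) (hsφ m))
        _ ≤ (Y * Real.exp (τ * D.rsum 0 m) * (T.acc D'.n k).total) *
              (B * Real.exp ((X + 9 * τ * (1 + lam 1)) * D.rsum 0 m) * N) :=
            mul_le_mul_of_nonneg_right ((hF.total_le_opNorm_mul_total hT hm'.le).trans
              (mul_le_mul_of_nonneg_right (hZ m) htk.le)) (by positivity)
        _ = Y * B * N * (T.acc D'.n k).total * (Real.exp (τ * D.rsum 0 m) *
              Real.exp ((X + 9 * τ * (1 + lam 1)) * D.rsum 0 m)) := by ring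
        _ ≤ Y * B * N * (T.acc D'.n k).total * Real.exp (-y * D.rsum 0 m) :=
            mul_le_mul_of_nonneg_left hEE (by positivity)
        _ = _ := by ring
    have e2 : Real.exp (-y * D.rsum 0 m) ≤ G * Real.exp (-(y / p) * D'.rsum 0 k) := by
      rw [hG, ← Real.exp_add, Real.exp_le_exp]
      have e3 := hR k (m + 1) hm'.le
      have e4 := hF.le_rsum m
      push_cast at e3
      have e5 : D'.rsum 0 k / p ≤ D.rsum 0 m + ((p + c) / p + C) := by
        have e6 : D'.rsum 0 k / p ≤ m + (p + c) / p := by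
          rw [← sub_le_iff_le_add, ← sub_div, div_le_iff₀ hp0]
          linarith
        linarith
      have e6 := mul_le_mul_of_nonneg_left e5 hy.le
      have e7 : -(y / p) * D'.rsum 0 k = -(y * (D'.rsum 0 k / p)) := by ring
      rw [e7]
      linarith
    have hposk := (hT.acc D'.n k).len_pos
    have e4 := norm_mean_le hposk (hF'.balanced k) (hF'.integrableOn_S hT hint k)
    have e6 : ‖(T.Q D'.n 0 k).mulVec u‖ ≤
        C' * (Y * B * N * (G * Real.exp (-(y / p) * D'.rsum 0 k))) +
        B' * Real.exp ((X + 9 * τ' * (1 + lam 1)) * D'.rsum 0 k) * N' := by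
      rw [hF'.mulVec_eq_mean_sub hT hint (fun α x _ => rfl : ∀ α, EqOn χ _ (T.inner α)) k]
      refine (norm_sub_le _ _).trans (add_le_add (e4.trans ?_) (hmχ k))
      rw [div_mul_eq_mul_div, div_le_iff₀ htk]
      refine (mul_le_mul_of_nonneg_left (e1.trans (mul_le_mul_of_nonneg_left
        (mul_le_mul_of_nonneg_left e2 (by positivity)) htk.le)) hC').trans (le_of_eq (by ring))
    have e7 := hF'.normQInv_neg 0 k (Nat.zero_le k) j hA.le
    rw [D'.rsum_self, sub_zero] at e7
    refine (mul_le_mul e7 e6 (norm_nonneg _) (by positivity)).trans (le_of_eq ?_)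
    have x1 : Real.exp ((lam (j + 1) + τ' - y / p) * D'.rsum 0 k) =
        Real.exp ((lam (j + 1) + τ') * D'.rsum 0 k) * Real.exp (-(y / p) * D'.rsum 0 k) := by
      rw [← Real.exp_add]; ring_nf
    have x2 : Real.exp ((X + 9 * τ' * (1 + lam 1) + (lam (j + 1) + τ')) * D'.rsum 0 k) =
        Real.exp ((lam (j + 1) + τ') * D'.rsum 0 k) *
          Real.exp ((X + 9 * τ' * (1 + lam 1)) * D'.rsum 0 k) := by
      rw [← Real.exp_add]; ring_nf
    rw [x1, x2]
    ring
  · have h4 : lam (j + 1) + τ' < y / p := (lt_div_iff₀ hp0).2 h3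
    have t1 := (hF'.tendsto_exp_rsum (x := lam (j + 1) + τ' - y / p) (by linarith)).const_mul
      (C' * C' * (Y * B * N * G))
    have t2 := (hF'.tendsto_exp_rsum
      (x := X + 9 * τ' * (1 + lam 1) + (lam (j + 1) + τ')) h2).const_mul (C' * (B' * N'))
    simpa using t1.add t2

end Transfer

section Main

variable {T : IETData 𝒜 d} {g : ℕ} {lam : ℕ → ℝ} {E : ℤ → Submodule ℝ (𝒜 → ℝ)} {a τ : ℝ}
  {i j : ℕ}

theorem IsOseledets.admissible {m : ℕ → ℕ} (h : T.IsOseledets m g lam E) (ha0 : 0 ≤ a)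
    (ha1 : a < 1) (hi2 : 2 ≤ i) (hig : i ≤ g + 1) (hj1 : 1 ≤ j) (hjg : j ≤ g) (hτ : 0 < τ)
    (hτj : 9 * τ * (1 + lam 1) < lam 1 - lam (j + 1) - max (lam i) (lam 1 * a))
    (hτi : 3 * τ * (1 + lam 1) < lam (i - 1) - lam 1 * a) : Admissible g lam a i j τ := by
  have hl : 0 < lam 1 :=
    (h.lam_nonneg (by omega) (by omega)).trans_lt (h.lam_anti 1 le_rfl (hj1.trans hjg))
  have hli := h.lam_nonneg (by omega : 1 ≤ i) hig
  have hlj := h.lam_nonneg (by omega : 1 ≤ j + 1) (by omega)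
  refine ⟨hτ, ?_, hl, ha0, ha1, hi2, hig, h.lam_antitone le_rfl (by omega) (by omega), hli, hj1,
    hjg, hlj, hτi, hτj⟩
  have h1 : 0 ≤ max (lam i) (lam 1 * a) := hli.trans (le_max_left _ _)
  refine le_of_mul_le_mul_right ?_ (by linarith : 0 < 1 + lam 1)
  have h2 : 0 ≤ τ * (1 + lam 1) := by positivity
  linarith

theorem primitive_zero (T : IETData 𝒜 d) (x : ℝ) : T.primitive 0 x = 0 := by
  simp [primitive, stepFun]

/-- The operator `𝔥_{-j,i}` of a frame. -/
def correctionOperator (T : IETData 𝒜 d) (E : ℤ → Submodule ℝ (𝒜 → ℝ)) (D : Frame 𝒜) (i j : ℕ)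
    (φ : ℝ → ℝ) : 𝒜 → ℝ :=
  T.corr E D (-(j : ℤ)) fun x => φ x - T.primitive (T.corr E D i (deriv φ)) x

variable {D : Frame 𝒜} {C : ℝ}

theorem FrameBounds.sub_primitive_mem_CiPaG (hF : T.FrameBounds g lam E τ D C) (hT : T.Regular)
    (ha1 : a < 1) (hig : i ≤ g + 1) {φ : ℝ → ℝ} (hφ : φ ∈ T.CPaG a 1)
    {h : 𝒜 → ℝ} (hh : h ∈ D.U i) (hc : T.IsCorrection E D i (deriv φ) h) :
    (fun x => φ x - T.primitive h x) ∈ T.CiPaG E D a i :=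
  ⟨sub_primitive_mem hT.len_pos hφ h, hF.isCorrection_congr hT
    (fun α => (deriv_sub_primitive_eq_stepFun hT.len_pos hφ h α).symm)
    (hF.isCorrection_sub_stepFun hT (by omega) (by exact_mod_cast hig)
      (integrableOn_deriv hT.len_pos ha1 hφ) hh hc)⟩

theorem FrameBounds.exists_correctionOperator (hF : T.FrameBounds g lam E τ D C)
    (hT : T.Regular) (hA : Admissible g lam a i j τ) (hi : E i ≠ ⊤) :
    ∃ B : ℝ, 0 ≤ B ∧ ∀ φ ∈ T.CPaG a 1,
      T.correctionOperator E D i j φ ∈ D.U (-(j : ℤ)) ∧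
      ‖T.correctionOperator E D i j φ‖ ≤ B * T.normPa a 1 φ ∧
      T.corr E D i (deriv φ) ∈ D.U (i : ℤ) ∧
      T.IsCorrection E D i (deriv φ) (T.corr E D i (deriv φ)) ∧
      T.IsCorrection E D (-(j : ℤ)) (fun x => φ x - T.primitive (T.corr E D i (deriv φ)) x)
        (T.correctionOperator E D i j φ) := by
  obtain ⟨B₁, hB₁, h₁⟩ := hF.exists_correction_deriv hT hA hi
  obtain ⟨B₂, hB₂, h₂⟩ := hF.exists_hstar hT hA hi
  have hpos := hT.len_pos
  have ht := IETData.total_pos hpos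
  refine ⟨B₂ * (1 + (T.total * T.total + T.total) * B₁), by positivity, fun φ hφ => ?_⟩
  obtain ⟨h, hh, hc, hle⟩ := (h₁ φ hφ).1
  have hmem := hF.sub_primitive_mem_CiPaG hT hA.a_lt_one hA.le_succ hφ hh hc
  obtain ⟨e1, e2, e3⟩ := h₂ _ hmem
  rw [correctionOperator, hc.corr_eq]
  refine ⟨e1, e3.trans ?_, hh, hc, e2⟩
  rw [mul_assoc]
  refine mul_le_mul_of_nonneg_left
    ((normPa_sub_primitive_le hpos hA.a_lt_one hφ h).trans ?_) hB₂
  have e4 := hle.trans (mul_le_mul_of_nonneg_left (T.normPa_deriv_le a φ) hB₁)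
  have e5 := mul_le_mul_of_nonneg_left e4 (by positivity : 0 ≤ T.total * T.total + T.total)
  linarith

theorem FrameBounds.linearOn_correctionOperator (hF : T.FrameBounds g lam E τ D C)
    (hT : T.Regular) (hA : Admissible g lam a i j τ) (hi : E i ≠ ⊤) :
    LinearOn (T.CPaG a 1) (T.correctionOperator E D i j) := by
  obtain ⟨B, -, hop⟩ := hF.exists_correctionOperator hT hA hi
  have hpos := hT.len_pos
  intro s t φ ψ hφ hψ hφψ
  obtain ⟨-, -, -, h1, h2⟩ := hop φ hφ
  obtain ⟨-, -, hU, h1', h2'⟩ := hop ψ hψ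
  obtain ⟨-, -, -, h1'', h2''⟩ := hop _ hφψ
  have e1 : T.corr E D i (deriv (s • φ + t • ψ)) =
      s • T.corr E D i (deriv φ) + t • T.corr E D i (deriv ψ) := by
    refine (hF.isCorrection_congr hT (fun α x hx => ?_) (hF.isCorrection_linear hT
      (integrableOn_deriv hpos hA.a_lt_one hφ) (integrableOn_deriv hpos hA.a_lt_one hψ)
      h1 h1' s t)).corr_eq
    have d1 := ((pieceDeriv_deriv hφ α).2 x hx).const_mul s
    have d2 := ((pieceDeriv_deriv hψ α).2 x hx).const_mul t
    exact (d1.add d2).deriv.symm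
  refine h2''.unique ?_
  rw [e1]
  refine hF.isCorrection_congr hT (fun α x _ => ?_) (hF.isCorrection_linear hT
    (integrableOn_of_mem hpos hA.a_lt_one (sub_primitive_mem hpos hφ _))
    (integrableOn_of_mem hpos hA.a_lt_one (sub_primitive_mem hpos hψ _)) h2 h2' s t)
  simp only [primitive_linear, Pi.add_apply, Pi.smul_apply, smul_eq_mul]
  ring

end Main

end IETData

end

theorem theorem4p3 {𝒜 : Type*} [Fintype 𝒜] [DecidableEq 𝒜] {d : ℕ} (T : IETData 𝒜 d)
    (g : ℕ) (lam : ℕ → ℝ) (E : ℤ → Submodule ℝ (𝒜 → ℝ)) (hT : T.FFDC g lam E)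
    (a : ℝ) (ha0 : 0 ≤ a) (ha1 : a < 1)
    (i : ℕ) (hi2 : 2 ≤ i) (hig : i ≤ g + 1) (j : ℕ) (hj1 : 1 ≤ j) (hjg : j ≤ g)
    (hai : a * lam 1 < lam (i - 1))
    (hij : max (a * lam 1) (lam i) < lam 1 - lam (j + 1)) :
    -- the operator `𝔥*_j` on `C_i^{1+P_aG}`
    (∀ τ : ℝ, 0 < τ →
      τ < (lam 1 - lam (j + 1) - max (a * lam 1) (lam i)) / (9 * (1 + lam 1)) →
      τ < (lam (i - 1) - lam 1 * a) / (3 * (1 + lam 1)) →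
      ∀ D : IETData.Frame 𝒜, T.IsFrame g lam E τ D →
        (∃ hstar : (ℝ → ℝ) → (𝒜 → ℝ),
          (∀ φ ∈ T.CiPaG E D a i, hstar φ ∈ D.U (-(j : ℤ)) ∧
            T.IsCorrection E D (-(j : ℤ)) φ (hstar φ)) ∧
          LinearOn (T.CiPaG E D a i) hstar ∧
          ∃ B : ℝ, ∀ φ ∈ T.CiPaG E D a i, ‖hstar φ‖ ≤ B * T.normPa a 1 φ) ∧
        (∀ k : ℕ, Summable (fun m : ℕ => T.Kterm D a i τ k (k + m))) ∧
        (∀ k : ℕ, Summable (fun m : ℕ => T.Vterm D j τ (T.sSeq E D a i τ) k (k + m))) ∧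
        (∃ C : ℝ, 1 ≤ C ∧ ∀ φ ∈ T.CiPaG E D a i, T.IsCorrection E D (-(j : ℤ)) φ 0 →
          ∀ k : ℕ,
            (T.acc D.n k).Var (T.S D.n 0 k φ) ≤
              ENNReal.ofReal (C * T.sSeq E D a i τ k * T.normPa a 0 (deriv φ)) ∧
            ‖(T.acc D.n k).mean (T.S D.n 0 k φ)‖ ≤
              C * ((T.Wseries E D j τ (T.sSeq E D a i τ) k +
                    T.Vseries D j τ (T.sSeq E D a i τ) k) * T.normPa a 0 (deriv φ) +
                  T.normQ D.n (E (-(j : ℤ))) 0 k * T.supNorm φ)) ∧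
        (∃ C : ℝ, ∀ k : ℕ, T.sSeq E D a i τ k ≤
          C * Real.exp ((max (lam i) (lam 1 * a) - lam 1 + 6 * τ * (1 + lam 1)) *
            D.rsum 0 (k + 1))) ∧
        (∃ C : ℝ, ∀ k : ℕ, T.Vseries D j τ (T.sSeq E D a i τ) k ≤
          C * Real.exp ((max (lam i) (lam 1 * a) - lam 1 + 8 * τ * (1 + lam 1)) *
            D.rsum 0 k)) ∧
        (∃ C : ℝ, ∀ k : ℕ, T.Wseries E D j τ (T.sSeq E D a i τ) k ≤
          C * Real.exp ((max (max (lam i - lam 1) (lam 1 * a - lam 1)) (-lam j) +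
            9 * τ * (1 + lam 1)) * D.rsum 0 k))) ∧
    -- the operator `𝔥_{-j,i}` on `C^{1+P_aG}`
    (∃ τs : ℝ, 0 < τs ∧ ∀ τ₀ : ℝ, 0 < τ₀ → τ₀ ≤ τs →
      ∀ D₀ : IETData.Frame 𝒜, T.IsFrame g lam E τ₀ D₀ →
        ∃ hop : (ℝ → ℝ) → (𝒜 → ℝ),
          (∀ φ ∈ T.CPaG a 1, hop φ ∈ D₀.U (-(j : ℤ))) ∧
          LinearOn (T.CPaG a 1) hop ∧
          (∃ B : ℝ, ∀ φ ∈ T.CPaG a 1, ‖hop φ‖ ≤ B * T.normPa a 1 φ) ∧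
          (∀ φ ∈ T.CPaG a 1, ∃ h ∈ D₀.U (i : ℤ), T.IsCorrection E D₀ i (deriv φ) h ∧
            T.IsCorrection E D₀ (-(j : ℤ)) (fun x => φ x - T.primitive h x) (hop φ)) ∧
          ∀ τ : ℝ, 0 < τ → ∀ τ₁ : ℝ, 0 < τ₁ → τ₁ ≤ τs → 9 * τ₁ * (1 + lam 1) ≤ τ →
            ∀ D₁ : IETData.Frame 𝒜, T.IsFrame g lam E τ₁ D₁ →
              ∃ C : ℝ, ∀ φ ∈ T.CPaG a 1, hop φ = 0 → T.IsCorrection E D₀ i (deriv φ) 0 →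
                ∀ (k : ℕ) (α : 𝒜), ∀ x ∈ (T.acc D₁.n k).inner α,
                  |T.S D₁.n 0 k φ x| ≤
                    C * Real.exp ((max (max (lam i - lam 1) (lam 1 * a - lam 1)) (-lam j) + τ) *
                      D₁.rsum 0 k) * T.normPa a 1 φ) := by
  obtain ⟨m₀, -, hO⟩ := hT.oseledets
  have hR := hT.regular (hj1.trans hjg)
  have hi := hO.ne_top hi2 hig
  have hl : 0 < lam 1 :=
    (hO.lam_nonneg (by omega) (by omega)).trans_lt (hO.lam_anti 1 le_rfl (hj1.trans hjg))
  have hL : 0 < 1 + lam 1 := by linarith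
  rw [mul_comm a] at hai hij
  rw [max_comm] at hij
  constructor
  · intro τ hτ hτj hτi D hD
    rw [mul_comm a, max_comm, lt_div_iff₀ (by positivity)] at hτj
    rw [lt_div_iff₀ (by positivity)] at hτi
    have hA := hO.admissible ha0 ha1 hi2 hig hj1 hjg hτ (by linarith) (by linarith)
    obtain ⟨C, hF⟩ := hD.frameBounds hR hτ
    obtain ⟨hK, hV, -, ⟨A, hA0, hs⟩, ⟨A₁, -, hV'⟩, A₂, -, hW'⟩ := hF.series_bounds hR hA
    obtain ⟨B, -, hst⟩ := hF.exists_hstar hR hA hi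
    refine ⟨⟨T.corr E D (-(j : ℤ)), fun φ hφ => ⟨(hst φ hφ).1, (hst φ hφ).2.1⟩,
      hF.linearOn_corr hR ha1 (fun φ hφ => hφ.1) fun φ hφ => (hst φ hφ).2.1, B,
      fun φ hφ => (hst φ hφ).2.2⟩, hK, hV, hF.exists_estimates hR hA hi,
      ⟨A, fun k => (hs k).trans ?_⟩, ⟨A₁, hV'⟩, A₂, hW'⟩
    refine mul_le_mul_of_nonneg_left (exp_mul_le_exp_mul ?_ (hF.rsum_nonneg _)) hA0
    have : 0 ≤ τ * (1 + lam 1) := by positivity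
    linarith
  set M := max (lam i) (lam 1 * a) with hM
  have hlj := hO.lam_nonneg (by omega : 1 ≤ j + 1) (by omega)
  have hli := hO.lam_nonneg (by omega : 1 ≤ i) hig
  have hl1 := hO.lam_antitone (by omega : 1 ≤ i - 1) (by omega : i - 1 ≤ i) hig
  have hl2 : lam (i - 1) ≤ lam 1 := hO.lam_antitone le_rfl (by omega) (by omega)
  have hlj1 : lam (j + 1) < lam j := hO.lam_anti j hj1 hjg
  have hlij : lam i < lam (i - 1) := by
    have := hO.lam_anti (i - 1) (by omega) (by omega)
    rwa [Nat.sub_add_cancel (by omega)] at this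
  have hM0 : 0 ≤ M := hli.trans (le_max_left _ _)
  have hMa : lam 1 * a ≤ M := le_max_right _ _
  have hMi : M < lam (i - 1) := max_lt hlij hai
  set X := max (max (lam i - lam 1) (lam 1 * a - lam 1)) (-lam j) with hX
  have hMX : M - lam 1 ≤ X := by
    rw [hX, max_sub_sub_right]
    exact le_max_left _ _
  have hXj : X < -lam (j + 1) := by
    rw [hX, max_sub_sub_right]
    exact max_lt (by linarith) (by linarith)
  set γ := min (lam (i - 1) - M) (-lam (j + 1) - X) with hγ
  have hγ0 : 0 < γ := lt_min (by linarith) (by linarith)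
  have hγ1 : γ ≤ lam (i - 1) - M := min_le_left _ _
  have hγ2 : γ ≤ -lam (j + 1) - X := min_le_right _ _
  set τs := γ / (24 * (1 + lam 1)) with hτs
  have hτs0 : 0 < τs := by positivity
  have hsmall : ∀ τ, 0 < τ → τ ≤ τs → 24 * (τ * (1 + lam 1)) ≤ γ := fun τ _ hle => by
    rw [hτs, le_div_iff₀ (by positivity)] at hle
    linarith
  have hadm : ∀ τ, 0 < τ → τ ≤ τs → IETData.Admissible g lam a i j τ := fun τ hτ hle => by
    have h1 := hsmall τ hτ hle
    have h2 : 0 < τ * (1 + lam 1) := by positivity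
    exact hO.admissible ha0 ha1 hi2 hig hj1 hjg hτ (by linarith) (by linarith)
  refine ⟨τs, hτs0, fun τ₀ hτ₀ hτ₀s D₀ hD₀ => ?_⟩
  have hA := hadm τ₀ hτ₀ hτ₀s
  obtain ⟨C, hF⟩ := hD₀.frameBounds hR hτ₀
  obtain ⟨B, -, hop⟩ := hF.exists_correctionOperator hR hA hi
  refine ⟨T.correctionOperator E D₀ i j, fun φ hφ => (hop φ hφ).1,
    hF.linearOn_correctionOperator hR hA hi, ⟨B, fun φ hφ => (hop φ hφ).2.1⟩,
    fun φ hφ => ⟨_, (hop φ hφ).2.2⟩, fun τ _ τ₁ hτ₁ hτ₁s hττ₁ D₁ hD₁ => ?_⟩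
  have hA' := hadm τ₁ hτ₁ hτ₁s
  obtain ⟨C', hF'⟩ := hD₁.frameBounds hR hτ₁
  obtain ⟨B', hB', hsup⟩ := hF'.exists_sup_bound hR hA' hi
  refine ⟨B', fun φ hφ h0 hc k α x hx => ?_⟩
  have hφ₀ : φ ∈ T.CiPaG E D₀ a i := ⟨hφ, hc⟩
  have hc₀ : T.IsCorrection E D₀ (-(j : ℤ)) φ 0 := by
    have := (hop φ hφ).2.2.2.2
    rw [hc.corr_eq, h0] at this
    simpa only [IETData.primitive_zero, sub_zero] using this
  set t := max τ₀ τ₁ with ht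
  have ht0 : 0 < t := hτ₀.trans_le (le_max_left _ _)
  have hts := hsmall t ht0 (max_le hτ₀s hτ₁s)
  have ht₀ : τ₀ ≤ t := le_max_left _ _
  have ht₁ : τ₁ ≤ t := le_max_right _ _
  have ht1 : t ≤ 1 := max_le hA.le_one hA'.le_one
  have htl : 0 ≤ t * lam 1 := by positivity
  have hp : (1 + τ₀) * (1 + τ₁) ≤ 1 + 3 * t := by
    have h1 : (1 + τ₀) * (1 + τ₁) ≤ (1 + t) * (1 + t) :=
      mul_le_mul (by linarith) (by linarith) (by linarith) (by linarith)
    have h2 : t * t ≤ t := mul_le_of_le_one_left ht0.le ht1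
    linarith
  have hm₀ : τ₀ * (1 + lam 1) ≤ t * (1 + lam 1) := mul_le_mul_of_nonneg_right ht₀ hL.le
  have hm₁ : τ₁ * (1 + lam 1) ≤ t * (1 + lam 1) := mul_le_mul_of_nonneg_right ht₁ hL.le
  have h1 : (M + 4 * τ₀ * (1 + lam 1)) * ((1 + τ₀) * (1 + τ₁)) + τ₁ < lam (i - 1) := by
    have e1 : (M + 4 * τ₀ * (1 + lam 1)) * ((1 + τ₀) * (1 + τ₁)) ≤
        (M + 4 * (t * (1 + lam 1))) * (1 + 3 * t) :=
      mul_le_mul (by linarith) hp (by positivity) (by positivity)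
    have e2 : M * t ≤ lam 1 * t := mul_le_mul_of_nonneg_right (by linarith) ht0.le
    have e3 : t * (t * (1 + lam 1)) ≤ t * (1 + lam 1) :=
      mul_le_of_le_one_left (by positivity) ht1
    linarith
  have h2 : M + 3 * τ₁ * (1 + lam 1) + τ₁ < lam (i - 1) := by linarith
  have hc' := hF.isCorrection_transfer hF' hR hA hA' hi h1 h2 hφ hc
  have hφ₁ : φ ∈ T.CiPaG E D₁ a i := ⟨hφ, hc'⟩
  have h3 : (lam (j + 1) + τ₁) * ((1 + τ₀) * (1 + τ₁)) < lam (j + 1) + γ / 2 := by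
    have e1 : (lam (j + 1) + τ₁) * ((1 + τ₀) * (1 + τ₁)) ≤ (lam (j + 1) + t) * (1 + 3 * t) :=
      mul_le_mul (by linarith) hp (by positivity) (by positivity)
    have e2 : lam (j + 1) * t ≤ lam 1 * t :=
      mul_le_mul_of_nonneg_right (by linarith) ht0.le
    have e3 : t * t ≤ t := mul_le_of_le_one_left ht0.le ht1
    linarith
  have hc₁ := hF.isCorrection_neg_transfer hF' hR hA hA' hi (y := lam (j + 1) + γ / 2)
    (by linarith) (by linarith) (by linarith) h3 hφ₀ hφ₁ hc₀
  refine (hsup φ hφ₁ hc₁ k α x hx).trans ?_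
  refine mul_le_mul_of_nonneg_right (mul_le_mul_of_nonneg_left
    (exp_mul_le_exp_mul (by linarith) (hF'.rsum_nonneg k)) hB') ?_
  rw [IETData.normPa_one]
  exact add_nonneg (integral_nonneg fun _ => abs_nonneg _)
    (IETData.normPa_deriv_nonneg hR.len_pos hφ)
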